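/- **Setting.** A *ball tangle diagram* is a link-type diagram in a disc with four marked boundary points NW, SW, SE, NE; a *spherical tangle diagram* is such a diagram in an annulus, with four marked points NW, SW, SE, NE on the outer boundary circle and four on the inner one (the inside hole). Closed components are allowed. Diagrams are considered up to isotopy, that is, up to isotopy of the projection surface and the tangle Reidemeister moves of types I, II, III and IV (type IV moves an arc, over or under everything, across the inside hole). $\mathbf I$ denotes the spherical tangle diagram consisting of four radial arcs. **The invariant.** Put $A=e^{i\pi/4}$ and, for a link diagram $L$, $\langle L\rangle=\sum_{\sigma}A^{\alpha(\sigma)-\beta(\sigma)}(-A^2-A^{-2})^{d(\sigma)-1}$, where $\sigma$ runs over all states of $L$, $\alpha(\sigma)$ and $\beta(\sigma)$ are the numbers of $A$-type and $B$-type splittings in $\sigma$, and $d(\sigma)$ is the number of circles of the split diagram. For a spherical tangle diagram $S$ and $i,j\in\{1,2\}$ let $S_{ij}$ be the link diagram obtained by filling the inside hole with two vertical arcs ($j=1$) or two horizontal arcs ($j=2$) and then taking the numerator closure (joining NW to NE and SW to SE outside; $i=1$) or the denominator closure (joining NW to SW and NE to SE outside; $i=2$). Then $$F(S)=\left\{ z\begin{pmatrix}\langle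 S_{11}\rangle & -i\langle S_{12}\rangle\\ i\langle S_{21}\rangle & \langle S_{22}\rangle\end{pmatrix} : z\in\mathbb C,\ z^8=1\right\}\cap M_{2\times2}(\mathbb Z),$$ which has the form $\{M,-M\}$ for an integer matrix $M$; $\det F(S)$ denotes $\det M$. **Connect sums.** Let $B$ be a ball tangle diagram and $S$ a spherical tangle diagram. The outer sums $B+_hS$ and $S+_hB$ place the left operand to the left of the right operand and join the NE and SE points of the left one to the NW and SW points of the right one; the outer sums $B+_vS$ and $S+_vB$ place the first operand above the second and join the SW and SE points of the upper one to the NW and NE points of the lower one. Let $S^-$ be $S$ with the inside and the outside hole interchanged (inversion of the annulus keeping all directions, with over and under exchanged at every crossing), and let $B^{h-}$, $B^{v-}$ be $B$ rotated in space by $180^\circ$ about the vertical, respectively the horizontal, axis of the projection plane. The inner sums are $$B\,\overline{+}_h\,S=(S^-+_hB^{h-})^-,\quad S\,\overline{+}_h\,B=(B^{h-}+_hS^-)^-,\quad B\,\overline{+}_v\,S=(S^-+_vB^{v-})^-,\quad S\,\overline{+}_v\,B=(B^{v-}+_vS^-)^-.$$ For a spherical tangle $J$, a spherical tangle $S$ is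 *$J$-reducible* if it is isotopic to one obtained from $J$ by finitely many successive operations, each being one of these eight connect sums with some ball tangle diagram. **Theorem 4.20.** If a spherical tangle $S$ is $\mathbf I$-reducible, then $\det F(S)=n^2$ for some $n\in\mathbb Z$. More generally, if $S$ is $J$-reducible for a spherical tangle $J$, then $\det F(S)=n^2\det F(J)$ for some $n\in\mathbb Z$. -/

import Mathlib

namespace TangleDiagram

/-! ### Diagrams

A diagram is recorded as a combinatorial map: the image of the projection is a graph drawn on the
oriented sphere, whose vertices are the crossings (four-valent), auxiliary bivalent points of the
strands (the joints), and the holes of the tangle, each hole being shrunk to a vertex.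
A half-edge is an edge together with one of its two ends. -/

/-- Half-edges of a diagram with crossings `C`, joints `J` and boundary points `B`.
At a crossing `c` the four half-edges `0, 1, 2, 3` are numbered counterclockwise and the
overstrand is the one which runs through `0` and `2`. -/
inductive HalfEdge (C J B : Type) : Type
  | crossing (c : C) (k : Fin 4)
  | joint (j : J) (e : Bool)
  | boundary (b : B)

/-- A diagram with boundary points `B`. `mate x` is the other end of the edge to which the
half-edge `x` belongs. Joints may be put anywhere on the strands; a circle without crossings is a
closed chain of at least one joint. -/
structure Diagram (B : Type) where
  Crossing : Type
  Joint : Type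
  [finite_crossing : Finite Crossing]
  [finite_joint : Finite Joint]
  mate : HalfEdge Crossing Joint B → HalfEdge Crossing Joint B
  mate_mate : ∀ x, mate (mate x) = x
  mate_ne : ∀ x, mate x ≠ x

attribute [instance] Diagram.finite_crossing Diagram.finite_joint

namespace Diagram

variable {B B₁ B₂ K W : Type}

/-- The half-edges of a diagram. -/
abbrev Half (D : Diagram B) : Type := HalfEdge D.Crossing D.Joint B

/-- Counterclockwise rotation about the vertices, where `r` says how the boundary points are
cyclically arranged around the holes. -/
def rot (D : Diagram B) (r : B → B) : D.Half → D.Half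
  | .crossing c k => .crossing c (k + 1)
  | .joint j e => .joint j (!e)
  | .boundary b => .boundary (r b)

/-- Half-edges that belong to the overstrand of a crossing. -/
def IsOver (D : Diagram B) : D.Half → Prop
  | .crossing _ k => k = 0 ∨ k = 2
  | .joint _ _ => False
  | .boundary _ => False

/-- A diagram can be drawn on the sphere, with the boundary points arranged around the holes by
`r`: every connected component of the graph has Euler characteristic `V - E + F = 2`. (Each
component has at most this Euler characteristic, so that it can be stated for the sum.)
The four quotients are the sets of vertices, faces, edges and connected components. -/
def PlanarWith (D : Diagram B) (r : B → B) : Prop :=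
  Nat.card (Quot fun x y : D.Half => y = D.rot r x)
      + Nat.card (Quot fun x y : D.Half => y = D.rot r (D.mate x))
    = Nat.card (Quot fun x y : D.Half => y = D.mate x)
      + 2 * Nat.card (Quot fun x y : D.Half => y = D.mate x ∨ y = D.rot r x)

/-! ### Operations on diagrams -/

/-- Half-edges of a disjoint union. -/
def unionEquiv (D₁ : Diagram B₁) (D₂ : Diagram B₂) :
    HalfEdge (D₁.Crossing ⊕ D₂.Crossing) (D₁.Joint ⊕ D₂.Joint) (B₁ ⊕ B₂) ≃ D₁.Half ⊕ D₂.Half where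
  toFun
    | .crossing (.inl c) k => .inl (.crossing c k)
    | .crossing (.inr c) k => .inr (.crossing c k)
    | .joint (.inl j) e => .inl (.joint j e)
    | .joint (.inr j) e => .inr (.joint j e)
    | .boundary (.inl b) => .inl (.boundary b)
    | .boundary (.inr b) => .inr (.boundary b)
  invFun
    | .inl (.crossing c k) => .crossing (.inl c) k
    | .inr (.crossing c k) => .crossing (.inr c) k
    | .inl (.joint j e) => .joint (.inl j) e
    | .inr (.joint j e) => .joint (.inr j) e
    | .inl (.boundary b) => .boundary (.inl b)
    | .inr (.boundary b) => .boundary (.inr b)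
  left_inv := by rintro ((c | c) | (j | j) | (b | b)) <;> rfl
  right_inv := by rintro ((c | j | b) | (c | j | b)) <;> rfl

/-- Disjoint union of two diagrams. -/
def union (D₁ : Diagram B₁) (D₂ : Diagram B₂) : Diagram (B₁ ⊕ B₂) where
  Crossing := D₁.Crossing ⊕ D₂.Crossing
  Joint := D₁.Joint ⊕ D₂.Joint
  mate x := (unionEquiv D₁ D₂).symm (Sum.map D₁.mate D₂.mate (unionEquiv D₁ D₂ x))
  mate_mate x := by
    rw [Equiv.apply_symm_apply, Equiv.symm_apply_eq]
    rcases unionEquiv D₁ D₂ x with y | y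
    · simp [D₁.mate_mate]
    · simp [D₂.mate_mate]
  mate_ne x h := by
    rw [Equiv.symm_apply_eq] at h
    rcases hy : unionEquiv D₁ D₂ x with y | y
    · rw [hy] at h; exact D₁.mate_ne y (Sum.inl.inj h)
    · rw [hy] at h; exact D₂.mate_ne y (Sum.inr.inj h)

/-- Half-edges after some pairs of boundary points have been joined. -/
def connectEquiv (D : Diagram W) (e : W ≃ B ⊕ K × Bool) :
    D.Half ≃ HalfEdge D.Crossing (D.Joint ⊕ K) B where
  toFun
    | .crossing c k => .crossing c k
    | .joint j s => .joint (.inl j) s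
    | .boundary w => Sum.elim .boundary (fun p => .joint (.inr p.1) p.2) (e w)
  invFun
    | .crossing c k => .crossing c k
    | .joint (.inl j) s => .joint j s
    | .joint (.inr k) s => .boundary (e.symm (.inr (k, s)))
    | .boundary b => .boundary (e.symm (.inl b))
  left_inv := by
    rintro (c | j | w)
    · rfl
    · rfl
    · rcases h : e w with b | ⟨k, s⟩
      · simp only [h, Sum.elim_inl]
        rw [← h, Equiv.symm_apply_apply]
      · simp only [h, Sum.elim_inr]
        rw [← h, Equiv.symm_apply_apply]
  right_inv := by
    rintro (c | (j | k) | b)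
    · rfl
    · rfl
    · simp
    · simp

/-- Join boundary points in pairs: `e` renames the boundary points which remain, and identifies the
others with pairs `(k, false), (k, true)`; these two are connected, and the point where they meet
becomes a joint. -/
def connect [Finite K] (D : Diagram W) (e : W ≃ B ⊕ K × Bool) : Diagram B where
  Crossing := D.Crossing
  Joint := D.Joint ⊕ K
  mate x := D.connectEquiv e (D.mate ((D.connectEquiv e).symm x))
  mate_mate x := by
    rw [Equiv.symm_apply_apply, D.mate_mate, Equiv.apply_symm_apply]
  mate_ne x h := by
    rw [← Equiv.eq_symm_apply] at h
    exact D.mate_ne _ h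

/-- Half-edges of a diagram which is looked at from behind. -/
def turnEquiv {C J : Type} (e : B₁ ≃ B₂) : HalfEdge C J B₁ ≃ HalfEdge C J B₂ where
  toFun
    | .crossing c k => .crossing c (1 - k)
    | .joint j s => .joint j s
    | .boundary b => .boundary (e b)
  invFun
    | .crossing c k => .crossing c (1 - k)
    | .joint j s => .joint j s
    | .boundary b => .boundary (e.symm b)
  left_inv := by rintro (c | j | b) <;> simp
  right_inv := by rintro (c | j | b) <;> simp

/-- The diagram seen from the other side of the projection surface: the orientation of the surface
is reversed and over and under are exchanged. The boundary points are renamed by `e`. -/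
def turnOver (D : Diagram B₁) (e : B₁ ≃ B₂) : Diagram B₂ where
  Crossing := D.Crossing
  Joint := D.Joint
  mate x := turnEquiv e (D.mate ((turnEquiv e).symm x))
  mate_mate x := by
    rw [Equiv.symm_apply_apply, D.mate_mate, Equiv.apply_symm_apply]
  mate_ne x h := by
    rw [← Equiv.eq_symm_apply] at h
    exact D.mate_ne _ h

/-- Boundary identification for `patch`. -/
def patchEquiv (B K : Type) : (B ⊕ K) ⊕ K ≃ B ⊕ K × Bool where
  toFun
    | .inl (.inl b) => .inl b
    | .inl (.inr k) => .inr (k, false)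
    | .inr k => .inr (k, true)
  invFun
    | .inl b => .inl (.inl b)
    | .inr (k, false) => .inl (.inr k)
    | .inr (k, true) => .inr k
  left_inv := by rintro ((b | k) | k) <;> rfl
  right_inv := by rintro (b | ⟨k, _ | _⟩) <;> rfl

/-- Glue the diagram `X` into `E` along the boundary points `K`. -/
def patch [Finite K] (E : Diagram (B ⊕ K)) (X : Diagram K) : Diagram B :=
  (E.union X).connect (patchEquiv B K)

/-- Boundary identification for `glue`. -/
def glueEquiv (B₁ B₂ K : Type) : (B₁ ⊕ K) ⊕ (B₂ ⊕ K) ≃ (B₁ ⊕ B₂) ⊕ K × Bool where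
  toFun
    | .inl (.inl b) => .inl (.inl b)
    | .inl (.inr k) => .inr (k, false)
    | .inr (.inl b) => .inl (.inr b)
    | .inr (.inr k) => .inr (k, true)
  invFun
    | .inl (.inl b) => .inl (.inl b)
    | .inl (.inr b) => .inr (.inl b)
    | .inr (k, false) => .inl (.inr k)
    | .inr (k, true) => .inr (.inr k)
  left_inv := by rintro ((b | k) | (b | k)) <;> rfl
  right_inv := by rintro ((b | b) | ⟨k, _ | _⟩) <;> rfl

/-- Glue the diagram `X` into `E` along the boundary points `K`, where `X` has further boundary
points. -/
def glue [Finite K] (E : Diagram (B₁ ⊕ K)) (X : Diagram (B₂ ⊕ K)) : Diagram (B₁ ⊕ B₂) :=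
  (E.union X).connect (glueEquiv B₁ B₂ K)

end Diagram

/-! ### Links and the Kauffman bracket -/

/-- Link diagrams. -/
abbrev Link : Type 1 := Diagram Empty

namespace Link

/-- The two ways of splitting a crossing (`true` is the `A`-type splitting). Rotating the overstrand
counterclockwise sweeps the regions between `0, 1` and between `2, 3`; the `A`-type splitting opens
a channel between these two, so that it connects `3` with `0` and `1` with `2`. -/
def split : Bool → Fin 4 → Fin 4
  | true, 0 => 3
  | true, 1 => 2
  | true, 2 => 1
  | true, 3 => 0
  | false, 0 => 1
  | false, 1 => 0
  | false, 2 => 3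
  | false, 3 => 2

/-- The half-edge at which one continues, at the same vertex, after all crossings have been split
according to the state `s`. -/
def through (L : Link) (s : L.Crossing → Bool) : L.Half → L.Half
  | .crossing c k => .crossing c (split (s c) k)
  | .joint j e => .joint j (!e)
  | .boundary b => .boundary b

/-- The number of circles of a state. -/
noncomputable def circles (L : Link) (s : L.Crossing → Bool) : ℕ :=
  Nat.card (Quot fun x y : L.Half => y = L.mate x ∨ y = L.through s x)

/-- `A = exp (i π / 4)`. -/
noncomputable def A : ℂ := Complex.exp (Complex.I * (Real.pi : ℂ) / 4)

/-- The Kauffman bracket at `A = exp (i π / 4)`. -/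
noncomputable def bracket (L : Link) : ℂ :=
  ∑ᶠ s : L.Crossing → Bool,
    A ^ Nat.card {c // s c = true} * A⁻¹ ^ Nat.card {c // s c = false}
      * (-A ^ 2 - A⁻¹ ^ 2) ^ (L.circles s - 1)

end Link

/-! ### Ball tangles and spherical tangles -/

/-- The four marked points of a hole, counterclockwise in the projection plane:
`0` is north-west, `1` south-west, `2` south-east, `3` north-east. -/
abbrev Corner : Type := Fin 4

/-- Diagrams with the boundary of a ball tangle. -/
abbrev Ball : Type 1 := Diagram Corner

/-- Diagrams with the boundary of a spherical tangle: the outside hole on the left, the inside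
hole on the right of the sum. -/
abbrev Spherical : Type 1 := Diagram (Corner ⊕ Corner)

/-- Ball tangle diagrams. The outside hole, as a vertex of a graph on the sphere, sees its
points in the reversed order. -/
def Ball.IsPlanar (X : Ball) : Prop := X.PlanarWith fun c => c - 1

/-- Spherical tangle diagrams. -/
def Spherical.IsPlanar (S : Spherical) : Prop := S.PlanarWith (Sum.map (fun c => c - 1) fun c => c + 1)

/-- A crossingless tangle whose boundary points are matched by `m`. -/
def matching {B : Type} (m : B → B) (h : ∀ b, m (m b) = b) (h' : ∀ b, m b ≠ b) : Diagram B where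
  Crossing := Empty
  Joint := Empty
  mate
    | .crossing c _ => c.elim
    | .joint j _ => j.elim
    | .boundary b => .boundary (m b)
  mate_mate := by
    rintro (c | j | b)
    · exact c.elim
    · exact j.elim
    · exact congrArg HalfEdge.boundary (h b)
  mate_ne := by
    rintro (c | j | b) hx
    · exact c.elim
    · exact j.elim
    · exact h' b (HalfEdge.boundary.inj hx)

namespace Ball

/-- The fundamental tangle 1: two vertical arcs. -/
def fundamental1 : Ball := matching ![1, 0, 3, 2] (by decide) (by decide)

/-- The fundamental tangle 2: two horizontal arcs. -/
def fundamental2 : Ball := matching ![3, 2, 1, 0] (by decide) (by decide)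

/-- Boundary identification for `numerator`: the northern points are joined, and so are the
southern ones. -/
def numeratorEquiv : Corner ≃ Empty ⊕ Bool × Bool where
  toFun
    | 0 => .inr (false, false)
    | 1 => .inr (true, false)
    | 2 => .inr (true, true)
    | 3 => .inr (false, true)
  invFun
    | .inr (false, false) => 0
    | .inr (true, false) => 1
    | .inr (true, true) => 2
    | .inr (false, true) => 3
  left_inv := by decide
  right_inv := by rintro (b | ⟨_ | _, _ | _⟩) <;> first | rfl | exact b.elim

/-- Boundary identification for `denominator`: the western points are joined, and so are the
eastern ones. -/
def denominatorEquiv : Corner ≃ Empty ⊕ Bool × Bool where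
  toFun
    | 0 => .inr (false, false)
    | 1 => .inr (false, true)
    | 2 => .inr (true, false)
    | 3 => .inr (true, true)
  invFun
    | .inr (false, false) => 0
    | .inr (false, true) => 1
    | .inr (true, false) => 2
    | .inr (true, true) => 3
  left_inv := by decide
  right_inv := by rintro (b | ⟨_ | _, _ | _⟩) <;> first | rfl | exact b.elim

/-- The numerator closure. -/
def numerator (X : Ball) : Link := X.connect numeratorEquiv

/-- The denominator closure. -/
def denominator (X : Ball) : Link := X.connect denominatorEquiv

/-- Boundary permutation of the rotation by 180 degrees about the vertical axis. -/
def eastWest : Corner ≃ Corner where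
  toFun := ![3, 2, 1, 0]
  invFun := ![3, 2, 1, 0]
  left_inv := by decide
  right_inv := by decide

/-- Boundary permutation of the rotation by 180 degrees about the horizontal axis. -/
def northSouth : Corner ≃ Corner where
  toFun := ![1, 0, 3, 2]
  invFun := ![1, 0, 3, 2]
  left_inv := by decide
  right_inv := by decide

/-- The rotation of a ball tangle by 180 degrees about the vertical axis of the plane. -/
def hTurn (X : Ball) : Ball := X.turnOver eastWest

/-- The rotation of a ball tangle by 180 degrees about the horizontal axis of the plane. -/
def vTurn (X : Ball) : Ball := X.turnOver northSouth

end Ball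

namespace Spherical

/-- The identity spherical tangle. -/
def identity : Spherical :=
  matching Sum.swap (by simp) (by rintro (c | c) <;> simp)

/-- The ball tangle obtained from `S` by filling its inside hole with `X`. -/
def fill (S : Spherical) (X : Ball) : Ball := S.patch X

/-- The interchange of the inside and the outside hole: inversion of the annulus in its core
circle, which keeps every direction, together with the reflection in the projection plane, so that
the orientation of space is preserved. -/
def interchange (S : Spherical) : Spherical := S.turnOver (Equiv.sumComm Corner Corner)

/-- Boundary identification for the horizontal sum with the ball tangle (first) on the left of the
spherical tangle (second): the eastern points of the first are joined to the western
points of the second. -/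
def hLeftEquiv : Corner ⊕ (Corner ⊕ Corner) ≃ (Corner ⊕ Corner) ⊕ Bool × Bool where
  toFun
    | .inl 0 => .inl (.inl 0)
    | .inl 1 => .inl (.inl 1)
    | .inl 2 => .inr (true, false)
    | .inl 3 => .inr (false, false)
    | .inr (.inl 0) => .inr (false, true)
    | .inr (.inl 1) => .inr (true, true)
    | .inr (.inl 2) => .inl (.inl 2)
    | .inr (.inl 3) => .inl (.inl 3)
    | .inr (.inr c) => .inl (.inr c)
  invFun
    | .inl (.inl 0) => .inl 0
    | .inl (.inl 1) => .inl 1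
    | .inl (.inl 2) => .inr (.inl 2)
    | .inl (.inl 3) => .inr (.inl 3)
    | .inl (.inr c) => .inr (.inr c)
    | .inr (false, false) => .inl 3
    | .inr (true, false) => .inl 2
    | .inr (false, true) => .inr (.inl 0)
    | .inr (true, true) => .inr (.inl 1)
  left_inv := by decide
  right_inv := by decide

/-- Boundary identification for the horizontal sum with the spherical tangle (second) on the left
of the ball tangle (first). -/
def hRightEquiv : Corner ⊕ (Corner ⊕ Corner) ≃ (Corner ⊕ Corner) ⊕ Bool × Bool where
  toFun
    | .inl 0 => .inr (false, false)
    | .inl 1 => .inr (true, false)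
    | .inl 2 => .inl (.inl 2)
    | .inl 3 => .inl (.inl 3)
    | .inr (.inl 0) => .inl (.inl 0)
    | .inr (.inl 1) => .inl (.inl 1)
    | .inr (.inl 2) => .inr (true, true)
    | .inr (.inl 3) => .inr (false, true)
    | .inr (.inr c) => .inl (.inr c)
  invFun
    | .inl (.inl 0) => .inr (.inl 0)
    | .inl (.inl 1) => .inr (.inl 1)
    | .inl (.inl 2) => .inl 2
    | .inl (.inl 3) => .inl 3
    | .inl (.inr c) => .inr (.inr c)
    | .inr (false, false) => .inl 0
    | .inr (true, false) => .inl 1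
    | .inr (false, true) => .inr (.inl 3)
    | .inr (true, true) => .inr (.inl 2)
  left_inv := by decide
  right_inv := by decide

/-- Boundary identification for the vertical sum with the ball tangle (first) above the spherical
tangle (second): the southern points of the first are joined to the northern points of the
second. -/
def vAboveEquiv : Corner ⊕ (Corner ⊕ Corner) ≃ (Corner ⊕ Corner) ⊕ Bool × Bool where
  toFun
    | .inl 0 => .inl (.inl 0)
    | .inl 1 => .inr (false, false)
    | .inl 2 => .inr (true, false)
    | .inl 3 => .inl (.inl 3)
    | .inr (.inl 0) => .inr (false, true)
    | .inr (.inl 1) => .inl (.inl 1)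
    | .inr (.inl 2) => .inl (.inl 2)
    | .inr (.inl 3) => .inr (true, true)
    | .inr (.inr c) => .inl (.inr c)
  invFun
    | .inl (.inl 0) => .inl 0
    | .inl (.inl 1) => .inr (.inl 1)
    | .inl (.inl 2) => .inr (.inl 2)
    | .inl (.inl 3) => .inl 3
    | .inl (.inr c) => .inr (.inr c)
    | .inr (false, false) => .inl 1
    | .inr (true, false) => .inl 2
    | .inr (false, true) => .inr (.inl 0)
    | .inr (true, true) => .inr (.inl 3)
  left_inv := by decide
  right_inv := by decide

/-- Boundary identification for the vertical sum with the spherical tangle (second) above the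
ball tangle (first). -/
def vBelowEquiv : Corner ⊕ (Corner ⊕ Corner) ≃ (Corner ⊕ Corner) ⊕ Bool × Bool where
  toFun
    | .inl 0 => .inr (false, false)
    | .inl 1 => .inl (.inl 1)
    | .inl 2 => .inl (.inl 2)
    | .inl 3 => .inr (true, false)
    | .inr (.inl 0) => .inl (.inl 0)
    | .inr (.inl 1) => .inr (false, true)
    | .inr (.inl 2) => .inr (true, true)
    | .inr (.inl 3) => .inl (.inl 3)
    | .inr (.inr c) => .inl (.inr c)
  invFun
    | .inl (.inl 0) => .inr (.inl 0)
    | .inl (.inl 1) => .inl 1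
    | .inl (.inl 2) => .inl 2
    | .inl (.inl 3) => .inr (.inl 3)
    | .inl (.inr c) => .inr (.inr c)
    | .inr (false, false) => .inl 0
    | .inr (true, false) => .inl 3
    | .inr (false, true) => .inr (.inl 1)
    | .inr (true, true) => .inr (.inl 2)
  left_inv := by decide
  right_inv := by decide

/-- The first outer horizontal connect sum `X +ₕ S`. -/
def outerH₁ (X : Ball) (S : Spherical) : Spherical := (X.union S).connect hLeftEquiv

/-- The second outer horizontal connect sum `S +ₕ X`. -/
def outerH₂ (S : Spherical) (X : Ball) : Spherical := (X.union S).connect hRightEquiv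

/-- The first outer vertical connect sum `X +ᵥ S`. -/
def outerV₁ (X : Ball) (S : Spherical) : Spherical := (X.union S).connect vAboveEquiv

/-- The second outer vertical connect sum `S +ᵥ X`. -/
def outerV₂ (S : Spherical) (X : Ball) : Spherical := (X.union S).connect vBelowEquiv

/-- The first inner horizontal connect sum of `X` and `S`. -/
def innerH₁ (X : Ball) (S : Spherical) : Spherical :=
  (outerH₂ S.interchange X.hTurn).interchange

/-- The second inner horizontal connect sum of `S` and `X`. -/
def innerH₂ (S : Spherical) (X : Ball) : Spherical :=
  (outerH₁ X.hTurn S.interchange).interchange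

/-- The first inner vertical connect sum of `X` and `S`. -/
def innerV₁ (X : Ball) (S : Spherical) : Spherical :=
  (outerV₂ S.interchange X.vTurn).interchange

/-- The second inner vertical connect sum of `S` and `X`. -/
def innerV₂ (S : Spherical) (X : Ball) : Spherical :=
  (outerV₁ X.vTurn S.interchange).interchange

/-! ### The invariant -/

/-- The matrix of normalized brackets of the four links obtained by filling the inside hole with a
fundamental tangle (column) and taking the numerator or denominator closure (row). -/
noncomputable def bracketMatrix (S : Spherical) : Matrix (Fin 2) (Fin 2) ℂ :=
  !![(S.fill Ball.fundamental1).numerator.bracket,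
     -Complex.I * (S.fill Ball.fundamental2).numerator.bracket;
     Complex.I * (S.fill Ball.fundamental1).denominator.bracket,
     -Complex.I * Complex.I * (S.fill Ball.fundamental2).denominator.bracket]

/-- The invariant `F`: the set of all integer matrices among the multiples of the bracket matrix by
eighth roots of unity. -/
def F (S : Spherical) : Set (Matrix (Fin 2) (Fin 2) ℤ) :=
  {M | ∃ z : ℂ, z ^ 8 = 1 ∧ M.map (Int.cast : ℤ → ℂ) = z • S.bracketMatrix}

end Spherical

/-! ### Isotopy of diagrams -/

namespace Diagram

variable {B : Type}

/-- Two diagrams differ by an isotopy of the projection surface (and the names of crossings and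
joints): there is a bijection of the half-edges which is compatible with the edges, the cyclic
order at the vertices, the overstrands and the boundary points. -/
def Iso (D D' : Diagram B) : Prop :=
  ∃ f : D.Half ≃ D'.Half,
    (∀ x, f (D.mate x) = D'.mate (f x)) ∧ (∀ x, f (D.rot id x) = D'.rot id (f x)) ∧
    (∀ x, D'.IsOver (f x) ↔ D.IsOver x) ∧ (∀ b, f (.boundary b) = .boundary b)

/-- `D'` arises from `D` by putting one more joint on the edge through the half-edge `x`. -/
def Subdivides (D D' : Diagram B) : Prop :=
  ∃ (f : D.Half ⊕ Bool ≃ D'.Half) (x : D.Half),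
    D'.mate (f (.inl x)) = f (.inr false) ∧ D'.mate (f (.inl (D.mate x))) = f (.inr true) ∧
    (∀ y, y ≠ x → y ≠ D.mate x → D'.mate (f (.inl y)) = f (.inl (D.mate y))) ∧
    (∀ y, f (.inl (D.rot id y)) = D'.rot id (f (.inl y))) ∧
    (∀ e, f (.inr (!e)) = D'.rot id (f (.inr e))) ∧
    (∀ y, D'.IsOver (f (.inl y)) ↔ D.IsOver y) ∧ (∀ b, f (.inl (.boundary b)) = .boundary b)

end Diagram

/-- A single arc. -/
def arc : Diagram Bool := matching not (by decide) (by decide)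

/-- An arc with one kink: the half-edges `k + 2` and `k + 3` of a crossing are connected. -/
def kink (k : Fin 4) : Diagram Bool where
  Crossing := Unit
  Joint := Empty
  mate
    | .crossing _ i =>
      match i - k with
      | 0 => .boundary false
      | 1 => .boundary true
      | 2 => .crossing () (k + 3)
      | 3 => .crossing () (k + 2)
    | .joint j _ => j.elim
    | .boundary false => .crossing () k
    | .boundary true => .crossing () (k + 1)
  mate_mate := by
    rintro (⟨⟨⟩, i⟩ | j | (_ | _))
    · fin_cases k <;> fin_cases i <;> rfl
    · exact j.elim
    · fin_cases k <;> rfl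
    · fin_cases k <;> rfl
  mate_ne := by
    rintro (⟨⟨⟩, i⟩ | j | (_ | _)) h
    · fin_cases k <;> fin_cases i <;> cases h
    · exact j.elim
    · cases h
    · cases h

/-- Two disjoint arcs: an upper one with ends `0, 3` and a lower one with ends `1, 2`. -/
def parallel : Diagram (Fin 4) := matching ![3, 2, 1, 0] (by decide) (by decide)

/-- The same arcs, the upper one being pulled over the lower one (two crossings). -/
def overlap : Diagram (Fin 4) where
  Crossing := Bool
  Joint := Empty
  mate
    | .boundary 0 => .crossing false 0
    | .boundary 1 => .crossing false 1
    | .crossing false 2 => .crossing true 2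
    | .crossing false 3 => .crossing true 1
    | .boundary 2 => .crossing true 3
    | .boundary 3 => .crossing true 0
    | .crossing false 0 => .boundary 0
    | .crossing false 1 => .boundary 1
    | .crossing true 2 => .crossing false 2
    | .crossing true 1 => .crossing false 3
    | .crossing true 3 => .boundary 2
    | .crossing true 0 => .boundary 3
    | .joint j _ => j.elim
  mate_mate := by
    rintro (⟨_ | _, i⟩ | j | b)
    · fin_cases i <;> rfl
    · fin_cases i <;> rfl
    · exact j.elim
    · fin_cases b <;> rfl
  mate_ne := by
    rintro (⟨_ | _, i⟩ | j | b) h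
    · fin_cases i <;> cases h
    · fin_cases i <;> cases h
    · exact j.elim
    · fin_cases b <;> cases h

/-- A horizontal strand over the two lower legs of a crossing. The boundary points are
`0` east, `1` north-east, `2` north-west, `3` west, `4` south-west, `5` south-east; crossing `2` has
its north-eastern half-edge numbered `k`, and `0`, `1` are the crossings on the strand. -/
def strandBelow (k : Fin 4) : Diagram (Fin 6) where
  Crossing := Fin 3
  Joint := Empty
  mate
    | .crossing 0 0 => .crossing 1 2
    | .crossing 1 2 => .crossing 0 0
    | .crossing 0 2 => .boundary 3
    | .boundary 3 => .crossing 0 2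
    | .crossing 1 0 => .boundary 0
    | .boundary 0 => .crossing 1 0
    | .crossing 0 1 => .crossing 2 (k + 2)
    | .crossing 1 1 => .crossing 2 (k + 3)
    | .crossing 0 3 => .boundary 4
    | .boundary 4 => .crossing 0 3
    | .crossing 1 3 => .boundary 5
    | .boundary 5 => .crossing 1 3
    | .boundary 1 => .crossing 2 k
    | .boundary 2 => .crossing 2 (k + 1)
    | .crossing 2 i =>
      match i - k with
      | 0 => .boundary 1
      | 1 => .boundary 2
      | 2 => .crossing 0 1
      | 3 => .crossing 1 1
    | .joint j _ => j.elim
  mate_mate := by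
    rintro (⟨c, i⟩ | j | b)
    · fin_cases k <;> fin_cases c <;> fin_cases i <;> rfl
    · exact j.elim
    · fin_cases k <;> fin_cases b <;> rfl
  mate_ne := by
    rintro (⟨c, i⟩ | j | b) h
    · fin_cases k <;> fin_cases c <;> fin_cases i <;> cases h
    · exact j.elim
    · fin_cases b <;> cases h

/-- The horizontal strand of `strandBelow`, moved over the crossing to its upper legs. -/
def strandAbove (k : Fin 4) : Diagram (Fin 6) where
  Crossing := Fin 3
  Joint := Empty
  mate
    | .crossing 0 0 => .crossing 1 2
    | .crossing 1 2 => .crossing 0 0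
    | .crossing 0 2 => .boundary 3
    | .boundary 3 => .crossing 0 2
    | .crossing 1 0 => .boundary 0
    | .boundary 0 => .crossing 1 0
    | .crossing 0 3 => .crossing 2 (k + 1)
    | .crossing 1 3 => .crossing 2 k
    | .crossing 0 1 => .boundary 2
    | .boundary 2 => .crossing 0 1
    | .crossing 1 1 => .boundary 1
    | .boundary 1 => .crossing 1 1
    | .boundary 4 => .crossing 2 (k + 2)
    | .boundary 5 => .crossing 2 (k + 3)
    | .crossing 2 i =>
      match i - k with
      | 0 => .crossing 1 3
      | 1 => .crossing 0 3
      | 2 => .boundary 4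
      | 3 => .boundary 5
    | .joint j _ => j.elim
  mate_mate := by
    rintro (⟨c, i⟩ | j | b)
    · fin_cases k <;> fin_cases c <;> fin_cases i <;> rfl
    · exact j.elim
    · fin_cases k <;> fin_cases b <;> rfl
  mate_ne := by
    rintro (⟨c, i⟩ | j | b) h
    · fin_cases k <;> fin_cases c <;> fin_cases i <;> cases h
    · exact j.elim
    · fin_cases b <;> cases h

/-- The neighbourhood of a hole, passed by an arc without crossings. The four strands which start at
the hole are, counterclockwise from `q`, those with outer ends `0, 1, 2, 3`; the arc has the
ends `4, 5`, between the strands `3` and `0`. -/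
def holeFree (q : Corner) : Diagram (Corner ⊕ Fin 6) :=
  matching
    (fun
      | .inl c =>
        match c - q with
        | 0 => .inr 0
        | 1 => .inr 1
        | 2 => .inr 2
        | 3 => .inr 3
      | .inr 0 => .inl q
      | .inr 1 => .inl (q + 1)
      | .inr 2 => .inl (q + 2)
      | .inr 3 => .inl (q + 3)
      | .inr 4 => .inr 5
      | .inr 5 => .inr 4)
    (by revert q; decide) (by revert q; decide)

/-- The arc passes around the hole on the other side, and meets the four strands in the crossings
`0, 1, 2, 3`. At each of them the half-edge pointing away from the hole has the number `o`; the arc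
goes over all strands if `o` is odd, and under all strands if `o` is even. -/
def holeCrossed (q : Corner) (o : Fin 4) : Diagram (Corner ⊕ Fin 6) where
  Crossing := Fin 4
  Joint := Empty
  mate
    | .boundary (.inl c) => .crossing (c - q) (o + 2)
    | .boundary (.inr 0) => .crossing 0 o
    | .boundary (.inr 1) => .crossing 1 o
    | .boundary (.inr 2) => .crossing 2 o
    | .boundary (.inr 3) => .crossing 3 o
    | .boundary (.inr 4) => .crossing 0 (o + 3)
    | .boundary (.inr 5) => .crossing 3 (o + 1)
    | .crossing x i =>
      match i - o, x with
      | 0, 0 => .boundary (.inr 0)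
      | 0, 1 => .boundary (.inr 1)
      | 0, 2 => .boundary (.inr 2)
      | 0, 3 => .boundary (.inr 3)
      | 1, 0 => .crossing 1 (o + 3)
      | 1, 1 => .crossing 2 (o + 3)
      | 1, 2 => .crossing 3 (o + 3)
      | 1, 3 => .boundary (.inr 5)
      | 2, x => .boundary (.inl (q + x))
      | 3, 0 => .boundary (.inr 4)
      | 3, 1 => .crossing 0 (o + 1)
      | 3, 2 => .crossing 1 (o + 1)
      | 3, 3 => .crossing 2 (o + 1)
    | .joint j _ => j.elim
  mate_mate := by
    rintro (⟨c, i⟩ | j | (b | b))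
    · fin_cases q <;> fin_cases o <;> fin_cases c <;> fin_cases i <;> rfl
    · exact j.elim
    · fin_cases q <;> fin_cases o <;> fin_cases b <;> rfl
    · fin_cases q <;> fin_cases o <;> fin_cases b <;> rfl
  mate_ne := by
    rintro (⟨c, i⟩ | j | (b | b)) h
    · fin_cases o <;> fin_cases c <;> fin_cases i <;> cases h
    · exact j.elim
    · cases h
    · fin_cases b <;> cases h

namespace Spherical

/-- Elementary changes of a spherical tangle diagram: isotopies of the projection surface, and the
tangle Reidemeister moves of type I, II, III, IV. -/
inductive Move : Spherical → Spherical → Prop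
  | iso {S S' : Spherical} (h : S.Iso S') : Move S S'
  | subdivide {S S' : Spherical} (h : S.Subdivides S') : Move S S'
  | typeI (E : Diagram ((Corner ⊕ Corner) ⊕ Bool)) (k : Fin 4) :
      Move (E.patch arc) (E.patch (kink k))
  | typeII (E : Diagram ((Corner ⊕ Corner) ⊕ Fin 4)) :
      Move (E.patch parallel) (E.patch overlap)
  | typeIII (E : Diagram ((Corner ⊕ Corner) ⊕ Fin 6)) (k : Fin 4) :
      Move (E.patch (strandBelow k)) (E.patch (strandAbove k))
  | typeIV (E : Diagram (Corner ⊕ Fin 6)) (q : Corner) (o : Fin 4) :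
      Move (E.glue (holeFree q)) (E.glue (holeCrossed q o))

/-- Isotopy of spherical tangle diagrams. -/
def Isotopic : Spherical → Spherical → Prop :=
  Relation.EqvGen fun S S' => S.IsPlanar ∧ S'.IsPlanar ∧ Move S S'

/-! ### Reducibility -/

/-- The outer and inner, horizontal and vertical connect sums and their opposites. -/
inductive SumKind : Type
  | outerH | outerHOp | outerV | outerVOp | innerH | innerHOp | innerV | innerVOp

/-- The connect sum of a spherical tangle (as left operand) and a ball tangle. -/
def SumKind.apply : SumKind → Spherical → Ball → Spherical
  | .outerH, S, X => outerH₂ S X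
  | .outerHOp, S, X => outerH₁ X S
  | .outerV, S, X => outerV₂ S X
  | .outerVOp, S, X => outerV₁ X S
  | .innerH, S, X => innerH₂ S X
  | .innerHOp, S, X => innerH₁ X S
  | .innerV, S, X => innerV₂ S X
  | .innerVOp, S, X => innerV₁ X S

/-- `J`-reducible spherical tangles, up to isotopy: those obtained from `J` by iterated connect sums
with ball tangles. -/
inductive Reducible (J : Spherical) : Spherical → Prop
  | start : Reducible J J
  | sum {S : Spherical} (hS : Reducible J S) (k : SumKind) (X : Ball) (hX : X.IsPlanar) :
      Reducible J (k.apply S X)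
  | isotopic {S S' : Spherical} (hS : Reducible J S) (h : Isotopic S S') : Reducible J S'

end Spherical

end TangleDiagram

namespace TangleDiagram

open Relation

/-! ### Relations whose equivalence closure is total -/

/-! At `A = exp (i π / 4)` a circle has the value `-A² - A⁻² = 0`. The bracket is therefore the sum
of the weights of those states that consist of a single circle, and whether a closed state is a
single circle depends only on two data of the tangle state: that it has no closed component, and how
it connects the boundary points. State sums with values in arbitrary functionals `Φ` of this
connectivity (`eval`) can be glued (`eval_union`), and this makes all computations local.

Connect sums. A state of a planar ball tangle without closed circles connects its corners like two
horizontal or two vertical arcs (`Ball.IsPlanar.joined_eq`). In a horizontal sum, horizontal arcs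
leave the spherical tangle unchanged; vertical arcs either cut off a circle or change the numerator
closure into the denominator closure. Outer sums thus multiply the bracket matrix on the left by a
triangular matrix with equal diagonal entries, and inner sums on the right, since the interchange of
the holes transposes the pairing. The determinant is multiplied by the square of the diagonal entry.

Integrality. By mod 2 homology, a planar diagram has a checkerboard colouring
(`exists_checkerboard`). With it, a one-circle state becomes a permutation with a single cycle on
half of the half-edges, whose sign does not depend on the state. Comparing two states and their
closures shows that the number of crossings at which they differ has the same parity as the number
of holes closed differently (`IsColouring.eight_dvd`). As a weight is `A⁻ᴺ` times `I` to the number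
of `A`-splittings, all closures are Gaussian integers of prescribed type, real or imaginary, up to
one common eighth root of unity (`exists_integral`).

Isotopy. Each Reidemeister move multiplies the local state sum by a power of `A`, which is verified
by enumerating states; for type IV the hole is closed beforehand (`pairing_glue`). Since an integral
multiple of the matrix by an eighth root of unity is unique up to sign (`IsNormalized.F_eq`), the
determinant is well defined and the theorem follows by induction on the reduction. -/

/-- The equivalence closure of `r` has at most one class. -/
def Connects {α : Type*} (r : α → α → Prop) : Prop := ∀ x y, EqvGen r x y

section Connects

variable {α β : Type*} {r : α → α → Prop} {q : β → β → Prop}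

lemma eqvGen_map (f : α → β) (h : ∀ x y, r x y → EqvGen q (f x) (f y)) {x y : α}
    (hxy : EqvGen r x y) : EqvGen q (f x) (f y) := by
  induction hxy with
  | rel x y hr => exact h x y hr
  | refl x => exact .refl _
  | symm x y _ ih => exact .symm _ _ ih
  | trans x y z _ _ ih₁ ih₂ => exact .trans _ _ _ ih₁ ih₂

lemma eqvGen_invariant {γ : Type*} (f : α → γ) (h : ∀ x y, r x y → f x = f y) {x y : α}
    (hxy : EqvGen r x y) : f x = f y := by
  induction hxy with
  | rel x y hr => exact h x y hr
  | refl x => rfl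
  | symm x y _ ih => exact ih.symm
  | trans x y z _ _ ih₁ ih₂ => exact ih₁.trans ih₂

lemma Connects.of_map (f : α → β) (g : β → α) (hf : ∀ x y, r x y → EqvGen q (f x) (f y))
    (hfg : ∀ u, EqvGen q u (f (g u))) (h : Connects r) : Connects q := fun u v =>
  .trans _ _ _ (hfg u) (.trans _ _ _ (eqvGen_map f hf (h (g u) (g v))) (.symm _ _ (hfg v)))

lemma connects_congr_of_maps (f : α → β) (g : β → α) (hf : ∀ x y, r x y → EqvGen q (f x) (f y))
    (hg : ∀ u v, q u v → EqvGen r (g u) (g v)) (hgf : ∀ x, EqvGen r x (g (f x)))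
    (hfg : ∀ u, EqvGen q u (f (g u))) : Connects r ↔ Connects q :=
  ⟨Connects.of_map f g hf hfg, Connects.of_map g f hg hgf⟩

lemma connects_congr_equiv (f : α ≃ β) (h : ∀ x y, r x y ↔ q (f x) (f y)) :
    Connects r ↔ Connects q :=
  connects_congr_of_maps f f.symm (fun x y hr => .rel _ _ ((h x y).1 hr))
    (fun u v hq => .rel _ _ ((h _ _).2 (by simpa using hq))) (fun x => by simpa using .refl x)
    (fun u => by simpa using .refl u)

lemma Connects.mono {r' : α → α → Prop} (h : ∀ x y, r x y → EqvGen r' x y) (hr : Connects r) :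
    Connects r' := fun x y => eqvGen_map id h (hr x y)

lemma connects_iff_card_quot_le [Finite α] : Connects r ↔ Nat.card (Quot r) ≤ 1 := by
  rw [Finite.card_le_one_iff_subsingleton]
  constructor
  · intro h
    refine ⟨fun a b => ?_⟩
    induction a using Quot.ind
    induction b using Quot.ind
    exact Quot.eqvGen_sound (h _ _)
  · intro h x y
    exact Quot.eqvGen_exact (Subsingleton.elim _ _)

end Connects

/-! ### State sums over connected states. -/

namespace Diagram

variable {B B₁ B₂ K W : Type}

instance finite_half [Finite B] (D : Diagram B) : Finite D.Half := by
  let f : D.Half → (D.Crossing × Fin 4) ⊕ (D.Joint × Bool) ⊕ B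
    | .crossing c k => .inl (c, k)
    | .joint j e => .inr (.inl (j, e))
    | .boundary b => .inr (.inr b)
  refine Finite.of_injective f ?_
  rintro (⟨c, k⟩ | ⟨j, e⟩ | b) (⟨c', k'⟩ | ⟨j', e'⟩ | b') h <;> simp_all [f]

/-- The half-edge at which one continues, at the same vertex, after all crossings have been split
according to the state `s`; the boundary points are fixed. -/
def through (D : Diagram B) (s : D.Crossing → Bool) : D.Half → D.Half
  | .crossing c k => .crossing c (Link.split (s c) k)
  | .joint j e => .joint j (!e)
  | .boundary b => .boundary b

/-- Consecutive half-edges of a state. -/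
def Adj (D : Diagram B) (s : D.Crossing → Bool) (x y : D.Half) : Prop :=
  y = D.mate x ∨ y = D.through s x

/-- Consecutive half-edges of a state whose boundary points have been joined by `r`. -/
def Closed (D : Diagram B) (s : D.Crossing → Bool) (r : B → B → Prop) (x y : D.Half) : Prop :=
  D.Adj s x y ∨ ∃ b b', x = .boundary b ∧ y = .boundary b' ∧ r b b'

/-- Every component of the state reaches the boundary. -/
def Spans (D : Diagram B) (s : D.Crossing → Bool) : Prop :=
  ∀ x, ∃ b, EqvGen (D.Adj s) x (.boundary b)

/-- Boundary points which belong to the same component of the state. -/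
def Joined (D : Diagram B) (s : D.Crossing → Bool) (b b' : B) : Prop :=
  EqvGen (D.Adj s) (.boundary b) (.boundary b')

/-- The weight of a state. -/
noncomputable def weight {C : Type} (s : C → Bool) : ℂ :=
  Link.A ^ Nat.card {c // s c = true} * Link.A⁻¹ ^ Nat.card {c // s c = false}

open Classical in
/-- The indicator function of a proposition. -/
noncomputable def indic (p : Prop) : ℂ := if p then 1 else 0

lemma indic_congr {p q : Prop} (h : p ↔ q) : indic p = indic q := by rw [propext h]

lemma indic_of {p : Prop} (h : p) : indic p = 1 := if_pos h

lemma indic_not {p : Prop} (h : ¬p) : indic p = 0 := if_neg h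

/-- The bracket of the diagram after joining the boundary points by `r`: since closed circles
have the value zero, only connected states count. -/
noncomputable def closedSum (D : Diagram B) (r : B → B → Prop) : ℂ :=
  ∑ᶠ s : D.Crossing → Bool, weight s * indic (Connects (D.Closed s r))

/-- The state sum with values in functions of the connectivity of the boundary points. -/
noncomputable def eval (D : Diagram B) (Φ : (B → B → Prop) → ℂ) : ℂ :=
  ∑ᶠ s : D.Crossing → Bool, weight s * (indic (D.Spans s) * Φ (D.Joined s))

/-- A walk that uses a joining at all has a first and a last one; between them it can be recorded by
boundary points alone. -/
lemma Closed.eqvGen_cases {D : Diagram B} {s : D.Crossing → Bool} {r : B → B → Prop} {x y : D.Half}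
    (h : EqvGen (D.Closed s r) x y) :
    EqvGen (D.Adj s) x y ∨ ∃ b b', EqvGen (D.Adj s) x (.boundary b) ∧
      EqvGen (D.Adj s) y (.boundary b') ∧ EqvGen (fun b b' => D.Joined s b b' ∨ r b b') b b' := by
  induction h with
  | rel x y h =>
    rcases h with h | ⟨b, b', rfl, rfl, h⟩
    · exact .inl (.rel _ _ h)
    · exact .inr ⟨b, b', .refl _, .refl _, .rel _ _ (.inr h)⟩
  | refl x => exact .inl (.refl _)
  | symm x y _ ih =>
    rcases ih with h | ⟨b, b', h₁, h₂, h₃⟩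
    · exact .inl (.symm _ _ h)
    · exact .inr ⟨b', b, h₂, h₁, .symm _ _ h₃⟩
  | trans x y z _ _ ih₁ ih₂ =>
    rcases ih₁ with h | ⟨b, b', h₁, h₂, h₃⟩
    · rcases ih₂ with h' | ⟨c, c', h₄, h₅, h₆⟩
      · exact .inl (.trans _ _ _ h h')
      · exact .inr ⟨c, c', .trans _ _ _ h h₄, h₅, h₆⟩
    · rcases ih₂ with h' | ⟨c, c', h₄, h₅, h₆⟩
      · exact .inr ⟨b, b', h₁, .trans _ _ _ (.symm _ _ h') h₂, h₃⟩
      · exact .inr ⟨b, c', h₁, h₅, .trans _ _ _ h₃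
          (.trans _ _ _ (.rel _ _ (.inl (.trans _ _ _ (.symm _ _ h₂) h₄))) h₆)⟩

/-- Without boundary points a single circle would be connected although it reaches no boundary,
which is why `B` is nonempty. -/
lemma connects_closed_iff [Nonempty B] (D : Diagram B) (s : D.Crossing → Bool)
    (r : B → B → Prop) : Connects (D.Closed s r) ↔
      D.Spans s ∧ Connects fun b b' => D.Joined s b b' ∨ r b b' := by
  have key : ∀ x y : D.Half, EqvGen (D.Adj s) x y → EqvGen (D.Closed s r) x y := fun x y h =>
    eqvGen_map id (fun x y h => .rel _ _ (.inl h)) h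
  constructor
  · intro h
    refine ⟨fun x => ?_, fun b b' => ?_⟩
    · obtain ⟨b₀⟩ := ‹Nonempty B›
      rcases Closed.eqvGen_cases (h x (.boundary b₀)) with h | ⟨b, -, h, -⟩
      · exact ⟨b₀, h⟩
      · exact ⟨b, h⟩
    · rcases Closed.eqvGen_cases (h (.boundary b) (.boundary b')) with h | ⟨c, c', h₁, h₂, h₃⟩
      · exact .rel _ _ (.inl h)
      · exact .trans _ _ _ (.rel _ _ (.inl h₁)) (.trans _ _ _ h₃ (.symm _ _ (.rel _ _ (.inl h₂))))
  · rintro ⟨h₁, h₂⟩ x y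
    obtain ⟨b, hb⟩ := h₁ x
    obtain ⟨b', hb'⟩ := h₁ y
    refine .trans _ _ _ (key _ _ hb) (.trans _ _ _ ?_ (.symm _ _ (key _ _ hb')))
    refine eqvGen_map HalfEdge.boundary ?_ (h₂ b b')
    rintro c c' (h | h)
    · exact key _ _ h
    · exact .rel _ _ (.inr ⟨c, c', rfl, rfl, h⟩)

lemma indic_and (p q : Prop) : indic (p ∧ q) = indic p * indic q := by
  by_cases hp : p <;> by_cases hq : q <;> simp [indic, hp, hq]

/-- This separates the tangle from its closure: the closure enters only through a functional of the
connectivity. -/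
lemma closedSum_eq_eval [Nonempty B] (D : Diagram B) (r : B → B → Prop) :
    D.closedSum r = D.eval fun ρ => indic (Connects fun b b' => ρ b b' ∨ r b b') := by
  refine finsum_congr fun s => ?_
  rw [indic_congr (D.connects_closed_iff s r), indic_and]

lemma closedSum_congr (D : Diagram B) {r r' : B → B → Prop} (h : ∀ b b', r b b' ↔ r' b b') :
    D.closedSum r = D.closedSum r' := by
  have : r = r' := by ext b b'; exact h b b'
  rw [this]

/-! ### State sums of composite diagrams -/

section Transfer

variable {C C' : Type}

lemma weight_comp_equiv (σ : C ≃ C') (s : C' → Bool) : weight (s ∘ σ) = weight s := by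
  unfold weight
  congr 2 <;> exact Nat.card_congr (σ.subtypeEquiv fun c => Iff.rfl)

lemma weight_sum [Finite C] [Finite C'] (s : C → Bool) (t : C' → Bool) :
    weight (Sum.elim s t) = weight s * weight t := by
  have h : ∀ v, Nat.card {c // Sum.elim s t c = v}
      = Nat.card {c // s c = v} + Nat.card {c // t c = v} := fun v => by
    rw [Nat.card_congr (Equiv.subtypeSum), Nat.card_sum]
    rfl
  simp only [weight, h, pow_add]
  ring

lemma weight_of_isEmpty [IsEmpty C] (s : C → Bool) : weight s = 1 := by
  simp [weight]

end Transfer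

/-- Half-edge maps under which states with equal connectivity correspond. -/
lemma closedSum_eq_of_equiv {D : Diagram B₁} {D' : Diagram B₂} {r : B₁ → B₁ → Prop}
    {r' : B₂ → B₂ → Prop} (σ : D.Crossing ≃ D'.Crossing)
    (h : ∀ s, Connects (D.Closed (s ∘ σ) r) ↔ Connects (D'.Closed s r')) :
    D.closedSum r = D'.closedSum r' := by
  unfold closedSum
  rw [← finsum_comp_equiv (Equiv.arrowCongr σ (Equiv.refl Bool)).symm]
  refine finsum_congr fun s => ?_
  have e : (Equiv.arrowCongr σ (Equiv.refl Bool)).symm s = s ∘ σ := rfl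
  rw [e, weight_comp_equiv, indic_congr (h s)]

/-- The relation by which the boundary points are joined if first some pairs are connected
and then the remaining points are joined by `r`. -/
def connectRel (e : W ≃ B ⊕ K × Bool) (r : B → B → Prop) (w w' : W) : Prop :=
  Sum.LiftRel r (fun p q : K × Bool => q = (p.1, !p.2)) (e w) (e w')

/-- `connectEquiv`, as a map to the half-edges of the new diagram. -/
def connectHalf [Finite K] (D : Diagram W) (e : W ≃ B ⊕ K × Bool) : D.Half ≃ (D.connect e).Half :=
  D.connectEquiv e

lemma connect_mate [Finite K] (D : Diagram W) (e : W ≃ B ⊕ K × Bool) (x : D.Half) :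
    (D.connect e).mate (D.connectHalf e x) = D.connectHalf e (D.mate x) := by
  show D.connectEquiv e (D.mate ((D.connectEquiv e).symm (D.connectEquiv e x))) = _
  rw [Equiv.symm_apply_apply]
  rfl

lemma connectHalf_boundary_inl [Finite K] (D : Diagram W) {e : W ≃ B ⊕ K × Bool} {w : W} {b : B}
    (h : e w = .inl b) : D.connectHalf e (.boundary w) = .boundary b := by
  show Sum.elim _ _ (e w) = _
  rw [h]
  rfl

lemma connectHalf_boundary_inr [Finite K] (D : Diagram W) {e : W ≃ B ⊕ K × Bool} {w : W}
    {p : K × Bool} (h : e w = .inr p) :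
    D.connectHalf e (.boundary w) = .joint (.inr p.1) p.2 := by
  show Sum.elim _ _ (e w) = _
  rw [h]
  rfl

/-- Both sides have the same half-edges and crossings. The passage through a new joint plays the
role of the joining of two boundary points. -/
lemma closedSum_connect [Finite K] (D : Diagram W) (e : W ≃ B ⊕ K × Bool) (r : B → B → Prop) :
    (D.connect e).closedSum r = D.closedSum (connectRel e r) := by
  refine (closedSum_eq_of_equiv (D := D) (D' := D.connect e) (Equiv.refl _) fun s => ?_).symm
  refine connects_congr_of_maps (D.connectHalf e) (D.connectHalf e).symm ?_ ?_ ?_ ?_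
  · rintro x y ((rfl | rfl) | ⟨w, w', rfl, rfl, h⟩)
    · exact .rel _ _ (.inl (.inl (D.connect_mate e x).symm))
    · rcases x with ⟨c, k⟩ | ⟨j, t⟩ | w
      · exact .rel _ _ (.inl (.inr rfl))
      · exact .rel _ _ (.inl (.inr rfl))
      · exact .refl _
    · simp only [connectRel] at h
      rcases hw : e w with b | ⟨k, t⟩ <;> rcases hw' : e w' with b' | ⟨k', t'⟩ <;>
        rw [hw, hw'] at h <;> simp only [Sum.liftRel_inl_inl, Sum.not_liftRel_inl_inr,
          Sum.not_liftRel_inr_inl, Sum.liftRel_inr_inr] at h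
      · rw [connectHalf_boundary_inl D hw, connectHalf_boundary_inl D hw']
        exact .rel _ _ (.inr ⟨b, b', rfl, rfl, h⟩)
      · rw [connectHalf_boundary_inr D hw, connectHalf_boundary_inr D hw', h]
        exact .rel _ _ (.inl (.inr rfl))
  · rintro x y ((rfl | rfl) | ⟨b, b', rfl, rfl, h⟩)
    · obtain ⟨x, rfl⟩ := (D.connectHalf e).surjective x
      rw [connect_mate, Equiv.symm_apply_apply, Equiv.symm_apply_apply]
      exact .rel _ _ (.inl (.inl rfl))
    · rcases x with ⟨c, k⟩ | ⟨j | k, t⟩ | w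
      · exact .rel _ _ (.inl (.inr rfl))
      · exact .rel _ _ (.inl (.inr rfl))
      · refine .rel _ _ (.inr ⟨_, _, rfl, rfl, ?_⟩)
        simp [connectRel]
      · exact .refl _
    · refine .rel _ _ (.inr ⟨_, _, rfl, rfl, ?_⟩)
      simpa [connectRel] using h
  · intro x
    rw [Equiv.symm_apply_apply]
    exact .refl _
  · intro x
    rw [Equiv.apply_symm_apply]
    exact .refl _

section Union

variable (D₁ : Diagram B₁) (D₂ : Diagram B₂) (s : D₁.Crossing → Bool) (t : D₂.Crossing → Bool)

/-- `unionEquiv`, as a map to the half-edges of the union. -/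
def unionHalf : D₁.Half ⊕ D₂.Half ≃ (D₁.union D₂).Half := (unionEquiv D₁ D₂).symm

/-- The states of a disjoint union. -/
def unionState : (D₁.Crossing → Bool) × (D₂.Crossing → Bool) ≃ ((D₁.union D₂).Crossing → Bool) :=
  (Equiv.sumArrowEquivProdArrow D₁.Crossing D₂.Crossing Bool).symm

lemma weight_unionState : weight (unionState D₁ D₂ (s, t)) = weight s * weight t := weight_sum s t

lemma union_mate (x : D₁.Half ⊕ D₂.Half) : (D₁.union D₂).mate (unionHalf D₁ D₂ x)
    = unionHalf D₁ D₂ (Sum.map D₁.mate D₂.mate x) := by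
  show (unionEquiv D₁ D₂).symm (Sum.map D₁.mate D₂.mate (unionEquiv D₁ D₂
    ((unionEquiv D₁ D₂).symm x))) = _
  rw [Equiv.apply_symm_apply]
  rfl

lemma union_through (x : D₁.Half ⊕ D₂.Half) :
    (D₁.union D₂).through (unionState D₁ D₂ (s, t)) (unionHalf D₁ D₂ x)
      = unionHalf D₁ D₂ (Sum.map (D₁.through s) (D₂.through t) x) := by
  rcases x with (⟨c, k⟩ | ⟨j, e⟩ | b) | (⟨c, k⟩ | ⟨j, e⟩ | b) <;> rfl

lemma union_adj_iff (x y : D₁.Half ⊕ D₂.Half) :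
    (D₁.union D₂).Adj (unionState D₁ D₂ (s, t)) (unionHalf D₁ D₂ x) (unionHalf D₁ D₂ y) ↔
      Sum.LiftRel (D₁.Adj s) (D₂.Adj t) x y := by
  unfold Adj
  rw [union_mate, union_through, Equiv.apply_eq_iff_eq, Equiv.apply_eq_iff_eq]
  rcases x with x | x <;> rcases y with y | y <;> simp

lemma union_eqvGen_iff (x y : D₁.Half ⊕ D₂.Half) :
    EqvGen ((D₁.union D₂).Adj (unionState D₁ D₂ (s, t))) (unionHalf D₁ D₂ x)
        (unionHalf D₁ D₂ y) ↔
      Sum.LiftRel (EqvGen (D₁.Adj s)) (EqvGen (D₂.Adj t)) x y := by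
  constructor
  · intro h
    have : ∀ u v, EqvGen ((D₁.union D₂).Adj (unionState D₁ D₂ (s, t))) u v →
        Sum.LiftRel (EqvGen (D₁.Adj s)) (EqvGen (D₂.Adj t)) ((unionHalf D₁ D₂).symm u)
          ((unionHalf D₁ D₂).symm v) := by
      intro u v h
      induction h with
      | rel u v h =>
        obtain ⟨u, rfl⟩ := (unionHalf D₁ D₂).surjective u
        obtain ⟨v, rfl⟩ := (unionHalf D₁ D₂).surjective v
        rw [union_adj_iff] at h
        rw [Equiv.symm_apply_apply, Equiv.symm_apply_apply]
        exact h.mono (fun _ _ h => .rel _ _ h) (fun _ _ h => .rel _ _ h)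
      | refl u => rcases (unionHalf D₁ D₂).symm u with a | a <;> simp <;> exact .refl _
      | symm u v _ ih =>
        revert ih
        rcases (unionHalf D₁ D₂).symm u with a | a <;> rcases (unionHalf D₁ D₂).symm v with b | b <;>
          simp <;> exact .symm _ _
      | trans u v w _ _ ih₁ ih₂ =>
        revert ih₁ ih₂
        rcases (unionHalf D₁ D₂).symm u with a | a <;> rcases (unionHalf D₁ D₂).symm v with b | b <;>
          rcases (unionHalf D₁ D₂).symm w with c | c <;> simp <;> exact .trans _ _ _
    simpa using this _ _ h
  · rintro (⟨h⟩ | ⟨h⟩)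
    · refine eqvGen_map (fun x => unionHalf D₁ D₂ (.inl x)) (fun x y h => ?_) h
      exact .rel _ _ ((union_adj_iff D₁ D₂ s t _ _).2 (by simpa using h))
    · refine eqvGen_map (fun x => unionHalf D₁ D₂ (.inr x)) (fun x y h => ?_) h
      exact .rel _ _ ((union_adj_iff D₁ D₂ s t _ _).2 (by simpa using h))

lemma union_joined : (D₁.union D₂).Joined (unionState D₁ D₂ (s, t)) = Sum.LiftRel (D₁.Joined s) (D₂.Joined t) := by
  ext b b'
  rcases b with b | b <;> rcases b' with b' | b' <;>
    first
    | exact (union_eqvGen_iff D₁ D₂ s t (.inl (.boundary b)) (.inl (.boundary b'))).trans (by simp [Joined])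
    | exact (union_eqvGen_iff D₁ D₂ s t (.inl (.boundary b)) (.inr (.boundary b'))).trans (by simp)
    | exact (union_eqvGen_iff D₁ D₂ s t (.inr (.boundary b)) (.inl (.boundary b'))).trans (by simp)
    | exact (union_eqvGen_iff D₁ D₂ s t (.inr (.boundary b)) (.inr (.boundary b'))).trans (by simp [Joined])

lemma union_spans : (D₁.union D₂).Spans (unionState D₁ D₂ (s, t)) ↔ D₁.Spans s ∧ D₂.Spans t := by
  unfold Spans
  rw [← (unionHalf D₁ D₂).forall_congr_right, Sum.forall]
  refine and_congr (forall_congr' fun x => ?_) (forall_congr' fun x => ?_)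
  · rw [Sum.exists]
    constructor
    · rintro (⟨b, h⟩ | ⟨b, h⟩)
      · exact ⟨b, by simpa using (union_eqvGen_iff D₁ D₂ s t (.inl x) (.inl (.boundary b))).1 h⟩
      · simpa using (union_eqvGen_iff D₁ D₂ s t (.inl x) (.inr (.boundary b))).1 h
    · rintro ⟨b, h⟩
      exact .inl ⟨b, (union_eqvGen_iff D₁ D₂ s t (.inl x) (.inl (.boundary b))).2 (by simpa using h)⟩
  · rw [Sum.exists]
    constructor
    · rintro (⟨b, h⟩ | ⟨b, h⟩)
      · simpa using (union_eqvGen_iff D₁ D₂ s t (.inr x) (.inl (.boundary b))).1 h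
      · exact ⟨b, by simpa using (union_eqvGen_iff D₁ D₂ s t (.inr x) (.inr (.boundary b))).1 h⟩
    · rintro ⟨b, h⟩
      exact .inr ⟨b, (union_eqvGen_iff D₁ D₂ s t (.inr x) (.inr (.boundary b))).2 (by simpa using h)⟩

/-- States of the union are pairs of states, and weight, spanning and connectivity all split
accordingly. -/
lemma eval_union (Φ : (B₁ ⊕ B₂ → B₁ ⊕ B₂ → Prop) → ℂ) :
    (D₁.union D₂).eval Φ = D₁.eval fun ρ => D₂.eval fun ρ' => Φ (Sum.LiftRel ρ ρ') := by
  classical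
  have := Fintype.ofFinite D₁.Crossing
  have := Fintype.ofFinite D₂.Crossing
  have : Fintype (D₁.union D₂).Crossing := inferInstanceAs (Fintype (D₁.Crossing ⊕ D₂.Crossing))
  unfold eval
  simp only [finsum_eq_sum_of_fintype]
  rw [← (unionState D₁ D₂).sum_comp, Fintype.sum_prod_type]
  refine Finset.sum_congr rfl fun s _ => ?_
  rw [Finset.mul_sum, Finset.mul_sum]
  refine Finset.sum_congr rfl fun t _ => ?_
  rw [union_joined, indic_congr (union_spans D₁ D₂ s t), indic_and, weight_unionState]
  ring

end Union

lemma matching_joined (m : B → B) (h : ∀ b, m (m b) = b) (h' : ∀ b, m b ≠ b)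
    (s : (matching m h h').Crossing → Bool) :
    (matching m h h').Joined s = fun b b' => b = b' ∨ b' = m b := by
  ext b b'
  constructor
  · intro hb
    -- `f` sends a boundary point to the predicate of lying on its arc, which is constant along the
    -- arc.
    let f : (matching m h h').Half → B → Prop
      | .crossing c _ => c.elim
      | .joint j _ => j.elim
      | .boundary b => fun b' => b = b' ∨ b' = m b
    have : f (.boundary b) = f (.boundary b') := by
      refine eqvGen_invariant f ?_ hb
      rintro (⟨c, k⟩ | ⟨j, e⟩ | b) y (rfl | rfl)
      · exact c.elim
      · exact c.elim
      · exact j.elim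
      · exact j.elim
      · ext c
        show b = c ∨ c = m b ↔ m b = c ∨ c = m (m b)
        rw [h, or_comm, eq_comm, @eq_comm _ c]
      · rfl
    have h2 : f (.boundary b') b' := .inl rfl
    rw [← this] at h2
    exact h2
  · rintro (rfl | rfl)
    · exact .refl _
    · exact .rel _ _ (.inl rfl)

lemma eval_matching (m : B → B) (h : ∀ b, m (m b) = b) (h' : ∀ b, m b ≠ b)
    (Φ : (B → B → Prop) → ℂ) :
    (matching m h h').eval Φ = Φ fun b b' => b = b' ∨ b' = m b := by
  have : IsEmpty (matching m h h').Crossing := inferInstanceAs (IsEmpty Empty)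
  have : Unique ((matching m h h').Crossing → Bool) := Pi.uniqueOfIsEmpty _
  unfold eval
  rw [finsum_unique, weight_of_isEmpty, matching_joined, indic_of, one_mul, one_mul]
  rintro (⟨c, k⟩ | ⟨j, e⟩ | b)
  · exact c.elim
  · exact j.elim
  · exact ⟨b, .refl _⟩

/-- Gluing a crossingless tangle into a diagram joins the boundary points. -/
lemma closedSum_patch_matching [Finite K] [Nonempty B] (E : Diagram (B ⊕ K)) (m : K → K) (h : ∀ b, m (m b) = b)
    (h' : ∀ b, m b ≠ b) (r : B → B → Prop) :
    (E.patch (matching m h h')).closedSum r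
      = E.closedSum (Sum.LiftRel r fun k k' => k' = m k) := by
  unfold patch
  rw [closedSum_connect, closedSum_eq_eval, closedSum_eq_eval, eval_union]
  refine congrArg E.eval (funext fun ρ => ?_)
  rw [eval_matching]
  -- The boundary points of the matching are contracted onto the points of `E` to which they are
  -- glued.
  refine indic_congr (connects_congr_of_maps (Sum.elim id .inr) .inl ?_ ?_ ?_ ?_)
  · rintro ((x | x) | x) ((y | y) | y) (hxy | hxy) <;>
      simp [connectRel, patchEquiv] at hxy ⊢
    · exact .rel _ _ (.inl hxy)
    · exact .rel _ _ (.inr (by simpa using hxy))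
    · exact .rel _ _ (.inl hxy)
    · exact .rel _ _ (.inl hxy)
    · exact .rel _ _ (.inl hxy)
    · subst hxy; exact .refl _
    · subst hxy; exact .refl _
    · rcases hxy with rfl | rfl
      · exact .refl _
      · exact .rel _ _ (.inr (by simp))
  · rintro u v (h | h)
    · exact .rel _ _ (.inl (by simpa using h))
    · rcases h with ⟨h⟩ | ⟨h⟩
      · exact .rel _ _ (.inr (by simpa [connectRel, patchEquiv] using h))
      · subst h
        rename_i k
        -- The detour: from `E` into the matching at `k`, along the arc to `m k`, and back into `E`.
        refine .trans _ (.inr k) _ (.rel _ _ (.inr (by simp [connectRel, patchEquiv]))) ?_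
        refine .trans _ (.inr (m k)) _ (.rel _ _ (.inl (by simp))) ?_
        exact .rel _ _ (.inr (by simp [connectRel, patchEquiv]))
  · rintro ((x | x) | x)
    · exact .refl _
    · exact .refl _
    · exact .rel _ _ (.inr (by simp [connectRel, patchEquiv]))
  · intro u
    exact .refl _

end Diagram

/-! ### The bracket at a primitive eighth root of unity. -/

namespace Link

lemma A_sq : A ^ 2 = Complex.I := by
  rw [A, ← Complex.exp_nat_mul]
  conv_rhs => rw [← Complex.exp_pi_div_two_mul_I]
  congr 1
  push_cast
  ring

lemma A_pow_four : A ^ 4 = -1 := by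
  rw [show 4 = 2 * 2 from rfl, pow_mul, A_sq, Complex.I_sq]

lemma A_pow_eight : A ^ 8 = 1 := by
  rw [show 8 = 4 * 2 from rfl, pow_mul, A_pow_four]; norm_num

lemma A_ne_zero : A ≠ 0 := Complex.exp_ne_zero _

lemma A_inv : A⁻¹ = A ^ 7 := by
  refine inv_eq_of_mul_eq_one_right ?_
  rw [← pow_succ', A_pow_eight]

/-- `A⁻²` equals `A¹⁴ = -A²`. This vanishing is what reduces the bracket to states with one circle.
-/
lemma loop_value : -A ^ 2 - A⁻¹ ^ 2 = 0 := by
  rw [A_inv, ← pow_mul, show A ^ (7 * 2) = A ^ 8 * A ^ 4 * A ^ 2 by ring, A_pow_eight, A_pow_four]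
  ring

lemma bracket_eq_closedSum (L : Link) (r : Empty → Empty → Prop) :
    L.bracket = Diagram.closedSum L r := by
  refine finsum_congr fun s => ?_
  have h : (-A ^ 2 - A⁻¹ ^ 2) ^ (L.circles s - 1)
      = Diagram.indic (Connects (Diagram.Closed L s r)) := by
    have hc : Connects (Diagram.Closed L s r) ↔ L.circles s ≤ 1 := by
      have : L.circles s = Nat.card (Quot (Diagram.Closed L s r)) := by
        have hr : (fun x y : Diagram.Half L => y = L.mate x ∨ y = L.through s x)
            = Diagram.Closed L s r := by
          ext x y
          have ht : L.through s x = Diagram.through L s x := by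
            rcases x with ⟨c, k⟩ | ⟨j, e⟩ | b
            · rfl
            · rfl
            · exact b.elim
          rw [ht]
          constructor
          · exact .inl
          · rintro (h | ⟨b, -⟩)
            · exact h
            · exact b.elim
        rw [circles, hr]
      rw [this, connects_iff_card_quot_le]
    -- With truncated subtraction the exponent is `0` for zero circles as well as for one, matching
    -- the convention of `Connects` that an empty type is connected.
    rw [loop_value, zero_pow_eq, Diagram.indic_congr hc, Diagram.indic]
    simp [Nat.sub_eq_zero_iff_le]
  rw [h]
  rfl

end Link

end TangleDiagram

namespace TangleDiagram

open Relation

namespace Diagram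

variable {B B₁ B₂ : Type}

/-! ### Turning a diagram over -/

/-- `turnEquiv`, as a map to the half-edges of the turned diagram. -/
def turnHalf (D : Diagram B₁) (e : B₁ ≃ B₂) : D.Half ≃ (D.turnOver e).Half := turnEquiv e

lemma turnOver_mate (D : Diagram B₁) (e : B₁ ≃ B₂) (x : D.Half) :
    (D.turnOver e).mate (D.turnHalf e x) = D.turnHalf e (D.mate x) := by
  show turnEquiv e (D.mate ((turnEquiv e).symm (turnEquiv e x))) = _
  rw [Equiv.symm_apply_apply]
  rfl

lemma turnOver_through (D : Diagram B₁) (e : B₁ ≃ B₂) (s : D.Crossing → Bool) (x : D.Half) :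
    (D.turnOver e).through s (D.turnHalf e x) = D.turnHalf e (D.through s x) := by
  rcases x with ⟨c, k⟩ | ⟨j, t⟩ | b
  -- Reversing the orientation and exchanging over and under compensate each other: an `A`-type
  -- splitting remains of type `A`.
  · have h : ∀ (a : Bool) (k : Fin 4), Link.split a (1 - k) = 1 - Link.split a k := by decide
    exact congrArg (HalfEdge.crossing c) (h (s c) k)
  · rfl
  · rfl

lemma turnOver_eqvGen (D : Diagram B₁) (e : B₁ ≃ B₂) (s : D.Crossing → Bool) (x y : D.Half) :
    EqvGen ((D.turnOver e).Adj s) (D.turnHalf e x) (D.turnHalf e y) ↔ EqvGen (D.Adj s) x y := by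
  have h : ∀ x y, (D.turnOver e).Adj s (D.turnHalf e x) (D.turnHalf e y) ↔ D.Adj s x y :=
    fun x y => by
      unfold Adj
      rw [turnOver_mate, turnOver_through, Equiv.apply_eq_iff_eq, Equiv.apply_eq_iff_eq]
  constructor
  · intro hxy
    have := eqvGen_map (q := D.Adj s) (D.turnHalf e).symm (fun u v huv => ?_) hxy
    · simpa using this
    · refine .rel _ _ ((h _ _).1 ?_)
      simpa using huv
  · exact eqvGen_map _ fun u v huv => .rel _ _ ((h u v).2 huv)

lemma eval_turnOver (D : Diagram B₁) (e : B₁ ≃ B₂) (Φ : (B₂ → B₂ → Prop) → ℂ) :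
    (D.turnOver e).eval Φ = D.eval fun ρ => Φ fun b b' => ρ (e.symm b) (e.symm b') := by
  refine finsum_congr fun s => ?_
  have hs : (D.turnOver e).Spans s ↔ D.Spans s := by
    unfold Spans
    rw [← (D.turnHalf e).forall_congr_right]
    refine forall_congr' fun x => ?_
    rw [← e.exists_congr_right]
    exact exists_congr fun b => turnOver_eqvGen D e s x (.boundary b)
  have hj : (D.turnOver e).Joined s = fun b b' => D.Joined s (e.symm b) (e.symm b') := by
    ext b b'
    obtain ⟨b, rfl⟩ := e.surjective b
    obtain ⟨b', rfl⟩ := e.surjective b'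
    rw [Equiv.symm_apply_apply, Equiv.symm_apply_apply]
    exact turnOver_eqvGen D e s (.boundary b) (.boundary b')
  rw [indic_congr hs, hj]
  rfl

lemma closedSum_turnOver [Nonempty B₁] (D : Diagram B₁) (e : B₁ ≃ B₂) (r : B₂ → B₂ → Prop) :
    (D.turnOver e).closedSum r = D.closedSum fun b b' => r (e b) (e b') := by
  have : Nonempty B₂ := e.nonempty_congr.1 ‹_›
  rw [closedSum_eq_eval, closedSum_eq_eval, eval_turnOver]
  refine congrArg D.eval (funext fun ρ => indic_congr ?_)
  exact (connects_congr_equiv e fun b b' => by simp).symm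

end Diagram

/-! ### The pairings of a spherical tangle with closures of its two holes -/

/-- Join the corners of a hole like the half-edges of a crossing: `true` yields horizontal and
`false` vertical arcs. -/
abbrev SplitRel (p : Bool) (c c' : Corner) : Prop := c' = Link.split p c

/-- The connectivity of a fundamental tangle. -/
abbrev Arcs (t : Bool) (c c' : Corner) : Prop := c = c' ∨ c' = Link.split t c

namespace Spherical

/-- The bracket of a spherical tangle after closing the outside hole by `p` and the inside hole
by `q`. -/
noncomputable def pairing (S : Spherical) (p q : Bool) : ℂ :=
  S.closedSum (Sum.LiftRel (SplitRel p) (SplitRel q))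

lemma bracket_numerator (X : Ball) : X.numerator.bracket = X.closedSum (SplitRel true) := by
  rw [Link.bracket_eq_closedSum _ fun _ _ => False, Ball.numerator, Diagram.closedSum_connect]
  refine Diagram.closedSum_congr _ fun b b' => ?_
  revert b b'
  unfold Diagram.connectRel
  decide

lemma bracket_denominator (X : Ball) : X.denominator.bracket = X.closedSum (SplitRel false) := by
  rw [Link.bracket_eq_closedSum _ fun _ _ => False, Ball.denominator, Diagram.closedSum_connect]
  refine Diagram.closedSum_congr _ fun b b' => ?_
  revert b b'
  unfold Diagram.connectRel
  decide

lemma closedSum_fill_fundamental1 (S : Spherical) (p : Bool) :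
    (S.fill Ball.fundamental1).closedSum (SplitRel p) = S.pairing p false := by
  unfold fill Ball.fundamental1 pairing
  rw [Diagram.closedSum_patch_matching]
  congr 2
  ext c c'
  revert c c'
  decide

lemma closedSum_fill_fundamental2 (S : Spherical) (p : Bool) :
    (S.fill Ball.fundamental2).closedSum (SplitRel p) = S.pairing p true := by
  unfold fill Ball.fundamental2 pairing
  rw [Diagram.closedSum_patch_matching]
  congr 2
  ext c c'
  revert c c'
  decide

lemma bracketMatrix_eq (S : Spherical) : S.bracketMatrix =
    !![S.pairing true false, -Complex.I * S.pairing true true;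
      Complex.I * S.pairing false false, S.pairing false true] := by
  unfold bracketMatrix
  simp only [bracket_numerator, bracket_denominator, closedSum_fill_fundamental1,
    closedSum_fill_fundamental2]
  simp

/-- Hence inner sums act on the second index exactly as outer sums act on the first. -/
lemma pairing_interchange (S : Spherical) (p q : Bool) :
    S.interchange.pairing p q = S.pairing q p := by
  unfold pairing interchange
  rw [Diagram.closedSum_turnOver]
  refine Diagram.closedSum_congr _ ?_
  rintro (b | b) (b' | b') <;> simp

/-- Four radial arcs with equal closures form two circles, and with different closures one circle.
The bracket matrix is thus the identity matrix. -/
lemma pairing_identity (p q : Bool) : identity.pairing p q = if p = q then 0 else 1 := by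
  unfold pairing identity
  rw [Diagram.closedSum_eq_eval, Diagram.eval_matching]
  split_ifs with h
  · subst h
    refine Diagram.indic_not fun h => ?_
    -- The circle through corner `0`, which occupies the corners `0` and `Link.split p 0` of both
    -- holes, is closed under all steps.
    have hf : ∀ (p : Bool) (x y : Corner ⊕ Corner), ((x = y ∨ y = x.swap) ∨
        Sum.LiftRel (SplitRel p) (SplitRel p) x y) →
        (Sum.elim id id x = 0 ∨ Sum.elim id id x = Link.split p 0 ↔
          Sum.elim id id y = 0 ∨ Sum.elim id id y = Link.split p 0) := by decide
    have := eqvGen_invariant _ (fun x y hxy => propext (hf p x y hxy)) (h (.inl 0) (.inl 2))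
    revert this
    cases p <;> simp [Link.split]
  · refine Diagram.indic_of ?_
    obtain rfl : q = !p := by cases p <;> cases q <;> simp_all
    have h₁ : ∀ c, EqvGen (fun b b' : Corner ⊕ Corner => (b = b' ∨ b' = b.swap) ∨
        Sum.LiftRel (SplitRel p) (SplitRel !p) b b') (.inl c) (.inl (Link.split p c)) := fun c =>
      .rel _ _ (.inr (by simp))
    have h₂ : ∀ c : Corner, EqvGen (fun b b' : Corner ⊕ Corner => (b = b' ∨ b' = b.swap) ∨
        Sum.LiftRel (SplitRel p) (SplitRel !p) b b') (.inr c) (.inl c) := fun c =>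
      .rel _ _ (.inl (.inr rfl))
    have h₃ : ∀ c, EqvGen (fun b b' : Corner ⊕ Corner => (b = b' ∨ b' = b.swap) ∨
        Sum.LiftRel (SplitRel p) (SplitRel !p) b b') (.inl c) (.inl (Link.split (!p) c)) :=
      fun c => .trans _ _ _ (.symm _ _ (h₂ c)) (.trans _ _ _ (.rel _ _ (.inr (by simp))) (h₂ _))
    have h₄ : ∀ c : Corner, EqvGen (fun b b' : Corner ⊕ Corner => (b = b' ∨ b' = b.swap) ∨
        Sum.LiftRel (SplitRel p) (SplitRel !p) b b') (.inl 0) (.inl c) := by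
      intro c
      -- The two splittings generate a Klein four-group that acts transitively on the corners.
      have key : ∀ p (c : Corner), c = 0 ∨ c = Link.split p 0 ∨ c = Link.split (!p) 0 ∨
        c = Link.split (!p) (Link.split p 0) := by decide
      rcases key p c with rfl | rfl | rfl | rfl
      · exact .refl _
      · exact h₁ 0
      · exact h₃ 0
      · exact .trans _ _ _ (h₁ 0) (h₃ _)
    have h₅ : ∀ x : Corner ⊕ Corner, EqvGen (fun b b' : Corner ⊕ Corner =>
        (b = b' ∨ b' = b.swap) ∨ Sum.LiftRel (SplitRel p) (SplitRel !p) b b') (.inl 0) x := by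
      rintro (c | c)
      · exact h₄ c
      · exact .trans _ _ _ (h₄ c) (.symm _ _ (h₂ c))
    exact fun x y => .trans _ _ _ (.symm _ _ (h₅ x)) (h₅ y)

end Spherical

/-! ### Connect sums with a ball tangle that resolves into fundamental tangles -/

/-- The states of the ball tangle which have no closed circles look like the two fundamental
tangles, and `x` is the sum of their weights. -/
def Ball.Resolves (X : Ball) (x : Bool → ℂ) : Prop :=
  ∀ Φ, X.eval Φ = x true * Φ (Arcs true) + x false * Φ (Arcs false)

lemma Ball.Resolves.turnOver {X : Ball} {x : Bool → ℂ} (h : X.Resolves x) (e : Corner ≃ Corner)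
    (he : ∀ t c c', Arcs t (e.symm c) (e.symm c') ↔ Arcs t c c') :
    Ball.Resolves (X.turnOver e) x := by
  have key : ∀ t, (fun c c' => Arcs t (e.symm c) (e.symm c')) = Arcs t := fun t => by
    ext c c'; exact he t c c'
  intro Φ
  rw [Diagram.eval_turnOver, h, key, key]

lemma Ball.Resolves.hTurn {X : Ball} {x : Bool → ℂ} (h : X.Resolves x) : X.hTurn.Resolves x :=
  h.turnOver _ (by decide)

lemma Ball.Resolves.vTurn {X : Ball} {x : Bool → ℂ} (h : X.Resolves x) : X.vTurn.Resolves x :=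
  h.turnOver _ (by decide)

/-- Arcs of type `t` closed by the same type form two circles, closed by the other type one circle.
The closure `!t` therefore detects exactly the coefficient `x t`. -/
lemma Ball.Resolves.closedSum {X : Ball} {x : Bool → ℂ} (h : X.Resolves x) (t : Bool) :
    x t = Diagram.closedSum X (SplitRel !t) := by
  have h₁ : ∀ t : Bool, ¬Connects fun c c' => Arcs t c c' ∨ SplitRel t c c' := by
    intro t ht
    have hf : ∀ (t : Bool) (c c' : Corner), Arcs t c c' ∨ SplitRel t c c' →
        (c = 0 ∨ c = Link.split t 0 ↔ c' = 0 ∨ c' = Link.split t 0) := by decide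
    have := eqvGen_invariant _ (fun c c' hc => propext (hf t c c' hc)) (ht 0 2)
    revert this
    cases t <;> simp [Link.split]
  have h₂ : ∀ t : Bool, Connects fun c c' => Arcs t c c' ∨ SplitRel (!t) c c' := by
    intro t
    have h₄ : ∀ c : Corner, EqvGen (fun c c' => Arcs t c c' ∨ SplitRel (!t) c c') 0 c := by
      intro c
      have key : ∀ p (c : Corner), c = 0 ∨ c = Link.split p 0 ∨ c = Link.split (!p) 0 ∨
        c = Link.split (!p) (Link.split p 0) := by decide
      rcases key t c with rfl | rfl | rfl | rfl
      · exact .refl _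
      · exact .rel _ _ (.inl (.inr rfl))
      · exact .rel _ _ (.inr rfl)
      · exact .trans _ _ _ (.rel _ _ (.inl (.inr rfl))) (.rel _ _ (.inr rfl))
    exact fun x y => .trans _ _ _ (.symm _ _ (h₄ x)) (h₄ y)
  rw [Diagram.closedSum_eq_eval, h]
  cases t
  · rw [Diagram.indic_not (by simpa using h₁ true), Diagram.indic_of (by simpa using h₂ false)]
    simp
  · rw [Diagram.indic_of (by simpa using h₂ true), Diagram.indic_not (by simpa using h₁ false)]
    simp

namespace Spherical

/-- The point to which a boundary point of a ball tangle or a spherical tangle is joined, when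
these have been connected by `e` and the remaining points are closed by `p` and `q`. -/
def partner (e : Corner ⊕ (Corner ⊕ Corner) ≃ (Corner ⊕ Corner) ⊕ Bool × Bool) (p q : Bool)
    (w : Corner ⊕ (Corner ⊕ Corner)) : Corner ⊕ (Corner ⊕ Corner) :=
  e.symm (Sum.map (Sum.map (Link.split p) (Link.split q)) (fun k => (k.1, !k.2)) (e w))

lemma connectRel_iff_partner (e : Corner ⊕ (Corner ⊕ Corner) ≃ (Corner ⊕ Corner) ⊕ Bool × Bool)
    (p q : Bool) (w w' : Corner ⊕ (Corner ⊕ Corner)) :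
    Diagram.connectRel e (Sum.LiftRel (SplitRel p) (SplitRel q)) w w' ↔ w' = partner e p q w := by
  unfold Diagram.connectRel partner
  rw [Equiv.eq_symm_apply]
  rcases e w with (b | b) | k <;> rcases e w' with (b' | b') | k' <;> simp

/-- Follow an arc of the fundamental tangle `t`. -/
def arcStep (t : Bool) : Corner ⊕ (Corner ⊕ Corner) → Corner ⊕ (Corner ⊕ Corner) :=
  Sum.map (Link.split t) id

/-- The first outer corner of the spherical tangle on the path which starts at a corner of the
ball tangle. -/
def exit (N : Corner ⊕ (Corner ⊕ Corner) → Corner ⊕ (Corner ⊕ Corner)) (t : Bool) (c : Corner) :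
    Corner :=
  match N (.inl c) with
  | .inr (.inl d) => d
  | y =>
    match N (arcStep t y) with
    | .inr (.inl d) => d
    | y =>
      match N (arcStep t y) with
      | .inr (.inl d) => d
      | _ => 0

/-- Contraction of a fundamental tangle which is connected to a spherical tangle. -/
lemma connects_sum_iff {N : Corner ⊕ (Corner ⊕ Corner) → Corner ⊕ (Corner ⊕ Corner)} {t p q : Bool}
    (h₁ : ∀ w, Sum.elim (fun c => .inl (exit N t c)) id (N w)
        = Sum.elim (fun c => .inl (exit N t c)) id w ∨
      Sum.elim (fun c => .inl (exit N t c)) id (N w)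
        = Sum.map (Link.split p) (Link.split q) (Sum.elim (fun c => .inl (exit N t c)) id w))
    (h₂ : ∀ c, exit N t (Link.split t c) = exit N t c ∨
      exit N t (Link.split t c) = Link.split p (exit N t c))
    (h₃ : ∀ u, ∃ k : Fin 3, (N ∘ arcStep t)^[k] (N (.inr u))
      = .inr (Sum.map (Link.split p) (Link.split q) u))
    (h₄ : ∀ c, ∃ k : Fin 3, (N ∘ arcStep t)^[k] (N (.inl c)) = .inr (.inl (exit N t c)))
    (ρ : Corner ⊕ Corner → Corner ⊕ Corner → Prop) :
    Connects (fun w w' => Sum.LiftRel (Arcs t) ρ w w' ∨ w' = N w) ↔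
      Connects fun u v => ρ u v ∨ Sum.LiftRel (SplitRel p) (SplitRel q) u v := by
  have hstep : ∀ u v : Corner ⊕ Corner, v = Sum.map (Link.split p) (Link.split q) u ↔
      Sum.LiftRel (SplitRel p) (SplitRel q) u v := by
    rintro (u | u) (v | v) <;> simp
  have hN : ∀ w, EqvGen (fun w w' => Sum.LiftRel (Arcs t) ρ w w' ∨ w' = N w) w (N w) := fun w =>
    .rel _ _ (.inr rfl)
  have hM : ∀ w, EqvGen (fun w w' => Sum.LiftRel (Arcs t) ρ w w' ∨ w' = N w) w (arcStep t w) := by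
    rintro (c | u)
    · exact .rel _ _ (.inl (by simp [arcStep, Arcs]))
    · exact .refl _
  have hpath : ∀ (k : ℕ) w, EqvGen (fun w w' => Sum.LiftRel (Arcs t) ρ w w' ∨ w' = N w) w
      ((N ∘ arcStep t)^[k] (N w)) := by
    intro k w
    induction k with
    | zero => exact hN w
    | succ k ih =>
      rw [Function.iterate_succ_apply']
      exact .trans _ _ _ ih (.trans _ _ _ (hM _) (hN _))
  -- Each corner of the ball tangle is contracted to its exit. By `h₄` the exit is really reached,
  -- so the default value `0` in `exit` plays no role; by `h₃` each closing arc of the spherical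
  -- tangle lifts to a path through the ball tangle.
  refine connects_congr_of_maps (Sum.elim (fun c => .inl (exit N t c)) id) .inr ?_ ?_ ?_ ?_
  · rintro w w' (h | rfl)
    · rcases h with ⟨rfl | rfl⟩ | ⟨h⟩
      · exact .refl _
      · rename_i c
        rcases h₂ c with h | h
        · simp only [Sum.elim_inl, h]
          exact .refl _
        · simp only [Sum.elim_inl, h]
          exact .rel _ _ (.inr (by simp))
      · exact .rel _ _ (.inl h)
    · rcases h₁ w with h | h
      · rw [h]
        exact .refl _
      · rw [h]
        exact .rel _ _ (.inr ((hstep _ _).1 rfl))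
  · rintro u v (h | h)
    · exact .rel _ _ (.inl (by simpa using h))
    · rw [← hstep] at h
      subst h
      obtain ⟨k, hk⟩ := h₃ u
      rw [← hk]
      exact hpath k _
  · rintro (c | u)
    · obtain ⟨k, hk⟩ := h₄ c
      simp only [Sum.elim_inl]
      rw [← hk]
      exact hpath k _
    · exact .refl _
  · intro u
    exact .refl _

/-- The closed circle that arises when an arc of a fundamental tangle is closed directly. -/
lemma not_connects_sum {N : Corner ⊕ (Corner ⊕ Corner) → Corner ⊕ (Corner ⊕ Corner)} {t : Bool}
    (h₁ : ∀ w, Sum.elim (fun c => decide (N (.inl c) = .inl (Link.split t c))) (fun _ => false) (N w)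
      = Sum.elim (fun c => decide (N (.inl c) = .inl (Link.split t c))) (fun _ => false) w)
    (h₂ : ∀ c, N (.inl (Link.split t c)) = .inl (Link.split t (Link.split t c)) ↔
      N (.inl c) = .inl (Link.split t c))
    (h₃ : ∃ c, N (.inl c) = .inl (Link.split t c))
    (ρ : Corner ⊕ Corner → Corner ⊕ Corner → Prop) :
    ¬Connects fun w w' => Sum.LiftRel (Arcs t) ρ w w' ∨ w' = N w := by
  intro h
  obtain ⟨c, hc⟩ := h₃
  -- The indicator of the corners on directly closed arcs is invariant; it is `true` at `c` and
  -- `false` on the spherical tangle.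
  have := eqvGen_invariant
    (Sum.elim (fun c => decide (N (.inl c) = .inl (Link.split t c))) (fun _ => false)) ?_
    (h (.inl c) (.inr (.inl 0)))
  · simp [hc] at this
  · rintro w w' (h | rfl)
    · rcases h with ⟨rfl | rfl⟩ | ⟨h⟩
      · rfl
      · simp [h₂]
      · rfl
    · exact (h₁ w).symm

/-- The effect of an outer connect sum on the pairings; `h` is true for horizontal sums. -/
def IsOuterSum (h : Bool)
    (e : Corner ⊕ (Corner ⊕ Corner) ≃ (Corner ⊕ Corner) ⊕ Bool × Bool) : Prop :=
  ∀ (X : Ball) (S : Spherical) (x : Bool → ℂ), X.Resolves x → ∀ p q,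
    pairing ((X.union S).connect e) p q
      = x h * S.pairing p q + if p = h then x (!h) * S.pairing (!p) q else 0

lemma pairing_connect_union
    (e : Corner ⊕ (Corner ⊕ Corner) ≃ (Corner ⊕ Corner) ⊕ Bool × Bool) {X : Ball} (S : Spherical)
    {x : Bool → ℂ} (hX : X.Resolves x) (p q : Bool) :
    pairing ((X.union S).connect e) p q =
      x true * S.eval (fun ρ => Diagram.indic (Connects fun w w' =>
        Sum.LiftRel (Arcs true) ρ w w' ∨ w' = partner e p q w)) +
      x false * S.eval (fun ρ => Diagram.indic (Connects fun w w' =>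
        Sum.LiftRel (Arcs false) ρ w w' ∨ w' = partner e p q w)) := by
  unfold pairing
  rw [Diagram.closedSum_connect, Diagram.closedSum_congr _ (connectRel_iff_partner e p q),
    Diagram.closedSum_eq_eval, Diagram.eval_union, hX]

lemma eval_indic_of_iff (S : Spherical) {p q : Bool} {P : (Corner ⊕ Corner → Corner ⊕ Corner → Prop) → Prop}
    (h : ∀ ρ, P ρ ↔ Connects fun u v => ρ u v ∨ Sum.LiftRel (SplitRel p) (SplitRel q) u v) :
    S.eval (fun ρ => Diagram.indic (P ρ)) = S.pairing p q := by
  unfold pairing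
  rw [Diagram.closedSum_eq_eval]
  exact congrArg S.eval (funext fun ρ => Diagram.indic_congr (h ρ))

lemma eval_indic_of_not (S : Spherical) {P : (Corner ⊕ Corner → Corner ⊕ Corner → Prop) → Prop}
    (h : ∀ ρ, ¬P ρ) : S.eval (fun ρ => Diagram.indic (P ρ)) = 0 := by
  unfold Diagram.eval
  simp [Diagram.indic_not (h _)]

lemma isOuterSum_hLeft : IsOuterSum true hLeftEquiv := by
  intro X S x hX p q
  rw [pairing_connect_union _ S hX, eval_indic_of_iff S (p := p) (q := q)
    (connects_sum_iff (by revert p q; decide) (by revert p q; decide)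
      (by revert p q; decide) (by revert p q; decide))]
  -- It remains to treat vertical arcs in the ball tangle: the denominator closure cuts off a
  -- circle, and the numerator closure becomes the denominator closure of `S`.
  cases p
  · rw [eval_indic_of_not S (not_connects_sum (by revert q; decide) (by revert q; decide)
      (by revert q; decide))]
    simp
  · rw [eval_indic_of_iff S (p := false) (q := q) (connects_sum_iff (by revert q; decide)
      (by revert q; decide) (by revert q; decide) (by revert q; decide))]
    simp

lemma isOuterSum_hRight : IsOuterSum true hRightEquiv := by
  intro X S x hX p q
  rw [pairing_connect_union _ S hX, eval_indic_of_iff S (p := p) (q := q)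
    (connects_sum_iff (by revert p q; decide) (by revert p q; decide)
      (by revert p q; decide) (by revert p q; decide))]
  cases p
  · rw [eval_indic_of_not S (not_connects_sum (by revert q; decide) (by revert q; decide)
      (by revert q; decide))]
    simp
  · rw [eval_indic_of_iff S (p := false) (q := q) (connects_sum_iff (by revert q; decide)
      (by revert q; decide) (by revert q; decide) (by revert q; decide))]
    simp

lemma isOuterSum_vAbove : IsOuterSum false vAboveEquiv := by
  intro X S x hX p q
  have hp : S.eval (fun ρ => Diagram.indic (Connects fun w w' => Sum.LiftRel (Arcs false) ρ w w' ∨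
      w' = partner vAboveEquiv p q w)) = S.pairing p q :=
    eval_indic_of_iff S (connects_sum_iff (by revert p q; decide) (by revert p q; decide)
      (by revert p q; decide) (by revert p q; decide))
  rw [pairing_connect_union _ S hX, hp]
  clear hp
  -- It remains to treat horizontal arcs: the denominator closure becomes the numerator closure of
  -- `S`, and the numerator closure cuts off a circle.
  cases p
  · rw [eval_indic_of_iff S (p := true) (q := q) (connects_sum_iff (by revert q; decide)
      (by revert q; decide) (by revert q; decide) (by revert q; decide))]
    simp [add_comm]
  · rw [eval_indic_of_not S (not_connects_sum (by revert q; decide) (by revert q; decide)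
      (by revert q; decide))]
    simp

lemma isOuterSum_vBelow : IsOuterSum false vBelowEquiv := by
  intro X S x hX p q
  have hp : S.eval (fun ρ => Diagram.indic (Connects fun w w' => Sum.LiftRel (Arcs false) ρ w w' ∨
      w' = partner vBelowEquiv p q w)) = S.pairing p q :=
    eval_indic_of_iff S (connects_sum_iff (by revert p q; decide) (by revert p q; decide)
      (by revert p q; decide) (by revert p q; decide))
  rw [pairing_connect_union _ S hX, hp]
  clear hp
  cases p
  · rw [eval_indic_of_iff S (p := true) (q := q) (connects_sum_iff (by revert q; decide)
      (by revert q; decide) (by revert q; decide) (by revert q; decide))]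
    simp [add_comm]
  · rw [eval_indic_of_not S (not_connects_sum (by revert q; decide) (by revert q; decide)
      (by revert q; decide))]
    simp

/-! ### Integral normalizations of the bracket matrix. -/

/-- The ball tangle has an integral pair of closures, up to an eighth root of unity. -/
def _root_.TangleDiagram.Ball.IsIntegral (X : Ball) : Prop :=
  ∃ (x : Bool → ℂ) (ζ : ℂ) (m n : ℤ), X.Resolves x ∧ ζ ^ 8 = 1 ∧ x true = ζ * m ∧
    x false = ζ * (Complex.I * n)

/-- `M` is the integral matrix obtained by multiplying the bracket matrix by `z`. -/
def IsNormalized (S : Spherical) (z : ℂ) (M : Matrix (Fin 2) (Fin 2) ℤ) : Prop :=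
  z ^ 8 = 1 ∧ M.map (Int.cast : ℤ → ℂ) = z • S.bracketMatrix

lemma isNormalized_iff {S : Spherical} {z : ℂ} {M : Matrix (Fin 2) (Fin 2) ℤ} :
    S.IsNormalized z M ↔ z ^ 8 = 1 ∧ (M 0 0 : ℂ) = z * S.pairing true false ∧
      (M 0 1 : ℂ) = z * (-Complex.I * S.pairing true true) ∧
      (M 1 0 : ℂ) = z * (Complex.I * S.pairing false false) ∧
      (M 1 1 : ℂ) = z * S.pairing false true := by
  unfold IsNormalized
  rw [bracketMatrix_eq, ← Matrix.ext_iff]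
  simp [Fin.forall_fin_two, and_assoc]

/-- Outer connect sums multiply the normalized matrix on the left by a triangular matrix. -/
lemma IsNormalized.of_rows {S S' : Spherical} {z : ℂ} {M : Matrix (Fin 2) (Fin 2) ℤ}
    (hM : S.IsNormalized z M) {h : Bool} {x : Bool → ℂ} {ζ : ℂ} {m n : ℤ} (hζ : ζ ^ 8 = 1)
    (hm : x true = ζ * m) (hn : x false = ζ * (Complex.I * n))
    (hS : ∀ p q, S'.pairing p q
      = x h * S.pairing p q + if p = h then x (!h) * S.pairing (!p) q else 0) :
    ∃ z' M', S'.IsNormalized z' M' ∧ ∃ k : ℤ, M'.det = k ^ 2 * M.det := by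
  rw [isNormalized_iff] at hM
  obtain ⟨hz, h₀₀, h₀₁, h₁₀, h₁₁⟩ := hM
  have hζ' : ζ * ζ ^ 7 = 1 := by rw [← pow_succ', hζ]
  have hI := Complex.I_mul_I
  have hI₃ : Complex.I ^ 3 = -Complex.I := Complex.I_pow_three
  cases h
  -- `ζ ^ 7` is the inverse of `ζ`, and `-I` cancels the factor `I` of the diagonal coefficient `x
  -- false`. The `I` in the second row of the bracket matrix makes the off-diagonal entry `m`
  -- integral.
  · refine ⟨z * ζ ^ 7 * -Complex.I, !![n, 0; m, n] * M, isNormalized_iff.2 ⟨?_, ?_, ?_, ?_, ?_⟩,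
      n, ?_⟩
    · rw [mul_pow, mul_pow, ← pow_mul, mul_comm 7 8, pow_mul, hζ, hz, neg_pow, Complex.I_pow_eq_pow_mod]
      norm_num
    any_goals
      simp only [Matrix.mul_apply, Fin.sum_univ_two, Int.cast_add, Int.cast_mul, hS, h₀₀, h₀₁, h₁₀,
        h₁₁, hm, hn, Matrix.of_apply, Matrix.cons_val', Matrix.cons_val_zero, Matrix.cons_val_one,
        Matrix.cons_val_fin_one, Bool.not_true, Bool.not_false, if_true, Bool.true_eq_false, if_false]
      ring_nf
      simp only [hζ, Complex.I_sq, hI₃]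
      ring
    rw [Matrix.det_mul, Matrix.det_fin_two_of]
    ring
  -- Here the diagonal coefficient is `x true = ζ * m`, so only `ζ` has to be cancelled; the factor
  -- `I` of `x false` is absorbed by the second row.
  · refine ⟨z * ζ ^ 7, !![m, n; 0, m] * M, isNormalized_iff.2 ⟨?_, ?_, ?_, ?_, ?_⟩, m, ?_⟩
    · rw [mul_pow, ← pow_mul, mul_comm 7 8, pow_mul, hζ, hz]
      norm_num
    any_goals
      simp only [Matrix.mul_apply, Fin.sum_univ_two, Int.cast_add, Int.cast_mul, hS, h₀₀, h₀₁, h₁₀,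
        h₁₁, hm, hn, Matrix.of_apply, Matrix.cons_val', Matrix.cons_val_zero, Matrix.cons_val_one,
        Matrix.cons_val_fin_one, Bool.not_true, Bool.not_false, if_true, Bool.false_eq_true, if_false]
      ring_nf
      simp only [hζ, Complex.I_sq]
      ring
    rw [Matrix.det_mul, Matrix.det_fin_two_of]
    ring

/-- Inner connect sums multiply the normalized matrix on the right by a triangular matrix. -/
lemma IsNormalized.of_columns {S S' : Spherical} {z : ℂ} {M : Matrix (Fin 2) (Fin 2) ℤ}
    (hM : S.IsNormalized z M) {h : Bool} {x : Bool → ℂ} {ζ : ℂ} {m n : ℤ} (hζ : ζ ^ 8 = 1)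
    (hm : x true = ζ * m) (hn : x false = ζ * (Complex.I * n))
    (hS : ∀ p q, S'.pairing p q
      = x h * S.pairing p q + if q = h then x (!h) * S.pairing p (!q) else 0) :
    ∃ z' M', S'.IsNormalized z' M' ∧ ∃ k : ℤ, M'.det = k ^ 2 * M.det := by
  rw [isNormalized_iff] at hM
  obtain ⟨hz, h₀₀, h₀₁, h₁₀, h₁₁⟩ := hM
  have hI₃ : Complex.I ^ 3 = -Complex.I := Complex.I_pow_three
  cases h
  · refine ⟨z * ζ ^ 7 * -Complex.I, M * !![n, 0; m, n], isNormalized_iff.2 ⟨?_, ?_, ?_, ?_, ?_⟩,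
      n, ?_⟩
    · rw [mul_pow, mul_pow, ← pow_mul, mul_comm 7 8, pow_mul, hζ, hz, neg_pow, Complex.I_pow_eq_pow_mod]
      norm_num
    any_goals
      simp only [Matrix.mul_apply, Fin.sum_univ_two, Int.cast_add, Int.cast_mul, hS, h₀₀, h₀₁, h₁₀,
        h₁₁, hm, hn, Matrix.of_apply, Matrix.cons_val', Matrix.cons_val_zero, Matrix.cons_val_one,
        Matrix.cons_val_fin_one, Bool.not_true, Bool.not_false, if_true, Bool.true_eq_false, if_false]
      ring_nf
      simp only [hζ, Complex.I_sq, hI₃]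
      ring
    rw [Matrix.det_mul, Matrix.det_fin_two_of]
    ring
  · refine ⟨z * ζ ^ 7, M * !![m, n; 0, m], isNormalized_iff.2 ⟨?_, ?_, ?_, ?_, ?_⟩, m, ?_⟩
    · rw [mul_pow, ← pow_mul, mul_comm 7 8, pow_mul, hζ, hz]
      norm_num
    any_goals
      simp only [Matrix.mul_apply, Fin.sum_univ_two, Int.cast_add, Int.cast_mul, hS, h₀₀, h₀₁, h₁₀,
        h₁₁, hm, hn, Matrix.of_apply, Matrix.cons_val', Matrix.cons_val_zero, Matrix.cons_val_one,
        Matrix.cons_val_fin_one, Bool.not_true, Bool.not_false, if_true, Bool.false_eq_true, if_false]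
      ring_nf
      simp only [hζ, Complex.I_sq]
      ring
    rw [Matrix.det_mul, Matrix.det_fin_two_of]
    ring

lemma IsOuterSum.interchange {h : Bool}
    {e : Corner ⊕ (Corner ⊕ Corner) ≃ (Corner ⊕ Corner) ⊕ Bool × Bool} (he : IsOuterSum h e)
    {X : Ball} (S : Spherical) {x : Bool → ℂ} (hX : X.Resolves x) (p q : Bool) :
    (interchange ((X.union S.interchange).connect e)).pairing p q
      = x h * S.pairing p q + if q = h then x (!h) * S.pairing p (!q) else 0 := by
  rw [pairing_interchange, he X _ x hX, pairing_interchange, pairing_interchange]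

lemma IsNormalized.connectSum {S : Spherical} {z : ℂ} {M : Matrix (Fin 2) (Fin 2) ℤ}
    (hM : S.IsNormalized z M) {X : Ball} (hX : X.IsIntegral) (k : SumKind) :
    ∃ z' M', (k.apply S X).IsNormalized z' M' ∧ ∃ n : ℤ, M'.det = n ^ 2 * M.det := by
  obtain ⟨x, ζ, m, n, hX, hζ, hm, hn⟩ := hX
  cases k with
  | outerH => exact hM.of_rows hζ hm hn (isOuterSum_hRight X S x hX)
  | outerHOp => exact hM.of_rows hζ hm hn (isOuterSum_hLeft X S x hX)
  | outerV => exact hM.of_rows hζ hm hn (isOuterSum_vBelow X S x hX)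
  | outerVOp => exact hM.of_rows hζ hm hn (isOuterSum_vAbove X S x hX)
  -- An inner sum is the opposite outer sum of the interchanged tangle with the turned ball tangle,
  -- and turning does not change the coefficients `x`.
  | innerH => exact hM.of_columns hζ hm hn (isOuterSum_hLeft.interchange S hX.hTurn)
  | innerHOp => exact hM.of_columns hζ hm hn (isOuterSum_hRight.interchange S hX.hTurn)
  | innerV => exact hM.of_columns hζ hm hn (isOuterSum_vAbove.interchange S hX.vTurn)
  | innerVOp => exact hM.of_columns hζ hm hn (isOuterSum_vBelow.interchange S hX.vTurn)

/-- The brackets of two spherical tangles differ by a common eighth root of unity. -/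
def Proportional (S S' : Spherical) : Prop :=
  ∃ ζ : ℂ, ζ ^ 8 = 1 ∧ ∀ p q, S'.pairing p q = ζ * S.pairing p q

lemma Proportional.symm {S S' : Spherical} (h : Proportional S S') : Proportional S' S := by
  obtain ⟨ζ, hζ, h⟩ := h
  refine ⟨ζ ^ 7, by rw [← pow_mul, mul_comm 7 8, pow_mul, hζ, one_pow], fun p q => ?_⟩
  rw [h, ← mul_assoc, ← pow_succ, hζ, one_mul]

lemma Proportional.trans {S S' S'' : Spherical} (h : Proportional S S') (h' : Proportional S' S'') :
    Proportional S S'' := by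
  obtain ⟨ζ, hζ, h⟩ := h
  obtain ⟨ζ', hζ', h'⟩ := h'
  exact ⟨ζ' * ζ, by rw [mul_pow, hζ, hζ', one_mul], fun p q => by rw [h', h, mul_assoc]⟩

lemma IsNormalized.proportional {S S' : Spherical} {z : ℂ} {M : Matrix (Fin 2) (Fin 2) ℤ}
    (hM : S.IsNormalized z M) (h : Proportional S S') : ∃ z', S'.IsNormalized z' M := by
  obtain ⟨ζ, hζ, h⟩ := h.symm
  refine ⟨z * ζ, by rw [mul_pow, hM.1, hζ, one_mul], ?_⟩
  rw [hM.2, bracketMatrix_eq, bracketMatrix_eq]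
  ext i j
  fin_cases i <;> fin_cases j <;> simp [h] <;> ring

/-- Two integral multiples of the matrix differ by a factor whose eighth power is `1`. At a nonzero
entry this factor is rational, hence a sign. -/
lemma IsNormalized.F_eq {S : Spherical} {z : ℂ} {M : Matrix (Fin 2) (Fin 2) ℤ}
    (hM : S.IsNormalized z M) : S.F = {M, -M} := by
  obtain ⟨hz, hM⟩ := hM
  have hz₀ : z ≠ 0 := by
    rintro rfl
    norm_num at hz
  ext N
  simp only [F, Set.mem_ofPred_eq, Set.mem_insert_iff, Set.mem_singleton_iff]
  constructor
  · rintro ⟨w, hw, hN⟩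
    have hNM : ∀ i j, (N i j : ℂ) * z = w * M i j := fun i j => by
      have h₁ := congrFun (congrFun hN i) j
      have h₂ := congrFun (congrFun hM i) j
      simp only [Matrix.map_apply, Matrix.smul_apply, smul_eq_mul] at h₁ h₂
      rw [h₁, h₂]
      ring
    -- For the zero matrix the quotient `w / z` is not determined, but then `N` vanishes too.
    by_cases hM₀ : M = 0
    · left
      subst hM₀
      ext i j
      simpa [hz₀] using hNM i j
    · obtain ⟨i, j, hij⟩ : ∃ i j, M i j ≠ 0 := by
        by_contra! h
        exact hM₀ (by ext i j; exact h i j)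
      have h8 : (N i j) ^ 8 = (M i j) ^ 8 := by
        have := congrArg (· ^ 8) (hNM i j)
        simp only [mul_pow, hz, hw, one_mul, mul_one] at this
        exact_mod_cast this
      have hMc : (M i j : ℂ) ≠ 0 := by exact_mod_cast hij
      have habs : N i j = M i j ∨ N i j = -M i j := by
        rw [← abs_eq_abs]
        exact (pow_left_inj₀ (abs_nonneg _) (abs_nonneg _) (by norm_num : (8 : ℕ) ≠ 0)).1
          (by rw [← abs_pow, h8, abs_pow])
      have hwz : w = z ∨ w = -z := by
        rcases habs with h | h
        · left
          have := hNM i j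
          rw [h, mul_comm] at this
          exact (mul_right_cancel₀ hMc this).symm
        · right
          have := hNM i j
          rw [h] at this
          push_cast at this
          exact mul_right_cancel₀ hMc (by linear_combination -this)
      rcases hwz with rfl | rfl
      · left
        ext i j
        have := hNM i j
        rw [mul_comm] at this
        exact_mod_cast mul_left_cancel₀ hz₀ this
      · right
        ext i j
        have : (N i j : ℂ) = -M i j := mul_left_cancel₀ hz₀ (by linear_combination hNM i j)
        simpa using (by exact_mod_cast this : N i j = -M i j)
  · rintro (rfl | rfl)
    · exact ⟨z, hz, hM⟩
    · refine ⟨-z, by rw [neg_pow, hz]; norm_num, ?_⟩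
      rw [neg_smul, ← hM]
      ext i j
      simp

end Spherical

end TangleDiagram

namespace TangleDiagram

open Relation

/-! ### Checkerboard colourings -/

section Checkerboard

variable {H : Type} {τ ρ : H → H}

/-- Edges of a combinatorial map. -/
abbrev EdgeQuot (τ : H → H) : Type := Quot fun x y => y = τ x

open Classical in
/-- The matrix which sends a function on the quotient `q : H → Q` to the sums over the two ends of
every edge. -/
noncomputable def incidence (τ : H → H) {Q : Type} (q : H → Q) : Matrix (EdgeQuot τ) Q (ZMod 2) :=
  Matrix.of fun e v => (if q e.out = v then 1 else 0) + if q (τ e.out) = v then 1 else 0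

lemma edge_out (hτ : ∀ x, τ (τ x) = x) (x : H) :
    Quot.out (Quot.mk _ x : EdgeQuot τ) = x ∨ Quot.out (Quot.mk _ x : EdgeQuot τ) = τ x := by
  have h : EqvGen (fun x y => y = τ x) (Quot.out (Quot.mk _ x : EdgeQuot τ)) x :=
    Quot.eqvGen_exact (Quot.out_eq _)
  have := eqvGen_invariant (fun y => y = x ∨ y = τ x) (fun y z hz => ?_) h
  · exact this.mpr (.inl rfl)
  · subst hz
    refine propext ⟨?_, ?_⟩
    · rintro (rfl | rfl)
      · exact .inr rfl
      · exact .inl (hτ _)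
    · rintro (rfl | h)
      · exact .inr (hτ _).symm
      · left
        rw [← hτ y, h, hτ]

lemma incidence_mulVec [Fintype (EdgeQuot τ)] {Q : Type} [Fintype Q] (q : H → Q) (hτ : ∀ x, τ (τ x) = x) (h : Q → ZMod 2)
    (x : H) : (incidence τ q).mulVec h (Quot.mk _ x) = h (q x) + h (q (τ x)) := by
  classical
  have key : (incidence τ q).mulVec h (Quot.mk _ x)
      = h (q (Quot.out (Quot.mk _ x : EdgeQuot τ)))
        + h (q (τ (Quot.out (Quot.mk _ x : EdgeQuot τ)))) := by
    simp [incidence, Matrix.mulVec, dotProduct, add_mul, Finset.sum_add_distrib]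
  rw [key]
  rcases edge_out hτ x with h | h <;> rw [h]
  rw [hτ, add_comm]

lemma sum_edges [Fintype H] [Fintype (EdgeQuot τ)] (hτ : ∀ x, τ (τ x) = x) (hτ' : ∀ x, τ x ≠ x)
    (φ : H → ZMod 2) : ∑ e : EdgeQuot τ, (φ e.out + φ (τ e.out)) = ∑ x, φ x := by
  classical
  rw [← Finset.sum_fiberwise (s := Finset.univ) (g := fun x => (Quot.mk _ x : EdgeQuot τ))]
  refine Finset.sum_congr rfl fun e _ => ?_
  rw [← Finset.sum_pair (hτ' e.out).symm]
  refine Finset.sum_congr ?_ fun _ _ => rfl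
  ext x
  simp only [Finset.mem_insert, Finset.mem_singleton, Finset.mem_filter, Finset.mem_univ, true_and]
  constructor
  · rintro (rfl | rfl)
    · exact Quot.out_eq e
    · have : (Quot.mk _ e.out : EdgeQuot τ) = Quot.mk _ (τ e.out) := Quot.sound rfl
      rw [← this, Quot.out_eq]
  · rintro rfl
    rcases edge_out hτ x with h | h
    · exact .inl h.symm
    · right
      rw [h, hτ]

/-- Summation by parts: an edge sum over both ends becomes a sum over half-edges. -/
lemma dotProduct_incidence [Fintype H] [Fintype (EdgeQuot τ)] {Q : Type} [Fintype Q] (q : H → Q)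
    (hτ : ∀ x, τ (τ x) = x) (hτ' : ∀ x, τ x ≠ x) (g : EdgeQuot τ → ZMod 2) (h : Q → ZMod 2) :
    dotProduct g ((incidence τ q).mulVec h) = ∑ x, g (Quot.mk _ x) * h (q x) := by
  rw [← sum_edges hτ hτ']
  refine Finset.sum_congr rfl fun e _ => ?_
  have h₁ : (Quot.mk _ (τ e.out) : EdgeQuot τ) = e := by
    have : (Quot.mk _ e.out : EdgeQuot τ) = Quot.mk _ (τ e.out) := Quot.sound rfl
    rw [← this, Quot.out_eq]
  have h₂ : (incidence τ q).mulVec h e = h (q e.out) + h (q (τ e.out)) := by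
    rw [← incidence_mulVec q hτ, Quot.out_eq]
  rw [h₁, h₂, Quot.out_eq, mul_add]

/-- The kernel consists of functions constant along edges. By `hρ` these descend to the connected
components, so the kernel is no larger than the space of functions on components. -/
lemma card_le_rank_incidence [Fintype (EdgeQuot τ)] {Q : Type} [Fintype Q] (q : H → Q)
    [Fintype (Quot fun x y => y = τ x ∨ y = ρ x)]
    (hτ : ∀ x, τ (τ x) = x) (hq : Function.Surjective q)
    (hρ : ∀ h : Q → ZMod 2, (∀ x, h (q (τ x)) = h (q x)) → ∀ x, h (q (ρ x)) = h (q x)) :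
    Fintype.card Q ≤ (incidence τ q).rank + Fintype.card (Quot fun x y => y = τ x ∨ y = ρ x) := by
  have h₁ := LinearMap.finrank_range_add_finrank_ker (incidence τ q).mulVecLin
  rw [Module.finrank_fintype_fun_eq_card] at h₁
  have hker : ∀ h ∈ LinearMap.ker (incidence τ q).mulVecLin, ∀ x, h (q (τ x)) = h (q x) := by
    intro h hh x
    have := congrFun (LinearMap.mem_ker.1 hh) (Quot.mk _ x)
    rw [Matrix.mulVecLin_apply, incidence_mulVec q hτ, Pi.zero_apply] at this
    rw [← sub_eq_zero, CharTwo.sub_eq_add, add_comm, this]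
  let L : LinearMap.ker (incidence τ q).mulVecLin →ₗ[ZMod 2]
      ((Quot fun x y => y = τ x ∨ y = ρ x) → ZMod 2) :=
    { toFun := fun h => Quot.lift (fun x => h.1 (q x)) (by
        rintro x y (rfl | rfl)
        · exact (hker _ h.2 x).symm
        · exact (hρ _ (hker _ h.2) x).symm)
      map_add' := fun a b => by
        ext c
        induction c using Quot.ind
        rfl
      map_smul' := fun a b => by
        ext c
        induction c using Quot.ind
        rfl }
  have hL : Function.Injective L := by
    intro a b hab
    ext v
    obtain ⟨x, rfl⟩ := hq v
    exact congrFun hab (Quot.mk _ x)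
  have h₂ := LinearMap.finrank_le_finrank_of_injective hL
  rw [Module.finrank_fintype_fun_eq_card] at h₂
  rw [Matrix.rank]
  omega

/-- A combinatorial map on the sphere all of whose vertices have even degree has a checkerboard
colouring. -/
lemma exists_checkerboard [Finite H] {κ : H → H} (hτ : ∀ x, τ (τ x) = x) (hτ' : ∀ x, τ x ≠ x)
    (hρ : Function.Bijective ρ) (hκ : ∀ x, κ (κ x) = x) (hκ' : ∀ x, κ x ≠ x)
    (hκρ : ∀ x, EqvGen (fun x y => y = ρ x) x (κ x))
    (euler : Nat.card (Quot fun x y => y = ρ x) + Nat.card (Quot fun x y => y = ρ (τ x))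
      = Nat.card (Quot fun x y => y = τ x) + 2 * Nat.card (Quot fun x y => y = τ x ∨ y = ρ x)) :
    ∃ χ : H → ZMod 2, ∀ x, χ (τ x) = χ x + 1 ∧ χ (ρ x) = χ x + 1 := by
  classical
  have : Fintype H := Fintype.ofFinite H
  let V := Quot fun x y => y = ρ x
  let F := Quot fun x y => y = ρ (τ x)
  have : Fintype V := Fintype.ofFinite _
  have : Fintype F := Fintype.ofFinite _
  have : Fintype (EdgeQuot τ) := Fintype.ofFinite _
  have : Fintype (Quot fun x y => y = τ x ∨ y = ρ x) := Fintype.ofFinite _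
  let v : H → V := Quot.mk _
  let f : H → F := Quot.mk _
  have hv : ∀ x, v (ρ x) = v x := fun x => Eq.symm (Quot.sound (r := fun x y => y = ρ x) rfl)
  -- Faces are the orbits of `ρ ∘ τ`; the half-edge following `x` at its vertex thus lies on the
  -- face on the other side of the edge of `x`.
  have hf : ∀ x, f (ρ x) = f (τ x) := fun x => by
    have : f (τ x) = f (ρ (τ (τ x))) := Quot.sound rfl
    rw [this, hτ]
  have hV := card_le_rank_incidence (ρ := ρ) v hτ Quot.mk_surjective fun h _ x => by rw [hv]
  have hF := card_le_rank_incidence (ρ := ρ) f hτ Quot.mk_surjective fun h hh x => by rw [hf, hh]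
  have horth : ∀ w : EdgeQuot τ → ZMod 2, (∀ h, dotProduct w ((incidence τ v).mulVec h) = 0) →
      w ∈ LinearMap.ker (incidence τ v).transpose.mulVecLin := by
    intro w hw
    rw [LinearMap.mem_ker, Matrix.mulVecLin_apply, Matrix.mulVec_transpose]
    refine dotProduct_eq_zero _ fun h => ?_
    rw [← Matrix.dotProduct_mulVec, hw]
  -- Boundaries of faces are cycles: around a vertex every face corner is counted twice, once from
  -- each of its sides, as the reindexing by `ρ` shows.
  have hle : LinearMap.range (incidence τ f).mulVecLin
      ≤ LinearMap.ker (incidence τ v).transpose.mulVecLin := by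
    rintro _ ⟨g, rfl⟩
    refine horth _ fun h => ?_
    rw [dotProduct_incidence v hτ hτ']
    simp only [Matrix.mulVecLin_apply, incidence_mulVec f hτ, add_mul, Finset.sum_add_distrib]
    have : ∑ x, g (f (τ x)) * h (v x) = ∑ x, g (f x) * h (v x) := by
      rw [← (Equiv.ofBijective ρ hρ).sum_comp fun x => g (f x) * h (v x)]
      refine Finset.sum_congr rfl fun x _ => ?_
      rw [Equiv.ofBijective_apply, hf, hv]
    rw [this, CharTwo.add_self_eq_zero]
  -- The Euler characteristic leaves no room for further cycles: the two rank estimates force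
  -- equality, which is the vanishing of the first homology mod 2.
  have hrange : LinearMap.range (incidence τ f).mulVecLin
      = LinearMap.ker (incidence τ v).transpose.mulVecLin := by
    refine Submodule.eq_of_le_of_finrank_le hle ?_
    have h₁ := LinearMap.finrank_range_add_finrank_ker (incidence τ v).transpose.mulVecLin
    rw [Module.finrank_fintype_fun_eq_card] at h₁
    have h₂ := Matrix.rank_transpose (incidence τ v)
    simp only [Nat.card_eq_fintype_card] at euler
    rw [Matrix.rank] at h₂ hF
    change Fintype.card V + Fintype.card F = Fintype.card (EdgeQuot τ) + _ at euler
    omega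
  -- The sum of all edges is a cycle because all degrees are even: `κ` pairs the half-edges at each
  -- vertex. The faces that it bounds are the black ones.
  have hone : (fun _ => 1 : EdgeQuot τ → ZMod 2) ∈ LinearMap.range (incidence τ f).mulVecLin := by
    rw [hrange]
    refine horth _ fun h => ?_
    rw [dotProduct_incidence v hτ hτ']
    refine Finset.sum_ninvolution κ (fun x => ?_) (fun x _ => hκ' x) (fun _ => Finset.mem_univ _) hκ
    have : v x = v (κ x) := Quot.eqvGen_sound (hκρ x)
    rw [this, CharTwo.add_self_eq_zero]
  obtain ⟨g, hg⟩ := hone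
  have key : ∀ x, g (f (τ x)) = g (f x) + 1 := fun x => by
    have := congrFun hg (Quot.mk _ x)
    rw [Matrix.mulVecLin_apply, incidence_mulVec f hτ] at this
    rw [← this, ← add_assoc, CharTwo.add_self_eq_zero, zero_add]
  exact ⟨fun x => g (f x), fun x => ⟨key x, by simp only [hf, key]⟩⟩

end Checkerboard

/-! ### Parity of connected states -/

section Parity

variable {H : Type} {τ T T' : H → H} {χ : H → Bool}

/-- The composition of two involutions which flip the colours, as a permutation of the elements
with the colour `true`. -/
def colourPerm (T τ : H → H) (χ : H → Bool) (hT : ∀ x, T (T x) = x) (hτ : ∀ x, τ (τ x) = x)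
    (hχT : ∀ x, χ (T x) = !χ x) (hχτ : ∀ x, χ (τ x) = !χ x) : Equiv.Perm {x // χ x = true} where
  toFun x := ⟨T (τ x), by rw [hχT, hχτ, x.2]; rfl⟩
  invFun x := ⟨τ (T x), by rw [hχτ, hχT, x.2]; rfl⟩
  left_inv x := by simp [hT, hτ]
  right_inv x := by simp [hT, hτ]

lemma sameCycle_colourPerm (hT : ∀ x, T (T x) = x) (hτ : ∀ x, τ (τ x) = x)
    (hχT : ∀ x, χ (T x) = !χ x) (hχτ : ∀ x, χ (τ x) = !χ x)
    (h : Connects fun x y => y = τ x ∨ y = T x) (x y : {x // χ x = true}) :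
    (colourPerm T τ χ hT hτ hχT hχτ).SameCycle x y := by
  -- Half-edges of the wrong colour are moved across their vertex by `T`. Then a `T`-step fixes the
  -- image under `o`, and a `τ`-step moves it once along the permutation, forwards or backwards.
  let o : H → {x // χ x = true} := fun x =>
    if hx : χ x = true then ⟨x, hx⟩ else ⟨T x, by rw [hχT]; simpa using hx⟩
  have ho : ∀ x : {x // χ x = true}, o x = x := fun x => dif_pos x.2
  have key : ∀ x y : H, EqvGen (fun x y => y = τ x ∨ y = T x) x y →
      (colourPerm T τ χ hT hτ hχT hχτ).SameCycle (o x) (o y) := by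
    intro x y hxy
    induction hxy with
    | rel x y h =>
      by_cases hx : χ x = true
      · have hox : o x = ⟨x, hx⟩ := dif_pos hx
        rcases h with rfl | rfl
        · have : o (τ x) = colourPerm T τ χ hT hτ hχT hχτ (o x) := by
            rw [hox]
            exact dif_neg (by simp [hχτ, hx])
          rw [this]
          exact Equiv.Perm.sameCycle_apply_right.2 (.refl _ _)
        · have : o (T x) = o x := by
            rw [hox]
            refine (dif_neg (by simp [hχT, hx])).trans (Subtype.ext (hT x))
          rw [this]
      · have hox : o x = ⟨T x, by rw [hχT]; simpa using hx⟩ := dif_neg hx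
        rcases h with rfl | rfl
        · have : o x = colourPerm T τ χ hT hτ hχT hχτ (o (τ x)) := by
            have h' : o (τ x) = ⟨τ x, by rw [hχτ]; simpa using hx⟩ :=
              dif_pos (by rw [hχτ]; simpa using hx)
            rw [hox, h']
            exact Subtype.ext (congrArg T (hτ x).symm)
          rw [this]
          exact Equiv.Perm.sameCycle_apply_left.2 (.refl _ _)
        · have : o (T x) = o x := by
            rw [hox]
            exact dif_pos (by rw [hχT]; simpa using hx)
          rw [this]
    | refl x => exact .refl _ _
    | symm x y _ ih => exact ih.symm
    | trans x y z _ _ ih₁ ih₂ => exact ih₁.trans ih₂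
  have := key x y (h x y)
  rwa [ho, ho] at this

lemma sign_of_forall_sameCycle {α : Type*} [Fintype α] [DecidableEq α] {π : Equiv.Perm α}
    (h : ∀ x y, π.SameCycle x y) [Nontrivial α] :
    Equiv.Perm.sign π = -(-1) ^ Fintype.card α := by
  have hne : ∀ x, π x ≠ x := fun x hx => by
    obtain ⟨y, hy⟩ := exists_ne x
    obtain ⟨i, hi⟩ := h x y
    rw [Equiv.Perm.zpow_apply_eq_self_of_apply_eq_self hx] at hi
    exact hy hi.symm
  obtain ⟨x, -, -⟩ := exists_pair_ne α
  have hc : π.IsCycle := ⟨x, hne x, fun y _ => h x y⟩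
  rw [hc.sign]
  congr 2
  rw [Finset.card_eq_iff_eq_univ]
  ext y
  simp [hne]

/-- An even involution is a product of an even number of disjoint transpositions. -/
lemma four_dvd_card_support {α : Type*} [Fintype α] [DecidableEq α] {π : Equiv.Perm α}
    (h : π ^ 2 = 1) (hs : Equiv.Perm.sign π = 1) : 4 ∣ π.support.card := by
  have hc := Equiv.Perm.cycleType_of_pow_prime_eq_one (p := 2) h
  rw [Equiv.Perm.sign_of_cycleType, hc, Multiset.sum_replicate, Multiset.card_replicate] at hs
  rw [← Equiv.Perm.sum_cycleType, hc, Multiset.sum_replicate]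
  simp only [smul_eq_mul] at hs ⊢
  have : Even (Multiset.card π.cycleType * 2 + Multiset.card π.cycleType) := by
    by_contra ho
    rw [Nat.not_even_iff_odd] at ho
    rw [ho.neg_one_pow] at hs
    exact absurd hs (by decide)
  rw [Nat.even_iff] at this
  omega

/-- Two ways of connecting the half-edges at the vertices of a map with a checkerboard colouring,
which both yield a single circle, differ at an even number of vertices. -/
lemma eight_dvd_card_ne [Finite H] (hτ : ∀ x, τ (τ x) = x) (hT : ∀ x, T (T x) = x)
    (hT' : ∀ x, T' (T' x) = x) (hχτ : ∀ x, χ (τ x) = !χ x) (hχT : ∀ x, χ (T x) = !χ x)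
    (hχT' : ∀ x, χ (T' x) = !χ x) (hcomm : ∀ x, T (T' x) = T' (T x))
    (h : Connects fun x y => y = τ x ∨ y = T x) (h' : Connects fun x y => y = τ x ∨ y = T' x) :
    8 ∣ Nat.card {x // T x ≠ T' x} := by
  classical
  have : Fintype H := Fintype.ofFinite H
  set π := colourPerm T τ χ hT hτ hχT hχτ
  set π' := colourPerm T' τ χ hT' hτ hχT' hχτ
  set Q := colourPerm T' T χ hT' hT hχT' hχT
  -- `T` cancels in the middle. Both `π` and `π'` are single cycles on the same set, so `Q` is even;
  -- it is an involution because `T` and `T'` commute.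
  have hQ : π' = Q * π := by
    ext x
    show T' (τ x) = T' (T (T (τ x)))
    rw [hT]
  have hsign : Equiv.Perm.sign π' = Equiv.Perm.sign π := by
    -- The sign formula for one full cycle fails on a single point, where both permutations are
    -- trivial.
    rcases subsingleton_or_nontrivial {x // χ x = true} with hs | hs
    · rw [Subsingleton.elim π π']
    · rw [sign_of_forall_sameCycle (sameCycle_colourPerm hT hτ hχT hχτ h),
        sign_of_forall_sameCycle (sameCycle_colourPerm hT' hτ hχT' hχτ h')]
  have hQ₁ : Equiv.Perm.sign Q = 1 := by
    rw [hQ, Equiv.Perm.sign_mul] at hsign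
    exact mul_eq_right.1 hsign
  have hQ₂ : Q ^ 2 = 1 := by
    ext x
    show T' (T (T' (T x))) = x
    rw [hcomm, hT', hT]
  have hmove : ∀ x, T' (T x) ≠ x ↔ T x ≠ T' x := fun x => by
    rw [not_iff_not]
    constructor
    · intro h
      rw [← hT' (T x), h]
    · intro h
      rw [h, hT']
  let S : Finset H := {x | T x ≠ T' x ∧ χ x = true}
  let S' : Finset H := {x | T x ≠ T' x ∧ χ x = false}
  -- `T` exchanges the colours and preserves the set where the two connections differ, which turns
  -- divisibility by four for one colour into divisibility by eight.
  have hSS' : S.card = S'.card := by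
    have hmem : ∀ x, T x ≠ T' x → T (T x) ≠ T' (T x) := fun x hx h => by
      rw [hT] at h
      exact (hmove x).2 hx h.symm
    refine Finset.card_nbij' T T ?_ ?_ (fun x _ => hT x) (fun x _ => hT x)
    · intro x hx
      simp only [S, S', Finset.coe_filter, Finset.mem_univ, true_and, Set.mem_ofPred_eq] at hx ⊢
      exact ⟨hmem x hx.1, by rw [hχT, hx.2]; rfl⟩
    · intro x hx
      simp only [S, S', Finset.coe_filter, Finset.mem_univ, true_and, Set.mem_ofPred_eq] at hx ⊢
      exact ⟨hmem x hx.1, by rw [hχT, hx.2]; rfl⟩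
  have hcard : Nat.card {x // T x ≠ T' x} = S.card + S'.card := by
    rw [Nat.card_eq_fintype_card, Fintype.card_subtype, ← Finset.card_union_of_disjoint]
    · congr 1
      ext x
      simp only [S, S', Finset.mem_union, Finset.mem_filter, Finset.mem_univ, true_and, ← and_or_left]
      cases χ x <;> simp
    · rw [Finset.disjoint_left]
      intro x hx hx'
      simp only [S, S', Finset.mem_filter, Finset.mem_univ, true_and] at hx hx'
      simp [hx.2] at hx'
  have hS : S = Q.support.map (Function.Embedding.subtype _) := by
    ext x
    simp only [S, Finset.mem_map, Finset.mem_filter, Finset.mem_univ, true_and,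
      Equiv.Perm.mem_support, Function.Embedding.subtype_apply]
    constructor
    · rintro ⟨hx, hχ⟩
      exact ⟨⟨x, hχ⟩, fun h => (hmove x).2 hx (congrArg Subtype.val h), rfl⟩
    · rintro ⟨y, hy, rfl⟩
      exact ⟨(hmove y.1).1 fun h => hy (Subtype.ext h), y.2⟩
  have hdvd : 4 ∣ S.card := by
    rw [hS, Finset.card_map]
    exact four_dvd_card_support hQ₂ hQ₁
  rw [hcard, ← hSS']
  omega

end Parity

/-! ### Colourings of planar diagrams and integrality of state sums. -/

namespace Diagram

variable {B : Type}

/-- A colouring of the half-edges which alternates along the edges and around the vertices. -/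
structure IsColouring (D : Diagram B) (r : B → B) (χ : D.Half → Bool) : Prop where
  mate : ∀ x, χ (D.mate x) = !χ x
  rot : ∀ x, χ (D.rot r x) = !χ x

lemma PlanarWith.exists_colouring [Finite B] {D : Diagram B} {r : B → B} (hD : D.PlanarWith r)
    (hr : ∀ b, r (r (r (r b))) = b) (hr' : ∀ b, r (r b) ≠ b) : ∃ χ, D.IsColouring r χ := by
  -- Opposite half-edges at a vertex are paired. A hole, like a crossing, is a four-valent vertex.
  let κ : D.Half → D.Half
    | .crossing c k => .crossing c (k + 2)
    | .joint j e => .joint j (!e)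
    | .boundary b => .boundary (r (r b))
  have h2 : ∀ k : Fin 4, k + 2 ≠ k := by decide
  have h4 : ∀ k : Fin 4, k + 2 + 2 = k := by decide
  have hrot : Function.Injective (D.rot r) := by
    have : ∀ x, D.rot r (D.rot r (D.rot r (D.rot r x))) = x := by
      have h : ∀ k : Fin 4, k + 1 + 1 + 1 + 1 = k := by decide
      rintro (⟨c, k⟩ | ⟨j, e⟩ | b) <;> simp [Diagram.rot, h, hr]
    exact Function.LeftInverse.injective (g := fun x => D.rot r (D.rot r (D.rot r x))) this
  obtain ⟨χ, hχ⟩ := exists_checkerboard (κ := κ) D.mate_mate D.mate_ne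
    (Finite.injective_iff_bijective.1 hrot)
    (by rintro (⟨c, k⟩ | ⟨j, e⟩ | b) <;> simp [κ, h4, hr])
    (by rintro (⟨c, k⟩ | ⟨j, e⟩ | b) <;> simp [κ, hr'])
    (by
      rintro (⟨c, k⟩ | ⟨j, e⟩ | b)
      · refine .trans _ (.crossing c (k + 1)) _ (.rel _ _ rfl) (.rel _ _ ?_)
        show HalfEdge.crossing c (k + 2) = .crossing c (k + 1 + 1)
        rw [add_assoc]
        rfl
      · exact .rel _ _ rfl
      · exact .trans _ (.boundary (r b)) _ (.rel _ _ rfl) (.rel _ _ rfl))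
    hD
  have h01 : ∀ a : ZMod 2, decide (a + 1 = 1) = !decide (a = 1) := by decide
  exact ⟨fun x => decide (χ x = 1), fun x => by rw [(hχ x).1, h01], fun x => by rw [(hχ x).2, h01]⟩

/-- The half-edge at which one continues in a state whose boundary points are joined by `n`. -/
def closedThrough (D : Diagram B) (s : D.Crossing → Bool) (n : B → B) : D.Half → D.Half
  | .crossing c k => .crossing c (Link.split (s c) k)
  | .joint j e => .joint j (!e)
  | .boundary b => .boundary (n b)

lemma connects_closedThrough {D : Diagram B} {s : D.Crossing → Bool} {r : B → B → Prop} {n : B → B}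
    (h : Connects (D.Closed s r)) (hr : ∀ b b', r b b' → b' = n b) :
    Connects fun x y => y = D.mate x ∨ y = D.closedThrough s n x := by
  refine h.mono fun x y hxy => ?_
  rcases hxy with (rfl | rfl) | ⟨b, b', rfl, rfl, hb⟩
  · exact .rel _ _ (.inl rfl)
  · rcases x with ⟨c, k⟩ | ⟨j, e⟩ | b
    · exact .rel _ _ (.inr rfl)
    · exact .rel _ _ (.inr rfl)
    · exact .refl _
  · rw [hr b b' hb]
    exact .rel _ _ (.inr rfl)

/-- Either splitting connects neighbouring half-edges, and neighbours have opposite colours. -/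
lemma IsColouring.split {D : Diagram B} {r : B → B} {χ : D.Half → Bool} (h : D.IsColouring r χ)
    (c : D.Crossing) (a : Bool) (k : Fin 4) :
    χ (.crossing c (Link.split a k)) = !χ (.crossing c k) := by
  have key : ∀ (a : Bool) (k : Fin 4), Link.split a k = k + 1 ∨ k = Link.split a k + 1 := by decide
  rcases key a k with hk | hk
  · rw [hk]
    exact h.rot (.crossing c k)
  · have := h.rot (.crossing c (Link.split a k))
    rw [Diagram.rot, ← hk] at this
    rw [this, Bool.not_not]

/-- Parity of the states of a planar diagram with closed boundary which consist of one circle. -/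
lemma IsColouring.eight_dvd [Finite B] {D : Diagram B} {r : B → B} {χ : D.Half → Bool}
    (h : D.IsColouring r χ) {s s' : D.Crossing → Bool} {n n' : B → B} {q q' : B → B → Prop}
    (hs : Connects (D.Closed s q)) (hs' : Connects (D.Closed s' q'))
    (hq : ∀ b b', q b b' → b' = n b) (hq' : ∀ b b', q' b b' → b' = n' b)
    (hn : ∀ b, n (n b) = b) (hn' : ∀ b, n' (n' b) = b) (hnn' : ∀ b, n (n' b) = n' (n b))
    (hχ : ∀ b, χ (.boundary (n b)) = !χ (.boundary b))
    (hχ' : ∀ b, χ (.boundary (n' b)) = !χ (.boundary b)) :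
    8 ∣ 4 * Nat.card {c // s c ≠ s' c} + Nat.card {b // n b ≠ n' b} := by
  have hsplit : ∀ a k, Link.split a (Link.split a k) = k := by decide
  have hcomm : ∀ a a' k, Link.split a (Link.split a' k) = Link.split a' (Link.split a k) := by decide
  have hne : ∀ a a' k, Link.split a k ≠ Link.split a' k ↔ a ≠ a' := by decide
  have key := eight_dvd_card_ne (τ := D.mate) (T := D.closedThrough s n)
    (T' := D.closedThrough s' n') (χ := χ) D.mate_mate
    (by rintro (⟨c, k⟩ | ⟨j, e⟩ | b) <;> simp [closedThrough, hsplit, hn])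
    (by rintro (⟨c, k⟩ | ⟨j, e⟩ | b) <;> simp [closedThrough, hsplit, hn']) h.mate
    (by
      rintro (⟨c, k⟩ | ⟨j, e⟩ | b)
      · exact h.split c _ k
      · exact h.rot (.joint j e)
      · exact hχ b)
    (by
      rintro (⟨c, k⟩ | ⟨j, e⟩ | b)
      · exact h.split c _ k
      · exact h.rot (.joint j e)
      · exact hχ' b)
    (by rintro (⟨c, k⟩ | ⟨j, e⟩ | b) <;> simp [closedThrough, hcomm, hnn'])
    (connects_closedThrough hs hq) (connects_closedThrough hs' hq')
  -- A crossing with different splittings contributes all its four half-edges, a joint contributes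
  -- none.
  let f : {x : D.Half // D.closedThrough s n x ≠ D.closedThrough s' n' x} ≃
      ({c // s c ≠ s' c} × Fin 4) ⊕ {b // n b ≠ n' b} :=
    { toFun := fun
        | ⟨.crossing c k, hx⟩ => .inl (⟨c, fun h => hx (by simp [closedThrough, h])⟩, k)
        | ⟨.joint j e, hx⟩ => (hx rfl).elim
        | ⟨.boundary b, hx⟩ => .inr ⟨b, fun h => hx (by simp [closedThrough, h])⟩
      invFun := fun
        | .inl (c, k) => ⟨.crossing c.1 k, fun h => (hne _ _ _).2 c.2 (HalfEdge.crossing.inj h).2⟩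
        | .inr b => ⟨.boundary b.1, fun h => b.2 (HalfEdge.boundary.inj h)⟩
      left_inv := by
        rintro ⟨⟨c, k⟩ | ⟨j, e⟩ | b, hx⟩
        · rfl
        · exact (hx rfl).elim
        · rfl
      right_inv := by rintro (⟨c, k⟩ | b) <;> rfl }
  rw [Nat.card_congr f, Nat.card_sum, Nat.card_prod, Nat.card_eq_fintype_card (α := Fin 4),
    Fintype.card_fin, mul_comm] at key
  exact key

lemma card_ne_add {C : Type} [Finite C] (s s' : C → Bool) :
    ∃ j : ℕ, Nat.card {c // s c = true} + Nat.card {c // s' c = true}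
      = Nat.card {c // s c ≠ s' c} + 2 * j := by
  classical
  have : Fintype C := Fintype.ofFinite C
  refine ⟨(Finset.univ.filter fun c => s c = true ∧ s' c = true).card, ?_⟩
  simp only [Nat.card_eq_fintype_card, Fintype.card_subtype, Finset.card_filter, two_mul,
    ← Finset.sum_add_distrib]
  refine Finset.sum_congr rfl fun c _ => ?_
  cases s c <;> cases s' c <;> rfl

lemma card_true_add_card_false {C : Type} [Finite C] (s : C → Bool) :
    Nat.card {c // s c = true} + Nat.card {c // s c = false} = Nat.card C := by
  classical
  have : Fintype C := Fintype.ofFinite C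
  have h : Nat.card C = ∑ _c : C, 1 := by simp
  rw [h]
  simp only [Nat.card_eq_fintype_card, Fintype.card_subtype, Finset.card_filter,
    ← Finset.sum_add_distrib]
  refine Finset.sum_congr rfl fun c _ => ?_
  cases s c <;> rfl

/-- A family of closed state sums, in which the connected states have a well-defined parity, is
integral up to a common eighth root of unity. -/
lemma exists_integral [Finite B] (D : Diagram B) {ι : Type} (q : ι → B → B → Prop) (w : ι → ℕ)
    (h : ∀ i i' s s', Connects (D.Closed s (q i)) → Connects (D.Closed s' (q i')) →
      Even (Nat.card {c // s c ≠ s' c} + w i + w i')) :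
    ∃ ζ : ℂ, ζ ^ 8 = 1 ∧ ∀ i, ∃ m : ℤ, D.closedSum (q i) = ζ * (Complex.I ^ w i * m) := by
  classical
  have : Fintype D.Crossing := Fintype.ofFinite _
  by_cases hex : ∃ i s, Connects (D.Closed s (q i))
  · obtain ⟨i₀, s₀, h₀⟩ := hex
    set ε := Nat.card {c // s₀ c = true} + w i₀ with hε
    set N := Nat.card D.Crossing
    -- The unit is read off from one connected state `s₀`; `A² = I` turns every weight into `A⁻ᴺ`
    -- times a power of `I`.
    refine ⟨Link.A⁻¹ ^ N * Complex.I ^ ε, ?_, fun i => ?_⟩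
    · rw [mul_pow, ← pow_mul, ← pow_mul, mul_comm N, mul_comm ε, pow_mul, pow_mul, inv_pow,
        Link.A_pow_eight, Complex.I_pow_eq_pow_mod]
      norm_num
    · have hterm : ∀ s, ∃ m : ℤ, weight s * indic (Connects (D.Closed s (q i)))
          = Link.A⁻¹ ^ N * Complex.I ^ ε * (Complex.I ^ w i * m) := by
        intro s
        by_cases hs : Connects (D.Closed s (q i))
        · obtain ⟨j, hj⟩ := card_ne_add s s₀
          obtain ⟨l, hl⟩ := h i i₀ s s₀ hs h₀
          -- By the parity hypothesis the exponents of `I` for `s` and for `ε + w i` agree modulo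
          -- two; this power of `-1 = I²` is their discrepancy.
          refine ⟨(-1) ^ (Nat.card {c // s c = true} + l + j), ?_⟩
          have hN := card_true_add_card_false s
          have hw : weight s = Link.A⁻¹ ^ N * Complex.I ^ Nat.card {c // s c = true} := by
            rw [weight, ← Link.A_sq, ← pow_mul, show N = _ from hN.symm, pow_add, two_mul, pow_add]
            have hA : Link.A⁻¹ ^ Nat.card {c // s c = true} * Link.A ^ Nat.card {c // s c = true}
                = 1 := by
              rw [← mul_pow, inv_mul_cancel₀ Link.A_ne_zero, one_pow]
            linear_combination (-Link.A ^ Nat.card {c // s c = true}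
              * Link.A⁻¹ ^ Nat.card {c // s c = false}) * hA
          rw [indic_of hs, mul_one, hw]
          push_cast
          rw [← Complex.I_sq, ← pow_mul, mul_assoc, ← pow_add, ← pow_add]
          congr 1
          have he : ε + (w i + 2 * (Nat.card {c // s c = true} + l + j))
              = Nat.card {c // s c = true} + 4 * (l + j) := by omega
          rw [he, pow_add, pow_mul, Complex.I_pow_four, one_pow, mul_one]
        · exact ⟨0, by rw [indic_not hs]; simp⟩
      choose m hm using hterm
      refine ⟨∑ s, m s, ?_⟩
      rw [closedSum, finsum_eq_sum_of_fintype]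
      push_cast
      rw [Finset.mul_sum, Finset.mul_sum]
      exact Finset.sum_congr rfl fun s _ => hm s
  · push Not at hex
    refine ⟨1, one_pow _, fun i => ⟨0, ?_⟩⟩
    simp [closedSum, indic_not (hex i _)]

end Diagram


lemma split_eq_or (p : Bool) (c : Corner) : Link.split p c = c - 1 ∨ c = Link.split p c - 1 := by
  revert p c
  decide

lemma split_eq_or' (p : Bool) (c : Corner) : Link.split p c = c + 1 ∨ c = Link.split p c + 1 := by
  revert p c
  decide

lemma card_split_ne (p p' : Bool) :
    Nat.card {c : Corner // Link.split p c ≠ Link.split p' c} = if p = p' then 0 else 4 := by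
  rw [Nat.card_eq_fintype_card]
  revert p p'
  decide

lemma split_split (p : Bool) (c : Corner) : Link.split p (Link.split p c) = c := by
  revert p c
  decide

lemma split_comm (p q : Bool) (c : Corner) :
    Link.split p (Link.split q c) = Link.split q (Link.split p c) := by
  revert p q c
  decide

/-! ### Resolution of planar ball tangles. -/

namespace Ball

lemma IsPlanar.colour_split {X : Ball} {χ : Diagram.Half X → Bool}
    (h : Diagram.IsColouring X (fun c => c - 1) χ) (p : Bool) (c : Corner) :
    χ (.boundary (Link.split p c)) = !χ (.boundary c) := by
  rcases split_eq_or p c with hc | hc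
  · rw [hc]
    exact h.rot (.boundary c)
  · have := h.rot (.boundary (Link.split p c))
    rw [Diagram.rot, ← hc] at this
    rw [this, Bool.not_not]

lemma IsPlanar.exists_colouring {X : Ball} (hX : X.IsPlanar) :
    ∃ χ, Diagram.IsColouring X (fun c => c - 1) χ :=
  Diagram.PlanarWith.exists_colouring hX (by decide) (by decide)

/-- A changed closure moves four boundary points, exactly as many as the half-edges moved by a
changed crossing. -/
lemma IsPlanar.even {X : Ball} (hX : X.IsPlanar) {p p' : Bool} {s s' : X.Crossing → Bool}
    (h : Connects (X.Closed s (SplitRel p))) (h' : Connects (X.Closed s' (SplitRel p'))) :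
    Even (Nat.card {c // s c ≠ s' c} + if p = p' then 0 else 1) := by
  obtain ⟨χ, hχ⟩ := hX.exists_colouring
  have := hχ.eight_dvd h h' (n := Link.split p) (n' := Link.split p') (fun _ _ h => h)
    (fun _ _ h => h) (split_split p) (split_split p') (split_comm p p')
    (IsPlanar.colour_split hχ p) (IsPlanar.colour_split hχ p')
  rw [card_split_ne] at this
  rw [Nat.even_iff]
  split_ifs at this ⊢ <;> omega

/-- Every component of a state contains an even number of boundary points. -/
lemma exists_joined_ne {B : Type} [Finite B] (D : Diagram B) (s : D.Crossing → Bool) (b : B) :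
    ∃ b', b' ≠ b ∧ D.Joined s b b' := by
  classical
  have : Fintype D.Half := Fintype.ofFinite _
  by_contra! hb
  let P : Finset D.Half := {x | EqvGen (D.Adj s) (.boundary b) x}
  have hsplit : ∀ a (k : Fin 4), Link.split a (Link.split a k) = k := by decide
  have hsplit' : ∀ a (k : Fin 4), Link.split a k ≠ k := by decide
  have hP : ∀ x, x ∈ P ↔ EqvGen (D.Adj s) (.boundary b) x := fun x => by simp [P]
  have hthrough : ∀ x, D.through s (D.through s x) = x := by
    rintro (⟨c, k⟩ | ⟨j, e⟩ | b) <;> simp [Diagram.through, hsplit]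
  have h₁ : ∑ x ∈ P, (1 : ZMod 2) = 0 :=
    Finset.sum_involution (fun x _ => D.mate x) (fun _ _ => by decide)
      (fun x _ _ => D.mate_ne x)
      (fun x hx => (hP _).2 (.trans _ _ _ ((hP x).1 hx) (.rel _ _ (.inl rfl))))
      (fun x _ => D.mate_mate x)
  -- `through` has only boundary points as fixed points. If `b` were the only one in its component,
  -- then `mate` would give the component an even and `through` an odd number of half-edges.
  have h₂ : ∑ x ∈ P.erase (.boundary b), (1 : ZMod 2) = 0 := by
    refine Finset.sum_involution (fun x _ => D.through s x) (fun _ _ => by decide) ?_ ?_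
      (fun x _ => hthrough x)
    · rintro (⟨c, k⟩ | ⟨j, e⟩ | b') hx -
      · simp [Diagram.through, hsplit']
      · simp [Diagram.through]
      · rw [Finset.mem_erase, hP] at hx
        exact (hb b' (fun h => hx.1 (by rw [h])) hx.2).elim
    · intro x hx
      rw [Finset.mem_erase, hP] at hx ⊢
      refine ⟨fun h => hx.1 ?_, .trans _ _ _ hx.2 (.rel _ _ (.inr rfl))⟩
      rw [← hthrough x, h]
      rfl
  have hbP : HalfEdge.boundary b ∈ P := (hP _).2 (.refl _)
  rw [← Finset.add_sum_erase _ _ hbP, h₂] at h₁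
  exact absurd h₁ (by decide)

/-- The states without closed circles of a planar ball tangle diagram look like the fundamental
tangles. -/
lemma IsPlanar.joined_eq {X : Ball} (hX : X.IsPlanar) {s : X.Crossing → Bool} (hs : X.Spans s) :
    X.Joined s = Arcs true ∨ X.Joined s = Arcs false := by
  -- This is the planarity input: by parity, one and the same state cannot yield a single circle
  -- under both closures.
  have hnot : ¬((Connects fun b b' => X.Joined s b b' ∨ SplitRel true b b') ∧
      Connects fun b b' => X.Joined s b b' ∨ SplitRel false b b') := by
    rintro ⟨h, h'⟩
    have := hX.even ((X.connects_closed_iff s _).2 ⟨hs, h⟩) ((X.connects_closed_iff s _).2 ⟨hs, h'⟩)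
    simp at this
  have hsymm : ∀ {b b'}, X.Joined s b b' → X.Joined s b' b := fun h => .symm _ _ h
  have htrans : ∀ {b b' b''}, X.Joined s b b' → X.Joined s b' b'' → X.Joined s b b'' :=
    fun h h' => .trans _ _ _ h h'
  have hrefl : ∀ b, X.Joined s b b := fun b => .refl _
  -- Opposite corners in one component would make both closures connected, since each splitting
  -- takes the two corners to the remaining two.
  have hconn : ∀ c, X.Joined s c (c + 2) → ∀ p,
      Connects fun b b' => X.Joined s b b' ∨ SplitRel p b b' := by
    intro c hc p
    have h₁ : ∀ b, EqvGen (fun b b' => X.Joined s b b' ∨ SplitRel p b b') c b := by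
      intro b
      have key : ∀ p (c b : Corner), b = c ∨ b = c + 2 ∨ b = Link.split p c ∨
        b = Link.split p (c + 2) := by decide
      rcases key p c b with rfl | rfl | rfl | rfl
      · exact .refl _
      · exact .rel _ _ (.inl hc)
      · exact .rel _ _ (.inr rfl)
      · exact .trans _ _ _ (.rel _ _ (.inl hc)) (.rel _ _ (.inr rfl))
    exact fun x y => .trans _ _ _ (.symm _ _ (h₁ x)) (h₁ y)
  have hdiag : ∀ c, ¬X.Joined s c (c + 2) := fun c hc => hnot ⟨hconn c hc true, hconn c hc false⟩
  have hside : ∀ c, X.Joined s c (c + 1) ∨ X.Joined s c (c + 3) := by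
    intro c
    obtain ⟨b, hb, hcb⟩ := exists_joined_ne X s c
    have key : ∀ b c : Corner, b = c ∨ b = c + 1 ∨ b = c + 2 ∨ b = c + 3 := by decide
    rcases key b c with rfl | rfl | rfl | rfl
    · exact (hb rfl).elim
    · exact .inl hcb
    · exact (hdiag _ hcb).elim
    · exact .inr hcb
  have n02 : ¬X.Joined s 0 2 := hdiag 0
  have n13 : ¬X.Joined s 1 3 := hdiag 1
  have n20 : ¬X.Joined s 2 0 := hdiag 2
  have n31 : ¬X.Joined s 3 1 := hdiag 3
  have s2 : X.Joined s 2 3 ∨ X.Joined s 2 1 := hside 2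
  rcases (hside 0 : X.Joined s 0 1 ∨ X.Joined s 0 3) with h | h
  · right
    have n03 : ¬X.Joined s 0 3 := fun h' => n13 (htrans (hsymm h) h')
    have n12 : ¬X.Joined s 1 2 := fun h' => n02 (htrans h h')
    have h' : X.Joined s 2 3 := s2.resolve_right fun h => n12 (hsymm h)
    have := hsymm h
    have := hsymm h'
    have n30 : ¬X.Joined s 3 0 := fun h => n03 (hsymm h)
    have n21 : ¬X.Joined s 2 1 := fun h => n12 (hsymm h)
    ext b b'
    fin_cases b <;> fin_cases b' <;> simp_all [Arcs, Link.split]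
  · left
    have n01 : ¬X.Joined s 0 1 := fun h' => n13 (htrans (hsymm h') h)
    have n23 : ¬X.Joined s 2 3 := fun h' => n02 (htrans h (hsymm h'))
    have h' : X.Joined s 2 1 := s2.resolve_left n23
    have := hsymm h
    have := hsymm h'
    have n10 : ¬X.Joined s 1 0 := fun h => n01 (hsymm h)
    have n32 : ¬X.Joined s 3 2 := fun h => n23 (hsymm h)
    ext b b'
    fin_cases b <;> fin_cases b' <;> simp_all [Arcs, Link.split]

/-- Planar ball tangle diagrams. -/
lemma IsPlanar.isIntegral {X : Ball} (hX : X.IsPlanar) : X.IsIntegral := by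
  classical
  have : Fintype X.Crossing := Fintype.ofFinite _
  let x : Bool → ℂ := fun t => X.eval fun ρ => Diagram.indic (ρ = Arcs t)
  have hx : X.Resolves x := by
    intro Φ
    simp only [x, Diagram.eval, finsum_eq_sum_of_fintype, Finset.sum_mul, ← Finset.sum_add_distrib]
    refine Finset.sum_congr rfl fun s _ => ?_
    by_cases hs : X.Spans s
    · have hne : Arcs true ≠ Arcs false := fun h => by
        have := congrFun (congrFun h 0) 1
        revert this
        decide
      rw [Diagram.indic_of hs]
      rcases hX.joined_eq hs with h | h <;> rw [h]
      · rw [Diagram.indic_of rfl, Diagram.indic_not hne]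
        ring
      · rw [Diagram.indic_of rfl, Diagram.indic_not hne.symm]
        ring
    · simp [Diagram.indic_not hs]
  -- The numerator closure gets the extra factor `I`. By `Resolves.closedSum` it computes `x false`,
  -- and the denominator closure computes `x true`.
  obtain ⟨ζ, hζ, h⟩ := Diagram.exists_integral X SplitRel (fun p => if p then 1 else 0)
    fun p p' s s' h h' => by
      have := hX.even h h'
      rw [Nat.even_iff] at this ⊢
      cases p <;> cases p' <;> simp at this ⊢ <;> omega
  obtain ⟨m, hm⟩ := h false
  obtain ⟨n, hn⟩ := h true
  refine ⟨x, ζ, m, n, hx, hζ, ?_, ?_⟩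
  · rw [hx.closedSum true]
    simpa using hm
  · rw [hx.closedSum false]
    simpa using hn

end Ball

/-! ### Integrality for planar spherical tangles. -/

namespace Spherical

lemma IsPlanar.exists_isNormalized {S : Spherical} (hS : S.IsPlanar) : ∃ z M, S.IsNormalized z M := by
  obtain ⟨χ, hχ⟩ := Diagram.PlanarWith.exists_colouring hS (by decide) (by decide)
  have hflip : ∀ p q b, χ (.boundary (Sum.map (Link.split p) (Link.split q) b))
      = !χ (.boundary b) := by
    rintro p q (c | c)
    · rcases split_eq_or p c with hc | hc
      · rw [Sum.map_inl, hc]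
        exact hχ.rot (.boundary (.inl c))
      · have := hχ.rot (.boundary (.inl (Link.split p c)))
        rw [Diagram.rot, Sum.map_inl, ← hc] at this
        rw [this, Bool.not_not, Sum.map_inl]
    · rcases split_eq_or' q c with hc | hc
      · rw [Sum.map_inr, hc]
        exact hχ.rot (.boundary (.inr c))
      · have := hχ.rot (.boundary (.inr (Link.split q c)))
        rw [Diagram.rot, Sum.map_inr, ← hc] at this
        rw [this, Bool.not_not, Sum.map_inr]
  have hcard : ∀ p q p' q', Nat.card {b : Corner ⊕ Corner //
      Sum.map (Link.split p) (Link.split q) b ≠ Sum.map (Link.split p') (Link.split q') b}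
      = (if p = p' then 0 else 4) + if q = q' then 0 else 4 := by
    intro p q p' q'
    rw [Nat.card_eq_fintype_card]
    revert p q p' q'
    decide
  have hrel : ∀ p q (b b' : Corner ⊕ Corner), Sum.LiftRel (SplitRel p) (SplitRel q) b b' →
      b' = Sum.map (Link.split p) (Link.split q) b := by
    rintro p q _ _ (⟨h⟩ | ⟨h⟩)
    · rw [h]; rfl
    · rw [h]; rfl
  obtain ⟨ζ, hζ, h⟩ := Diagram.exists_integral S
    (fun k : Bool × Bool => Sum.LiftRel (SplitRel k.1) (SplitRel k.2))
    -- The exponent counts the holes closed horizontally; for two pairs of closures the sum has the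
    -- parity of the number of holes closed differently.
    (fun k => (if k.1 then 1 else 0) + if k.2 then 1 else 0) (by
      rintro ⟨p, q⟩ ⟨p', q'⟩ s s' h h'
      have := hχ.eight_dvd h h' (hrel p q) (hrel p' q')
        (by rintro (c | c) <;> simp [split_split]) (by rintro (c | c) <;> simp [split_split])
        (by rintro (c | c) <;> simp [split_comm p p', split_comm q q']) (hflip p q) (hflip p' q')
      rw [hcard] at this
      rw [Nat.even_iff]
      cases p <;> cases p' <;> cases q <;> cases q' <;> simp at this ⊢ <;> omega)
  obtain ⟨a, ha⟩ := h (true, false)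
  obtain ⟨b, hb⟩ := h (true, true)
  obtain ⟨c, hc⟩ := h (false, false)
  obtain ⟨d, hd⟩ := h (false, true)
  have hI := Complex.I_mul_I
  -- Together with the factors `±I` of the bracket matrix, the exponents `1, 2, 0, 1` give every
  -- entry the same unit `ζ * I`, which is cancelled here.
  refine ⟨ζ ^ 7 * -Complex.I, !![a, b; c, d], isNormalized_iff.2 ⟨?_, ?_, ?_, ?_, ?_⟩⟩
  · rw [mul_pow, ← pow_mul, mul_comm 7 8, pow_mul, hζ, neg_pow, Complex.I_pow_eq_pow_mod]
    norm_num
  all_goals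
    unfold pairing
    simp only [ha, hb, hc, hd]
    simp only [Matrix.of_apply, Matrix.cons_val', Matrix.cons_val_zero, Matrix.cons_val_one,
      Matrix.cons_val_fin_one]
    simp
    ring_nf
    simp [hζ]

end Spherical

end TangleDiagram

namespace TangleDiagram

open Relation

namespace Diagram

variable {B B₁ B₂ K W : Type}

/-! ### Isotopies of the projection surface -/

section Relabelling

variable {D D' : Diagram B} {f : D.Half → D'.Half}

lemma through_eq_rot {s : D.Crossing → Bool} {x : D.Half} (hx : D.rot id (D.rot id x) = x) :
    D.through s x = D.rot id x := by
  rcases x with ⟨c, k⟩ | ⟨j, e⟩ | b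
  · have : ∀ k : Fin 4, k + 1 + 1 ≠ k := by decide
    exact (this k (HalfEdge.crossing.inj hx).2).elim
  · rfl
  · rfl

/-- Maps of half-edges that preserve the vertices induce a correspondence of the crossings. -/
lemma exists_crossing_equiv (hf : Function.Injective f)
    (hrot : ∀ x, f (D.rot id x) = D'.rot id (f x)) (hover : ∀ x, D'.IsOver (f x) ↔ D.IsOver x)
    (hsurj : ∀ c k, ∃ x, f x = .crossing c k) :
    ∃ σ : D.Crossing ≃ D'.Crossing,
      ∀ s x, f (D.through (s ∘ σ) x) = D'.through s (f x) := by
  have h2 : ∀ k : Fin 4, k + 1 + 1 ≠ k := by decide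
  -- Only crossings have vertices of order greater than two under `rot id`, so they go to crossings.
  -- The numbering may be shifted by `0` or `2`, because the overstrand is preserved.
  have hcr : ∀ c, ∃ c' k₀, (k₀ = 0 ∨ k₀ = 2) ∧ ∀ k, f (.crossing c k) = .crossing c' (k₀ + k) := by
    intro c
    rcases hx : f (.crossing c 0) with ⟨c', k₀⟩ | ⟨j, e⟩ | b
    · refine ⟨c', k₀, ?_, ?_⟩
      · have := (hover (.crossing c 0)).2 (.inl rfl)
        rw [hx] at this
        exact this
      · have step : ∀ k l, f (.crossing c k) = .crossing c' l →
            f (.crossing c (k + 1)) = .crossing c' (l + 1) := fun k l h => by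
          have := hrot (.crossing c k)
          rw [h] at this
          exact this
        intro k
        have key : ∀ k : Fin 4, k = 0 ∨ k = 0 + 1 ∨ k = 0 + 1 + 1 ∨ k = 0 + 1 + 1 + 1 := by decide
        have key' : ∀ k₀ : Fin 4, k₀ + 1 + 1 = k₀ + (0 + 1 + 1) ∧
          k₀ + 1 + 1 + 1 = k₀ + (0 + 1 + 1 + 1) := by decide
        rcases key k with rfl | rfl | rfl | rfl
        · rw [hx, add_zero]
        · rw [step _ _ hx, zero_add]
        · rw [step _ _ (step _ _ hx), (key' _).1]
        · rw [step _ _ (step _ _ (step _ _ hx)), (key' _).2]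
    all_goals
      have h : f (D.rot id (D.rot id (.crossing c 0))) = D'.rot id (D'.rot id (f (.crossing c 0))) := by
        rw [hrot, hrot]
      rw [hx] at h
      simp only [Diagram.rot, Bool.not_not, id] at h
      rw [← hx] at h
      exact (h2 0 (HalfEdge.crossing.inj (hf h)).2).elim
  choose g k₀ hk₀ hg using hcr
  have hinv : ∀ x : D.Half, (∃ c k, x = .crossing c k) ∨ D.rot id (D.rot id x) = x := by
    rintro (⟨c, k⟩ | ⟨j, e⟩ | b)
    · exact .inl ⟨c, k, rfl⟩
    · exact .inr (by simp [Diagram.rot])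
    · exact .inr rfl
  have hbij : Function.Bijective g := by
    constructor
    · intro c d h
      have h₁ := hg c (k₀ d - k₀ c)
      rw [add_sub_cancel, h] at h₁
      have h₂ := hg d 0
      rw [add_zero, ← h₁] at h₂
      exact (HalfEdge.crossing.inj (hf h₂)).1.symm
    · intro c'
      obtain ⟨x, hx⟩ := hsurj c' 0
      rcases hinv x with ⟨c, k, rfl⟩ | h
      · rw [hg] at hx
        exact ⟨c, (HalfEdge.crossing.inj hx).1⟩
      · have := congrArg f h
        rw [hrot, hrot, hx] at this
        exact (h2 0 (HalfEdge.crossing.inj this).2).elim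
  refine ⟨Equiv.ofBijective g hbij, fun s x => ?_⟩
  rcases hinv x with ⟨c, k, rfl⟩ | h
  -- A half turn of a crossing does not affect its splittings.
  · have key : ∀ (a : Bool) (k₀ k : Fin 4), k₀ = 0 ∨ k₀ = 2 →
        k₀ + Link.split a k = Link.split a (k₀ + k) := by decide
    rw [hg]
    show f (.crossing c (Link.split (s (g c)) k)) = .crossing (g c) (Link.split (s (g c)) (k₀ c + k))
    rw [hg, key _ _ _ (hk₀ c)]
  · rw [through_eq_rot h, hrot, through_eq_rot]
    rw [← hrot, ← hrot, h]

end Relabelling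

lemma Iso.closedSum_eq {D D' : Diagram B} (h : D.Iso D') (r : B → B → Prop) :
    D.closedSum r = D'.closedSum r := by
  obtain ⟨f, hmate, hrot, hover, hb⟩ := h
  obtain ⟨σ, hσ⟩ := exists_crossing_equiv f.injective hrot hover fun c k => f.surjective _
  refine closedSum_eq_of_equiv σ fun s => connects_congr_equiv f fun x y => ?_
  have h₁ : D.Adj (s ∘ σ) x y ↔ D'.Adj s (f x) (f y) := by
    unfold Adj
    rw [← hmate, ← hσ, f.apply_eq_iff_eq, f.apply_eq_iff_eq]
  refine or_congr h₁ (exists_congr fun b => exists_congr fun b' => ?_)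
  rw [← hb, ← hb, f.apply_eq_iff_eq, f.apply_eq_iff_eq]

lemma Subdivides.closedSum_eq {D D' : Diagram B} (h : D.Subdivides D') (r : B → B → Prop) :
    D.closedSum r = D'.closedSum r := by
  obtain ⟨f, x, hx₁, hx₂, hmate, hrot, hrot', hover, hb⟩ := h
  have hrr : ∀ e, D'.rot id (D'.rot id (f (.inr e))) = f (.inr e) := fun e => by
    rw [← hrot', ← hrot', Bool.not_not]
  obtain ⟨σ, hσ⟩ := exists_crossing_equiv (f := fun y => f (.inl y))
    (fun a b h => Sum.inl.inj (f.injective h)) hrot hover fun c k => by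
      obtain ⟨y | e, hy⟩ := f.surjective (.crossing c k)
      · exact ⟨y, hy⟩
      · have := hrr e
        rw [hy] at this
        have h2 : ∀ k : Fin 4, k + 1 + 1 ≠ k := by decide
        exact (h2 k (HalfEdge.crossing.inj this).2).elim
  have hx₁' : D'.mate (f (.inr false)) = f (.inl x) := by rw [← hx₁, D'.mate_mate]
  have hx₂' : D'.mate (f (.inr true)) = f (.inl (D.mate x)) := by rw [← hx₂, D'.mate_mate]
  have hthrough : ∀ s e, D'.through s (f (.inr e)) = f (.inr (!e)) := fun s e => by
    rw [through_eq_rot (hrr e), hrot']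
  refine closedSum_eq_of_equiv σ fun s => ?_
  -- The two half-edges of the new joint are contracted to the ends of the old edge at which they
  -- face.
  let G : D.Half ⊕ Bool → D.Half := Sum.elim id fun e => if e then D.mate x else x
  have hm' : ∀ z, EqvGen (D'.Closed s r) z (D'.mate z) := fun z => .rel _ _ (.inl (.inl rfl))
  have ht' : ∀ z, EqvGen (D'.Closed s r) z (D'.through s z) := fun z => .rel _ _ (.inl (.inr rfl))
  have hpath : EqvGen (D'.Closed s r) (f (.inl x)) (f (.inl (D.mate x))) := by
    have h₁ := hm' (f (.inl x))
    have h₂ := ht' (f (.inr false))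
    have h₃ := hm' (f (.inr true))
    rw [hx₁] at h₁
    rw [hthrough] at h₂
    rw [hx₂'] at h₃
    exact .trans _ _ _ h₁ (.trans _ _ _ h₂ h₃)
  refine connects_congr_of_maps (fun y => f (.inl y)) (fun z => G (f.symm z)) ?_ ?_ ?_ ?_
  · rintro y z ((rfl | rfl) | ⟨b, b', rfl, rfl, h⟩)
    · by_cases h₁ : y = x
      · subst h₁
        exact hpath
      · by_cases h₂ : y = D.mate x
        · subst h₂
          rw [D.mate_mate]
          exact .symm _ _ hpath
        · have := hm' (f (.inl y))
          rwa [hmate y h₁ h₂] at this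
    · have := ht' (f (.inl y))
      rwa [← hσ s y] at this
    · simp only [hb]
      exact .rel _ _ (.inr ⟨b, b', rfl, rfl, h⟩)
  · have hm : ∀ y, EqvGen (D.Closed (s ∘ σ) r) y (D.mate y) := fun y => .rel _ _ (.inl (.inl rfl))
    rintro z z' ((rfl | rfl) | ⟨b, b', rfl, rfl, h⟩)
    · obtain ⟨y | e, rfl⟩ := f.surjective z
      · by_cases h₁ : y = x
        · subst h₁
          simp only [hx₁, Equiv.symm_apply_apply]
          exact .refl _
        · by_cases h₂ : y = D.mate x
          · subst h₂
            simp only [hx₂, Equiv.symm_apply_apply]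
            exact .refl _
          · simp only [hmate y h₁ h₂, Equiv.symm_apply_apply]
            exact hm y
      · cases e
        · simp only [hx₁', Equiv.symm_apply_apply]
          exact .refl _
        · simp only [hx₂', Equiv.symm_apply_apply]
          exact .refl _
    · obtain ⟨y | e, rfl⟩ := f.surjective z
      · simp only [← hσ s y, Equiv.symm_apply_apply]
        exact .rel _ _ (.inl (.inr rfl))
      · simp only [hthrough, Equiv.symm_apply_apply]
        cases e
        · exact hm x
        · exact .symm _ _ (hm x)
    · simp only [← hb, Equiv.symm_apply_apply]
      exact .rel _ _ (.inr ⟨b, b', rfl, rfl, h⟩)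
  · intro y
    simp only [Equiv.symm_apply_apply]
    exact .refl _
  · intro z
    obtain ⟨y | e, rfl⟩ := f.surjective z
    · simp only [Equiv.symm_apply_apply]
      exact .refl _
    · simp only [Equiv.symm_apply_apply]
      cases e
      · have := hm' (f (.inr false))
        rwa [hx₁'] at this
      · have := hm' (f (.inr true))
        rwa [hx₂'] at this

/-! ### Replacing a part of a diagram -/

lemma eval_mul_left (D : Diagram B) (ζ : ℂ) (Φ : (B → B → Prop) → ℂ) :
    (D.eval fun ρ => ζ * Φ ρ) = ζ * D.eval Φ := by
  unfold eval
  rw [← smul_eq_mul, smul_finsum]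
  refine finsum_congr fun s => ?_
  rw [smul_eq_mul]
  ring

/-- A local move needs to be checked only on the replaced piece, for all functionals `Φ` at once. -/
lemma closedSum_patch_of_eval [Finite K] [Nonempty B] (E : Diagram (B ⊕ K)) {Y Y' : Diagram K} {ζ : ℂ}
    (h : ∀ Φ, Y'.eval Φ = ζ * Y.eval Φ) (r : B → B → Prop) :
    (E.patch Y').closedSum r = ζ * (E.patch Y).closedSum r := by
  unfold patch
  rw [closedSum_connect, closedSum_connect, closedSum_eq_eval, closedSum_eq_eval, eval_union,
    eval_union, ← eval_mul_left]
  simp only [h]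

/-- Connecting boundary points of the second part of a disjoint union. -/
lemma closedSum_union_connect [Finite K] (E : Diagram B₁) (Y : Diagram W) (e : W ≃ B ⊕ K × Bool)
    (r : B₁ ⊕ B → B₁ ⊕ B → Prop) :
    (E.union (Y.connect e)).closedSum r = (E.union Y).closedSum
      (connectRel ((Equiv.sumCongr (Equiv.refl B₁) e).trans (Equiv.sumAssoc _ _ _).symm) r) := by
  refine (closedSum_eq_of_equiv (D := E.union Y) (D' := E.union (Y.connect e)) (Equiv.refl _)
    fun s => ?_).symm
  obtain ⟨⟨s, t⟩, rfl⟩ := (unionState E Y).surjective s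
  show Connects ((E.union Y).Closed (unionState E Y (s, t)) _) ↔
    Connects ((E.union (Y.connect e)).Closed (unionState E (Y.connect e) (s, t)) r)
  let F : (E.union Y).Half ≃ (E.union (Y.connect e)).Half :=
    ((unionHalf E Y).symm.trans (Equiv.sumCongr (Equiv.refl _) (Y.connectHalf e))).trans
      (unionHalf E (Y.connect e))
  have hF₁ : ∀ x, F (unionHalf E Y (.inl x)) = unionHalf E (Y.connect e) (.inl x) := fun x => by
    simp [F]
  have hF₂ : ∀ x, F (unionHalf E Y (.inr x)) = unionHalf E (Y.connect e) (.inr (Y.connectHalf e x)) :=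
    fun x => by simp [F]
  have hF₁' : ∀ x, F.symm (unionHalf E (Y.connect e) (.inl x)) = unionHalf E Y (.inl x) := fun x => by
    rw [Equiv.symm_apply_eq, hF₁]
  have hF₂' : ∀ x, F.symm (unionHalf E (Y.connect e) (.inr (Y.connectHalf e x)))
      = unionHalf E Y (.inr x) := fun x => by
    rw [Equiv.symm_apply_eq, hF₂]
  have hadj : ∀ {x y}, E.Adj s x y → EqvGen ((E.union (Y.connect e)).Closed
      (unionState E (Y.connect e) (s, t)) r) (unionHalf E (Y.connect e) (.inl x))
      (unionHalf E (Y.connect e) (.inl y)) := fun h =>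
    .rel _ _ (.inl ((union_adj_iff E (Y.connect e) s t _ _).2 (.inl h)))
  have hadj' : ∀ {x y}, (Y.connect e).Adj t x y → EqvGen ((E.union (Y.connect e)).Closed
      (unionState E (Y.connect e) (s, t)) r) (unionHalf E (Y.connect e) (.inr x))
      (unionHalf E (Y.connect e) (.inr y)) := fun h =>
    .rel _ _ (.inl ((union_adj_iff E (Y.connect e) s t _ _).2 (.inr h)))
  refine connects_congr_of_maps F F.symm ?_ ?_ ?_ ?_
  · rintro x y (h | ⟨w, w', rfl, rfl, h⟩)
    · obtain ⟨x, rfl⟩ := (unionHalf E Y).surjective x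
      obtain ⟨y, rfl⟩ := (unionHalf E Y).surjective y
      rw [union_adj_iff] at h
      rcases h with ⟨h⟩ | ⟨rfl | rfl⟩
      · rw [hF₁, hF₁]
        exact hadj h
      · rw [hF₂, hF₂, ← connect_mate]
        exact hadj' (.inl rfl)
      · rename_i x
        rw [hF₂, hF₂]
        rcases x with ⟨c, k⟩ | ⟨j, u⟩ | w
        · exact hadj' (.inr rfl)
        · exact hadj' (.inr rfl)
        · exact .refl _
    · have hb : ∀ b : B₁, F (.boundary (.inl b)) = .boundary (.inl b) := fun b => hF₁ (.boundary b)
      have hw : ∀ (w : W) b, e w = .inl b → F (.boundary (.inr w)) = .boundary (.inr b) :=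
        fun w b h => (hF₂ (.boundary w)).trans (by rw [connectHalf_boundary_inl Y h]; rfl)
      have hw' : ∀ (w : W) p, e w = .inr p → F (.boundary (.inr w))
          = unionHalf E (Y.connect e) (.inr (.joint (.inr p.1) p.2)) :=
        fun w b h => (hF₂ (.boundary w)).trans (by rw [connectHalf_boundary_inr Y h])
      rcases w with b | w <;> rcases w' with b' | w'
      · rw [hb, hb]
        exact .rel _ _ (.inr ⟨_, _, rfl, rfl, by simpa [connectRel] using h⟩)
      · rcases hw₁ : e w' with b' | p
        · rw [hb, hw _ _ hw₁]
          exact .rel _ _ (.inr ⟨_, _, rfl, rfl, by simpa [connectRel, hw₁] using h⟩)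
        · simp [connectRel, hw₁] at h
      · rcases hw₁ : e w with b | p
        · rw [hb, hw _ _ hw₁]
          exact .rel _ _ (.inr ⟨_, _, rfl, rfl, by simpa [connectRel, hw₁] using h⟩)
        · simp [connectRel, hw₁] at h
      · rcases hw₁ : e w with b | p <;> rcases hw₂ : e w' with b' | p'
        · rw [hw _ _ hw₁, hw _ _ hw₂]
          exact .rel _ _ (.inr ⟨_, _, rfl, rfl, by simpa [connectRel, hw₁, hw₂] using h⟩)
        · simp [connectRel, hw₁, hw₂] at h
        · simp [connectRel, hw₁, hw₂] at h
        · have h' : p' = (p.1, !p.2) := by simpa [connectRel, hw₁, hw₂] using h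
          rw [hw' _ _ hw₁, hw' _ _ hw₂, h']
          exact hadj' (.inr rfl)
  · rintro x y (h | ⟨w, w', rfl, rfl, h⟩)
    · obtain ⟨x, rfl⟩ := (unionHalf E (Y.connect e)).surjective x
      obtain ⟨y, rfl⟩ := (unionHalf E (Y.connect e)).surjective y
      replace h := (union_adj_iff E (Y.connect e) s t x y).1 h
      rcases h with ⟨h⟩ | ⟨rfl | rfl⟩
      · rw [hF₁', hF₁']
        exact .rel _ _ (.inl ((union_adj_iff E Y s t _ _).2 (.inl h)))
      · rename_i x
        obtain ⟨x, rfl⟩ := (Y.connectHalf e).surjective x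
        rw [connect_mate, hF₂', hF₂']
        exact .rel _ _ (.inl ((union_adj_iff E Y s t _ _).2 (.inr (.inl rfl))))
      · rename_i x
        obtain ⟨x, rfl⟩ := (Y.connectHalf e).surjective x
        rcases x with ⟨c, k⟩ | ⟨j, u⟩ | w
        · exact .rel _ _ (.inl ((union_adj_iff E Y s t (.inr (.crossing c k)) (.inr _)).2
            (.inr (.inr rfl))))
        · exact .rel _ _ (.inl ((union_adj_iff E Y s t (.inr (.joint j u)) (.inr _)).2
            (.inr (.inr rfl))))
        · rcases hw : e w with b | p
          · rw [connectHalf_boundary_inl Y hw]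
            exact .refl _
          · have h₁ : (Y.connect e).through t (Y.connectHalf e (.boundary w))
                = Y.connectHalf e (.boundary (e.symm (.inr (p.1, !p.2)))) := by
              rw [connectHalf_boundary_inr Y hw,
                connectHalf_boundary_inr Y (p := (p.1, !p.2)) (by simp)]
              rfl
            rw [h₁, hF₂', hF₂']
            refine .rel _ _ (.inr ⟨.inr w, .inr _, rfl, rfl, ?_⟩)
            simp [connectRel, hw]
    · have hb : ∀ b : B₁, F.symm (.boundary (.inl b)) = .boundary (.inl b) :=
        fun b => hF₁' (.boundary b)
      have hw : ∀ b : B, F.symm (.boundary (.inr b)) = .boundary (.inr (e.symm (.inl b))) := fun b => by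
        have := hF₂' (.boundary (e.symm (.inl b)))
        rw [connectHalf_boundary_inl Y (b := b) (by simp)] at this
        exact this
      rcases w with b | w <;> rcases w' with b' | w' <;> simp only [hb, hw] <;>
        exact .rel _ _ (.inr ⟨_, _, rfl, rfl, by simpa [connectRel] using h⟩)
  · intro x
    rw [Equiv.symm_apply_apply]
    exact .refl _
  · intro x
    rw [Equiv.apply_symm_apply]
    exact .refl _

/-- Boundary identification which closes the first hole of a diagram. -/
def closeHole {C : Type} (e : C ≃ Empty ⊕ Bool × Bool) : C ⊕ K ≃ K ⊕ Bool × Bool :=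
  ((Equiv.sumCongr (e.trans (Equiv.emptySum _ _)) (Equiv.refl K)).trans (Equiv.sumComm _ _))

end Diagram

/-! ### Closing the inside hole before a move of type IV. -/

namespace Spherical

/-- The pairs of corners of a hole which are joined by the numerator or denominator closure. -/
def closure : Bool → (Corner ≃ Empty ⊕ Bool × Bool)
  | true => Ball.numeratorEquiv
  | false => Ball.denominatorEquiv

/-- The hole lies inside the piece changed by a type IV move. Once it has been closed, that piece is
an ordinary tangle with six ends, and the move becomes a local replacement. -/
lemma pairing_glue (E Y : Diagram (Corner ⊕ Fin 6)) (p q : Bool) :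
    pairing (E.glue Y) p q
      = (E.patch (Y.connect (Diagram.closeHole (closure q)))).closedSum (SplitRel p) := by
  unfold pairing Diagram.glue Diagram.patch
  rw [Diagram.closedSum_connect, Diagram.closedSum_connect, Diagram.closedSum_union_connect]
  refine Diagram.closedSum_congr _ ?_
  rintro ((b | k) | (b | k)) ((b' | k') | (b' | k')) <;>
    simp [Diagram.connectRel, Diagram.glueEquiv, Diagram.patchEquiv, Diagram.closeHole]
  revert b b' q
  decide

end Spherical

end TangleDiagram

namespace TangleDiagram

open Relation

/-! ### Computation of local state sums -/

section Label

variable {C J K : Type}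

instance decidableForallHalfEdge [Fintype C] [Fintype J] [Fintype K] (p : HalfEdge C J K → Prop)
    [DecidablePred p] : Decidable (∀ x, p x) :=
  decidable_of_iff ((∀ c k, p (.crossing c k)) ∧ (∀ j e, p (.joint j e)) ∧ ∀ b, p (.boundary b))
    ⟨fun h => by
      rintro (⟨c, k⟩ | ⟨j, e⟩ | b)
      · exact h.1 c k
      · exact h.2.1 j e
      · exact h.2.2 b,
    fun h => ⟨fun _ _ => h _, fun _ _ => h _, fun _ => h _⟩⟩

/-- The end of the path which leaves a half-edge along its edge, if it is found in `n` steps. -/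
def pathEnd (m : HalfEdge C J K → HalfEdge C J K) (s : C → Bool) : ℕ → HalfEdge C J K → Option K
  | 0, _ => none
  | n + 1, x =>
    match m x with
    | .crossing c k => pathEnd m s n (.crossing c (Link.split (s c) k))
    | .joint j e => pathEnd m s n (.joint j (!e))
    | .boundary b => some b

/-- The smaller one of the two ends of the path through a half-edge. -/
def label [Min K] (m : HalfEdge C J K → HalfEdge C J K) (s : C → Bool) (n : ℕ)
    (x : HalfEdge C J K) : Option K :=
  match pathEnd m s n x, (match x with
    | .crossing c k => pathEnd m s n (.crossing c (Link.split (s c) k))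
    | .joint j e => pathEnd m s n (.joint j (!e))
    | .boundary b => some b) with
  | some b, some b' => some (min b b')
  | _, _ => none

/-- The labels are constant on the components of the state. -/
def IsLabelling [Min K] (m : HalfEdge C J K → HalfEdge C J K) (s : C → Bool) (n : ℕ) : Prop :=
  (∀ x, label m s n (m x) = label m s n x) ∧
    (∀ c k, label m s n (.crossing c (Link.split (s c) k)) = label m s n (.crossing c k)) ∧
    (∀ j, label m s n (.joint j true) = label m s n (.joint j false)) ∧
    ∀ b, label m s n (.boundary b) ≠ none

instance [Fintype C] [Fintype J] [Fintype K] [DecidableEq K] [Min K]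
    (m : HalfEdge C J K → HalfEdge C J K) (s : C → Bool) (n : ℕ) : Decidable (IsLabelling m s n) :=
  inferInstanceAs (Decidable (_ ∧ _ ∧ _ ∧ _))

/-- The labels of the boundary points, if there are no closed circles. -/
def code [Fintype C] [Fintype J] [Fintype K] [DecidableEq K] [Min K]
    (m : HalfEdge C J K → HalfEdge C J K) (n : ℕ) (s : C → Bool) : Option (K → Option K) :=
  if ∀ x, label m s n x ≠ none then some fun b => label m s n (.boundary b) else none

/-- The exponent of the weight of a state. -/
def exponent [Fintype C] (s : C → Bool) : ℕ := ∑ c, if s c then 1 else 7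

end Label

namespace Diagram

variable {K : Type}

lemma weight_eq_pow_exponent {C : Type} [Fintype C] (s : C → Bool) :
    weight s = Link.A ^ exponent s := by
  have h : exponent s = Nat.card {c // s c = true} + 7 * Nat.card {c // s c = false} := by
    simp only [Nat.card_eq_fintype_card, Fintype.card_subtype, Finset.card_filter, Finset.mul_sum,
      ← Finset.sum_add_distrib, exponent]
    refine Finset.sum_congr rfl fun c _ => ?_
    cases s c <;> rfl
  rw [weight, Link.A_inv, h, pow_add, pow_mul]

section Evaluation

variable {D : Diagram K} {s : D.Crossing → Bool}

lemma pathEnd_eqvGen (n : ℕ) (x : D.Half) {b : K} (h : pathEnd D.mate s n x = some b) :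
    EqvGen (D.Adj s) x (.boundary b) := by
  induction n generalizing x with
  | zero => simp [pathEnd] at h
  | succ n ih =>
    have hm : EqvGen (D.Adj s) x (D.mate x) := .rel _ _ (.inl rfl)
    unfold pathEnd at h
    rcases hx : D.mate x with ⟨c, k⟩ | ⟨j, e⟩ | b' <;> rw [hx] at h hm <;> simp only at h
    · exact .trans _ _ _ hm (.trans _ _ _ (.rel _ _ (.inr rfl)) (ih _ h))
    · exact .trans _ _ _ hm (.trans _ _ _ (.rel _ _ (.inr rfl)) (ih _ h))
    · rw [← Option.some.inj h]
      exact hm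

lemma label_eqvGen [LinearOrder K] (n : ℕ) (x : D.Half) {b : K} (h : label D.mate s n x = some b) :
    EqvGen (D.Adj s) x (.boundary b) := by
  have hmin : ∀ (b₁ b₂ : K), min b₁ b₂ = b₁ ∨ min b₁ b₂ = b₂ := fun b₁ b₂ => min_choice b₁ b₂
  have ht : EqvGen (D.Adj s) x (D.through s x) := .rel _ _ (.inr rfl)
  unfold label at h
  split at h
  · rename_i b₁ b₂ h₁ h₂
    rw [← Option.some.inj h]
    rcases hmin b₁ b₂ with h | h <;> rw [h]
    · exact pathEnd_eqvGen n x h₁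
    · rcases x with ⟨c, k⟩ | ⟨j, e⟩ | b'
      · exact .trans _ _ _ ht (pathEnd_eqvGen n _ h₂)
      · exact .trans _ _ _ ht (pathEnd_eqvGen n _ h₂)
      · rw [← Option.some.inj h₂]
        exact .refl _
  · simp at h

lemma label_invariant [LinearOrder K] {n : ℕ} (h : IsLabelling D.mate s n) {x y : D.Half}
    (hxy : EqvGen (D.Adj s) x y) : label D.mate s n x = label D.mate s n y := by
  refine eqvGen_invariant _ ?_ hxy
  rintro x y (rfl | rfl)
  · exact (h.1 x).symm
  · rcases x with ⟨c, k⟩ | ⟨j, e⟩ | b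
    · exact (h.2.1 c k).symm
    · cases e
      · exact (h.2.2.1 j).symm
      · exact h.2.2.1 j
    · rfl

/-- The value of a functional on the connectivity described by a code. -/
noncomputable def codeValue (Φ : (K → K → Prop) → ℂ) (l : K → Option K) : ℂ :=
  Φ fun b b' => l b = l b'

/-- `IsLabelling` acts as a certificate, so the step bound `n` need not be proved sufficient: a
label always names a boundary point of the same component, and invariance shows that an unlabelled
half-edge lies on a closed circle. -/
lemma term_eq [LinearOrder K] [Fintype K] [Fintype D.Crossing] [Fintype D.Joint] {n : ℕ}
    (h : IsLabelling D.mate s n) (Φ : (K → K → Prop) → ℂ) :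
    indic (D.Spans s) * Φ (D.Joined s) = (code D.mate n s).elim 0 (codeValue Φ) := by
  have hspan : D.Spans s ↔ ∀ x, label D.mate s n x ≠ none := by
    constructor
    · intro hs x
      obtain ⟨b, hb⟩ := hs x
      rw [label_invariant h hb]
      exact h.2.2.2 b
    · intro hx x
      obtain ⟨b, hb⟩ := Option.ne_none_iff_exists'.1 (hx x)
      exact ⟨b, label_eqvGen n x hb⟩
  unfold code
  split_ifs with hx
  · have hj : D.Joined s = fun b b' => label D.mate s n (.boundary b) = label D.mate s n (.boundary b') := by
      ext b b'
      constructor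
      · exact label_invariant h
      · intro hb
        obtain ⟨a, ha⟩ := Option.ne_none_iff_exists'.1 (hx (.boundary b))
        exact .trans _ _ _ (label_eqvGen n _ ha) (.symm _ _ (label_eqvGen n _ (hb ▸ ha)))
    rw [indic_of (hspan.2 hx), one_mul, hj]
    rfl
  · rw [indic_not (mt hspan.1 hx), zero_mul]
    rfl

end Evaluation

/-- A list of all states. -/
structure StateList (C : Type) [Fintype C] where
  list : List (C → Bool)
  sum_eq : ∀ f : (C → Bool) → ℂ, ∑ᶠ s, f s = (list.map f).sum

/-- The contributions of the states without closed circles; the exponents are shifted by `a`. -/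
def terms {C J : Type} [Fintype C] [Fintype J] [Fintype K] [DecidableEq K] [Min K]
    (L : List (C → Bool)) (m : HalfEdge C J K → HalfEdge C J K) (n a : ℕ) :
    List ((K → Option K) × ℕ) :=
  L.filterMap fun s => (code m n s).map fun l => (l, (exponent s + a) % 8)

/-- The value of a list of contributions. -/
noncomputable def termsValue (Φ : (K → K → Prop) → ℂ) (L : List ((K → Option K) × ℕ)) : ℂ :=
  (L.map fun t => Link.A ^ t.2 * codeValue Φ t.1).sum

lemma pow_A_mod (n : ℕ) : Link.A ^ (n % 8) = Link.A ^ n := by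
  conv_rhs => rw [← Nat.div_add_mod n 8, pow_add, pow_mul, Link.A_pow_eight, one_pow, one_mul]

lemma termsValue_terms {D : Diagram K} [LinearOrder K] [Fintype K] [Fintype D.Crossing]
    [Fintype D.Joint] (S : StateList D.Crossing) {n : ℕ}
    (h : ∀ s ∈ S.list, IsLabelling D.mate s n) (a : ℕ) (Φ : (K → K → Prop) → ℂ) :
    termsValue Φ (terms S.list D.mate n a) = Link.A ^ a * D.eval Φ := by
  unfold eval
  rw [S.sum_eq]
  revert h
  generalize S.list = L
  intro h
  induction L with
  | nil => simp [terms, termsValue]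
  | cons s L ih =>
    have ih := ih fun s hs => h s (List.mem_cons_of_mem _ hs)
    rw [List.map_cons, List.sum_cons, mul_add, ← ih, term_eq (h s List.mem_cons_self),
      weight_eq_pow_exponent]
    unfold terms
    rcases hc : code D.mate n s with _ | l
    · simp [hc]
    · simp only [List.filterMap_cons, hc, Option.map_some, termsValue, List.map_cons, List.sum_cons,
        pow_A_mod, Option.elim_some, pow_add]
      ring

/-- Contributions whose exponents differ by four cancel. -/
lemma termsValue_eq_zero [DecidableEq K] [Fintype K] {L : List ((K → Option K) × ℕ)}
    (h : ∀ t ∈ L, t.2 < 8 ∧ L.count (t.1, (t.2 + 4) % 8) = L.count t) (Φ : (K → K → Prop) → ℂ) :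
    termsValue Φ L = 0 := by
  -- Counting uses the product comparison when it is evaluated, but the one derived from decidable
  -- equality in the sum over distinct elements.
  have hc : ∀ t, @List.count _ instBEqProd t L = @List.count _ instBEqOfDecidableEq t L := fun t => by
    congr 1
    exact lawful_beq_subsingleton _ _
  have h₀ := h
  simp only [hc] at h
  unfold termsValue
  rw [Finset.sum_list_map_count]
  -- Contributions with the same connectivity and exponents four apart have opposite signs, as `A⁴ =
  -- -1`, and equal multiplicities.
  refine Finset.sum_involution (fun t _ => (t.1, (t.2 + 4) % 8)) ?_ ?_ ?_ ?_
  · intro t ht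
    rw [(h t (List.mem_toFinset.1 ht)).2, ← smul_add, pow_A_mod, pow_add, Link.A_pow_four]
    simp
  · intro t ht _ heq
    have h₁ := congrArg Prod.snd heq
    have h₂ := (h t (List.mem_toFinset.1 ht)).1
    simp only at h₁
    omega
  · intro t ht
    have hpos : 0 < L.count t := List.count_pos_iff.2 (List.mem_toFinset.1 ht)
    rw [← (h₀ t (List.mem_toFinset.1 ht)).2] at hpos
    exact List.mem_toFinset.2 (List.count_pos_iff.1 hpos)
  · intro t ht
    have h₂ := (h t (List.mem_toFinset.1 ht)).1
    ext1
    · rfl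
    · simp only
      omega

/-- The states of finitely many crossings. -/
def finStates : (n : ℕ) → List (Fin n → Bool)
  | 0 => [Fin.elim0]
  | n + 1 => (finStates n).flatMap fun s => [Fin.cons true s, Fin.cons false s]

lemma sum_finStates (n : ℕ) (f : (Fin n → Bool) → ℂ) : ∑ᶠ s, f s = ((finStates n).map f).sum := by
  rw [finsum_eq_sum_of_fintype]
  induction n with
  | zero =>
    rw [Fintype.sum_unique]
    simp [finStates]
    congr 1
  | succ n ih =>
    rw [← (Fin.consEquiv fun _ => Bool).sum_comp, Fintype.sum_prod_type, Fintype.sum_bool,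
      ← Finset.sum_add_distrib, ih fun s => _]
    simp only [finStates]
    generalize finStates n = L
    induction L with
    | nil => simp
    | cons s L ih =>
      simp only [List.map_cons, List.sum_cons, List.flatMap_cons, List.map_append, List.sum_append,
        ih, List.map_nil, List.sum_nil, add_zero]
      rfl

/-- The list of the states of a diagram whose crossings are numbered. -/
def StateList.ofEquiv {C : Type} [Fintype C] {n : ℕ} (e : C ≃ Fin n) : StateList C where
  list := (finStates n).map fun s => s ∘ e
  sum_eq f := by
    rw [List.map_map, ← finsum_comp_equiv (Equiv.arrowCongr e (Equiv.refl Bool)).symm]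
    exact sum_finStates n _

/-- A criterion for the equality of local state sums up to a power of `A`, which can be checked by
computation. -/
lemma eval_eq_of_terms {D D' : Diagram K} [LinearOrder K] [Fintype K] [Fintype D.Crossing]
    [Fintype D.Joint] [Fintype D'.Crossing] [Fintype D'.Joint] (S : StateList D.Crossing)
    (S' : StateList D'.Crossing) (n a : ℕ) (h : ∀ s ∈ S.list, IsLabelling D.mate s n)
    (h' : ∀ s ∈ S'.list, IsLabelling D'.mate s n)
    (hterms : ∀ t ∈ terms S'.list D'.mate n 4 ++ terms S.list D.mate n a,
      t.2 < 8 ∧ (terms S'.list D'.mate n 4 ++ terms S.list D.mate n a).count (t.1, (t.2 + 4) % 8)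
        = (terms S'.list D'.mate n 4 ++ terms S.list D.mate n a).count t)
    (Φ : (K → K → Prop) → ℂ) : D'.eval Φ = Link.A ^ a * D.eval Φ := by
  -- The shift by `4` of the first list supplies the minus sign of the difference of the two sides.
  have := termsValue_eq_zero hterms Φ
  rw [termsValue, List.map_append, List.sum_append] at this
  change termsValue Φ _ + termsValue Φ _ = 0 at this
  rw [termsValue_terms S h, termsValue_terms S' h', Link.A_pow_four] at this
  linear_combination -this

end Diagram

end TangleDiagram

/-! ### Invariance under the Reidemeister moves. -/

namespace TangleDiagram
open Diagram

section Instances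

variable (k : Fin 4)


instance : Fintype arc.Crossing := inferInstanceAs (Fintype Empty)
instance : Fintype arc.Joint := inferInstanceAs (Fintype Empty)
instance : Fintype (kink k).Crossing := inferInstanceAs (Fintype Unit)
instance : Fintype (kink k).Joint := inferInstanceAs (Fintype Empty)
instance : Fintype parallel.Crossing := inferInstanceAs (Fintype Empty)
instance : Fintype parallel.Joint := inferInstanceAs (Fintype Empty)
instance : Fintype overlap.Crossing := inferInstanceAs (Fintype Bool)
instance : Fintype overlap.Joint := inferInstanceAs (Fintype Empty)
instance : Fintype (strandBelow k).Crossing := inferInstanceAs (Fintype (Fin 3))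
instance : Fintype (strandBelow k).Joint := inferInstanceAs (Fintype Empty)
instance : Fintype (strandAbove k).Crossing := inferInstanceAs (Fintype (Fin 3))
instance : Fintype (strandAbove k).Joint := inferInstanceAs (Fintype Empty)

end Instances

/-- The only state of a diagram without crossings. -/
def emptyStates : StateList Empty := .ofEquiv (n := 0) (Equiv.equivOfIsEmpty _ _)

/-- One of the two splittings cuts off a circle and drops out; the other leaves an arc with weight
`A` or `A⁻¹ = A⁷`. These are the usual factors `-A⁻³` and `-A³`. -/
lemma eval_kink (k : Fin 4) :
    ∀ Φ, (kink k).eval Φ = Link.A ^ (if k = 0 ∨ k = 2 then 1 else 7) * arc.eval Φ := by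
  refine eval_eq_of_terms (D := arc) (D' := kink k) emptyStates
    (.ofEquiv (C := Unit) (n := 1) (Equiv.ofUnique _ _)) 10 _ ?_ ?_ ?_
  · decide +kernel
  · revert k; decide +kernel
  · revert k; decide +kernel

lemma eval_overlap : ∀ Φ, overlap.eval Φ = Link.A ^ 0 * parallel.eval Φ := by
  refine eval_eq_of_terms (D := parallel) (D' := overlap) emptyStates
    (.ofEquiv (C := Bool) finTwoEquiv.symm) 20 0 ?_ ?_ ?_
  · decide +kernel
  · decide +kernel
  · decide +kernel

lemma eval_strand (k : Fin 4) :
    ∀ Φ, (strandAbove k).eval Φ = Link.A ^ 0 * (strandBelow k).eval Φ := by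
  refine eval_eq_of_terms (D := strandBelow k) (D' := strandAbove k)
    (.ofEquiv (C := Fin 3) (Equiv.refl _)) (.ofEquiv (C := Fin 3) (Equiv.refl _)) 20 0 ?_ ?_ ?_
  · revert k; decide +kernel
  · revert k; decide +kernel
  · revert k; decide +kernel

/-- The neighbourhood of a hole which has been closed. -/
abbrev closedHole (Y : Diagram (Corner ⊕ Fin 6)) (t : Bool) : Diagram (Fin 6) :=
  Y.connect (closeHole (Spherical.closure t))

instance (q : Corner) (t : Bool) : Fintype (closedHole (holeFree q) t).Crossing :=
  inferInstanceAs (Fintype Empty)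
instance (q : Corner) (t : Bool) : Fintype (closedHole (holeFree q) t).Joint :=
  inferInstanceAs (Fintype (Empty ⊕ Bool))
instance (q : Corner) (o : Fin 4) (t : Bool) : Fintype (closedHole (holeCrossed q o) t).Crossing :=
  inferInstanceAs (Fintype (Fin 4))
instance (q : Corner) (o : Fin 4) (t : Bool) : Fintype (closedHole (holeCrossed q o) t).Joint :=
  inferInstanceAs (Fintype (Empty ⊕ Bool))

/-- After either closure the arc passes over or under two plain strands, so no factor appears. -/
lemma eval_closedHole (q : Corner) (o : Fin 4) (t : Bool) :
    ∀ Φ, (closedHole (holeCrossed q o) t).eval Φ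
      = Link.A ^ 0 * (closedHole (holeFree q) t).eval Φ := by
  refine eval_eq_of_terms (D := closedHole (holeFree q) t) (D' := closedHole (holeCrossed q o) t)
    emptyStates (.ofEquiv (C := Fin 4) (Equiv.refl _)) 30 0 ?_ ?_ ?_
  · revert q t; decide +kernel
  · revert q o t; decide +kernel
  · revert q o t; decide +kernel

/-! ### Isotopy invariance and induction on the reduction. -/

namespace Spherical

lemma Proportional.of_eval {K : Type} [Finite K] (E : Diagram ((Corner ⊕ Corner) ⊕ K)) {Y Y' : Diagram K} {a : ℕ}
    (h : ∀ Φ, Y'.eval Φ = Link.A ^ a * Y.eval Φ) : Proportional (E.patch Y) (E.patch Y') := by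
  refine ⟨Link.A ^ a, by rw [← pow_mul, mul_comm, pow_mul, Link.A_pow_eight, one_pow], fun p q => ?_⟩
  exact closedSum_patch_of_eval E h _

lemma Move.proportional {S S' : Spherical} (h : Move S S') : Proportional S S' := by
  cases h with
  | iso h => exact ⟨1, one_pow _, fun p q => by rw [one_mul]; exact (h.closedSum_eq _).symm⟩
  | subdivide h => exact ⟨1, one_pow _, fun p q => by rw [one_mul]; exact (h.closedSum_eq _).symm⟩
  | typeI E k => exact .of_eval E (eval_kink k)
  | typeII E => exact .of_eval E eval_overlap
  | typeIII E k => exact .of_eval E (eval_strand k)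
  | typeIV E q o =>
    refine ⟨1, one_pow _, fun p t => ?_⟩
    rw [pairing_glue, pairing_glue, ← pow_zero Link.A]
    exact closedSum_patch_of_eval E (eval_closedHole q o t) _

lemma Isotopic.proportional {S S' : Spherical} (h : Isotopic S S') : Proportional S S' := by
  induction h with
  | rel S S' h => exact h.2.2.proportional
  | refl S => exact ⟨1, one_pow _, fun p q => (one_mul _).symm⟩
  | symm S S' _ ih => exact ih.symm
  | trans S S' S'' _ _ ih₁ ih₂ => exact ih₁.trans ih₂

/-- The induction carries a normalized matrix along: sums multiply its determinant by a square, and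
isotopies change only the root of unity. -/
lemma Reducible.exists_isNormalized {J S : Spherical} (h : Reducible J S) {z : ℂ}
    {N : Matrix (Fin 2) (Fin 2) ℤ} (hN : J.IsNormalized z N) :
    ∃ z' M, S.IsNormalized z' M ∧ ∃ n : ℤ, M.det = n ^ 2 * N.det := by
  induction h with
  | start => exact ⟨z, N, hN, 1, by ring⟩
  | sum hS k X hX ih =>
    obtain ⟨z', M, hM, n, hn⟩ := ih
    obtain ⟨z'', M', hM', n', hn'⟩ := hM.connectSum hX.isIntegral k
    exact ⟨z'', M', hM', n' * n, by rw [hn', hn]; ring⟩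
  | isotopic hS h ih =>
    obtain ⟨z', M, hM, n, hn⟩ := ih
    obtain ⟨z'', hM'⟩ := hM.proportional h.proportional
    exact ⟨z'', M, hM', n, hn⟩

lemma isNormalized_identity : identity.IsNormalized 1 1 := by
  rw [isNormalized_iff]
  simp [pairing_identity]

end Spherical

end TangleDiagram

theorem theorem4p20 :
    (∀ S : TangleDiagram.Spherical,
      TangleDiagram.Spherical.Reducible TangleDiagram.Spherical.identity S →
      ∃ (M : Matrix (Fin 2) (Fin 2) ℤ) (n : ℤ),
        TangleDiagram.Spherical.F S = {M, -M} ∧ M.det = n ^ 2) ∧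
    (∀ J S : TangleDiagram.Spherical,
      TangleDiagram.Spherical.IsPlanar J →
      TangleDiagram.Spherical.Reducible J S →
      ∃ (M N : Matrix (Fin 2) (Fin 2) ℤ) (n : ℤ),
        TangleDiagram.Spherical.F S = {M, -M} ∧ TangleDiagram.Spherical.F J = {N, -N} ∧
          M.det = n ^ 2 * N.det) := by
  refine ⟨fun S hS => ?_, fun J S hJ hS => ?_⟩
  · obtain ⟨z, M, hM, n, hn⟩ := hS.exists_isNormalized
      TangleDiagram.Spherical.isNormalized_identity
    exact ⟨M, n, hM.F_eq, by rw [hn, Matrix.det_one, mul_one]⟩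
  · obtain ⟨z, N, hN⟩ := hJ.exists_isNormalized
    obtain ⟨z', M, hM, n, hn⟩ := hS.exists_isNormalized hN
    exact ⟨M, N, n, hM.F_eq, hN.F_eq, hn⟩
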